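/- All polygons lie in the Euclidean plane. A pattern is a set of polygons (tiles); two tiles do not overlap if their interiors are disjoint, and a pattern is edge-to-edge if any two different tiles are disjoint or share exactly one vertex or exactly one entire edge. A symmetry of a pattern is an isometry of the plane that permutes its tiles. $C_k$ about a point $c$ is the group of the $k$ rotations about $c$ by multiples of $360^\circ/k$; $D_k$ about $c$ consists of these together with $k$ reflections in axes through $c$. Let $m\ge 5$ be an integer. There is an equilateral convex hexagon $ABCDEF$ with interior angles $$A=D=720^\circ/m,\qquad B=C=E=F=180^\circ-360^\circ/m. \tag{3}$$ Every such hexagon $H$ is a parallelohexagon (opposite edges are parallel and equal in length) and has the following properties. (a) Every straight line through the center of $H$ that meets two opposite edges of $H$ at relatively interior points cuts $H$ into two congruent convex pentagons. (b) There is an edge-to-edge pattern of non-overlapping congruent copies of $H$ that covers exactly the plane minus the interior of a regular $m$-gon (the hole) whose side length is the edge length of $H$. If $m\neq 6$, the symmetry group of this pattern is exactly $C_m$ about the center of the hole. If $m=6$ ($H$ is then a regular hexagon), it is $D_6$ about the center of the hole, so that it contains $C_6$. Moreover, for every line as in (a), if each copy of $H$ in this pattern is bisected along the copy of that line (carried over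 by the isometries that place the copies of $H$, chosen once for all lines), then the resulting congruent convex pentagons do not overlap and cover exactly the same set; this pattern is not edge-to-edge, and its symmetry group is exactly $C_m$ about the center of the hole (for $m=6$ also). (c) If $m=2n$ is even, then $H$ also satisfies the condition $$A=D=360^\circ/n,\qquad B=C=E=F=180^\circ-180^\circ/n,\qquad \text{all edges equal}, \tag{2}$$ and, besides the pattern in (b) with a regular $2n$-gonal hole, there is an edge-to-edge tiling of the whole plane by non-overlapping congruent copies of $H$ with $D_n$ symmetry: for some point $c$, the symmetries of the tiling that fix $c$ form exactly $D_n$ about $c$, and for $n\ge 4$ this is the whole symmetry group. If each copy of $H$ in this tiling is bisected along the copy of any line as in (a) (again carried over by placements chosen once for all lines), the resulting congruent convex pentagons form a non-edge-to-edge tiling of the plane; the symmetries of that tiling that fix $c$ form exactly the same group $D_n$ about $c$ if the line joins the midpoints of $BC$ and $EF$, and exactly $C_n$ about $c$ for every other line. -/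

import Mathlib

open scoped ComplexConjugate EuclideanGeometry

noncomputable section

/-! The Euclidean plane is `ℂ`; a polygon is Mathlib's `Polygon ℂ n`, its vertices listed in
cyclic order; a pattern is a set of polygons. -/

namespace PolygonPattern

/-- The closed solid region bounded by a convex polygon. -/
def region {n : ℕ} (P : Polygon ℂ n) : Set ℂ :=
  convexHull ℝ (Set.range P.vertices)

/-- `P 0, P 1, …, P (n - 1)` are, in this cyclic order (counterclockwise for `s = 1`, clockwise
for `s = -1`), the vertices of a strictly convex `n`-gon: every vertex off the edge from `P i` to
its successor lies strictly on the inner side of that edge. -/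
def IsConvexPolygon {n : ℕ} (P : Polygon ℂ n) : Prop :=
  ∃ s : ℝ, (s = 1 ∨ s = -1) ∧ ∀ i j : Fin n, j ≠ i → j ≠ finRotate n i →
    0 < s * (conj (P (finRotate n i) - P i) * (P j - P i)).im

/-- The interior angle of a convex polygon at the vertex `P i`, in radians. -/
def interiorAngle {n : ℕ} (P : Polygon ℂ n) (i : Fin n) : ℝ :=
  ∠ (P ((finRotate n).symm i)) (P i) (P (finRotate n i))

/-- All edges of the polygon have the same length. -/
def IsEquilateral {n : ℕ} (P : Polygon ℂ n) : Prop :=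
  ∀ i j : Fin n, dist (P i) (P (finRotate n i)) = dist (P j) (P (finRotate n j))

/-- Opposite edges of the hexagon are parallel and equal in length. -/
def IsParallelohexagon (H : Polygon ℂ 6) : Prop :=
  ∀ i : Fin 6, H (i + 1) - H i = H (i + 3) - H (i + 4)

/-- An equilateral convex hexagon `ABCDEF = H 0, …, H 5` with `A = D = 360°/n` and
`B = C = E = F = 180° - 180°/n`. -/
def TileCondition2 (n : ℕ) (H : Polygon ℂ 6) : Prop :=
  IsConvexPolygon H ∧ IsEquilateral H ∧
    (∀ i ∈ ({0, 3} : Set (Fin 6)), interiorAngle H i = 2 * Real.pi / n) ∧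
    (∀ i ∈ ({1, 2, 4, 5} : Set (Fin 6)), interiorAngle H i = Real.pi - Real.pi / n)

/-- An equilateral convex hexagon `ABCDEF = H 0, …, H 5` with `A = D = 720°/m` and
`B = C = E = F = 180° - 360°/m`. -/
def TileCondition3 (m : ℕ) (H : Polygon ℂ 6) : Prop :=
  IsConvexPolygon H ∧ IsEquilateral H ∧
    (∀ i ∈ ({0, 3} : Set (Fin 6)), interiorAngle H i = 4 * Real.pi / m) ∧
    (∀ i ∈ ({1, 2, 4, 5} : Set (Fin 6)), interiorAngle H i = Real.pi - 2 * Real.pi / m)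

/-- The regular `m`-gon with centre `c` and first vertex `c + w`. -/
def regularPolygon (m : ℕ) (c w : ℂ) : Polygon ℂ m :=
  ⟨fun k => c + w * Complex.exp (2 * Real.pi * Complex.I * (k : ℕ) / m)⟩

/-- The image of a polygon under an isometry of the plane. -/
def movePolygon {n : ℕ} (g : ℂ ≃ᵢ ℂ) (P : Polygon ℂ n) : Polygon ℂ n :=
  ⟨fun i => g (P i)⟩

/-- The congruent copies of `P` placed by the isometries in `G`. -/
def copies {n : ℕ} (G : Set (ℂ ≃ᵢ ℂ)) (P : Polygon ℂ n) : Set (Polygon ℂ n) :=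
  {Q | ∃ g ∈ G, Q = movePolygon g P}

/-- The pattern `T` covers exactly the set `S`, without overlaps except on the boundaries. -/
def Tiles {n : ℕ} (T : Set (Polygon ℂ n)) (S : Set ℂ) : Prop :=
  (⋃ P ∈ T, region P) = S ∧
    ∀ P ∈ T, ∀ Q ∈ T, region P ≠ region Q → Disjoint (interior (region P)) (interior (region Q))

/-- Any two different tiles are disjoint or share exactly one vertex or exactly one entire
edge. -/
def EdgeToEdge {n : ℕ} (T : Set (Polygon ℂ n)) : Prop :=
  ∀ P ∈ T, ∀ Q ∈ T, region P ≠ region Q →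
    region P ∩ region Q = ∅ ∨
    (∃ i j, P i = Q j ∧ region P ∩ region Q = {P i}) ∨
    (∃ i j, P.edgeSet ℝ i = Q.edgeSet ℝ j ∧ region P ∩ region Q = P.edgeSet ℝ i)

/-- The isometries of the plane that map the set of tiles of `T` onto itself. -/
def symmetries {n : ℕ} (T : Set (Polygon ℂ n)) : Set (ℂ ≃ᵢ ℂ) :=
  {g | (fun K : Set ℂ => g '' K) '' (region '' T) = region '' T}

/-- The point group of `T` at `c`: the symmetries of `T` that fix `c`. -/
def pointGroup {n : ℕ} (T : Set (Polygon ℂ n)) (c : ℂ) : Set (ℂ ≃ᵢ ℂ) :=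
  {g | g ∈ symmetries T ∧ g c = c}

/-- `C_n` about `c`: the rotations about `c` by the multiples of `360°/n`. -/
def cyclicSymmetries (n : ℕ) (c : ℂ) : Set (ℂ ≃ᵢ ℂ) :=
  {g | ∃ k : ℕ, ∀ z, g z = c + Complex.exp (2 * Real.pi * Complex.I * k / n) * (z - c)}

/-- `D_n` about `c`: the rotations in `C_n` and `n` reflections in axes through `c`. The unit
complex number `u` fixes the position of the axes: its square roots are the directions of one of
them. -/
def dihedralSymmetries (n : ℕ) (c u : ℂ) : Set (ℂ ≃ᵢ ℂ) :=
  cyclicSymmetries n c ∪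
  {g | ∃ k : ℕ, ∀ z,
    g z = c + u * Complex.exp (2 * Real.pi * Complex.I * k / n) * conj (z - c)}

/-- The centre of a parallelohexagon. -/
def hexagonCenter (H : Polygon ℂ 6) : ℂ := midpoint ℝ (H 0) (H 3)

/-- A straight line through the centre of the hexagon meets the edge from `H i` to `H (i + 1)` at
`x` and the opposite edge at `y`, both at relatively interior points. -/
def IsBisection (H : Polygon ℂ 6) (i : Fin 6) (x y : ℂ) : Prop :=
  x ∈ openSegment ℝ (H i) (H (i + 1)) ∧ y ∈ openSegment ℝ (H (i + 3)) (H (i + 4)) ∧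
    hexagonCenter H ∈ segment ℝ x y

/-- One of the two pentagons cut off by the line `xy`. -/
def firstHalf (H : Polygon ℂ 6) (i : Fin 6) (x y : ℂ) : Polygon ℂ 5 :=
  ⟨![x, H (i + 1), H (i + 2), H (i + 3), y]⟩

/-- The other of the two pentagons cut off by the line `xy`. -/
def secondHalf (H : Polygon ℂ 6) (i : Fin 6) (x y : ℂ) : Polygon ℂ 5 :=
  ⟨![y, H (i + 4), H (i + 5), H i, x]⟩

/-- The pattern of pentagons obtained from the copies of `H` placed by `G` when each copy is
bisected along the corresponding copy of the line `xy`. -/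
def bisectedPattern (G : Set (ℂ ≃ᵢ ℂ)) (H : Polygon ℂ 6) (i : Fin 6) (x y : ℂ) :
    Set (Polygon ℂ 5) :=
  copies G (firstHalf H i x y) ∪ copies G (secondHalf H i x y)

end PolygonPattern

end

/-!
Place a hexagon of the theorem with its first vertex at `0`. Its edge vectors are, up to an isometry,
`e₀, e₁, e₂, -e₀, -e₁, -e₂`, where `eₖ` is `edgeVec m r k`, the vector of length `r` at the angle
`2πk/m` (`TileCondition3.exists_eq_movePolygon`). So it is a parallelohexagon, its translates by
`e₀ + e₁` and `e₁ + e₂` form a lattice tiling, and its rotation by `2πk/m` has the edge vectors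
`eₖ, eₖ₊₁, eₖ₊₂`. Both patterns consist of `m` sectors; sector `k` is the quadrant of the `k`-th
rotated lattice tiling that lies between the directions `eₖ` and `eₖ₊₂`, moved to a corner `p k`.
Neighbouring sectors have a common zigzag boundary of edges `eₖ₊₁` and `eₖ₊₂`. All that is needed
of the corners is recorded in `IsFan`. For the hole, the corners are the vertices of a regular
`m`-gon (`holeCorner`); for even `m`, a tiling of the whole plane arises if the corners are alternately
`0` and the ends of the edges at `0` (`starCorner`).

*Non-overlap and edge-to-edge.* For any two tiles, the line of a suitable edge separates them
and meets them in at most a common vertex or edge (`compat_lattice`, `compat_adjacent`,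
`compat_far`).

*Covering.* The union of the tiles and the hole is closed, and it is a neighbourhood of each of its
points other than the vertices, because every directed edge of a tile occurs reversed in another tile
or in the hole (`IsFan.exists_hasEdge`). The vertices are countable, so they do not disconnect the
plane, and the union is everything (`IsFan.fanUnion_union_eq_univ`).

*Bisection.* A cut through the centre divides the hexagon into its parts on the two sides of a line,
which the point reflection interchanges (`IsBisection.halves`). The cut ends inside an edge. On the
boundary of two sectors, edges of different kinds meet, so some end of a cut is a vertex on one side
only, and the pentagons are not edge-to-edge (`IsFan.not_edgeToEdge`).

*Symmetries.* A symmetry preserves the union of the interiors of the tiles. Around the hole it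
preserves the hole, hence it is a rotation of the hole up to the reflection that fixes one vertex of the
hole (`eq_rotation_or_reflection`). For `m ≠ 6` that reflection moves an edge into the interior of
a tile (`reflection_not_mem_symmetries`). For `m = 6` it preserves the hexagons, and two tiles
impose incompatible conditions on the direction of the cut if it preserves the pentagons
(`reflection_not_mem_symmetries_six`). In the tiling of the plane, a symmetry that fixes `0` permutes
the edges at `0`; the reflection in the axis of a tile at `0` is a symmetry, and it preserves the
pentagons exactly if the cut is perpendicular to the axis (`midpoint_of_reflection_mem`). For
`m ≥ 7` the diameter of the hexagon is attained only by the diagonal from vertex `0` to vertex `3`, and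
the origin is the only point that is an end of this diagonal in every tile containing it, so every
symmetry fixes it (`apply_zero_of_mem_symmetries`).
-/

namespace PolygonPattern

open Set Filter Topology

noncomputable section

/-! ### Cross products in the plane -/

/-- The cross product of two plane vectors: the signed area of the parallelogram they span. -/
def cross (z w : ℂ) : ℝ := (conj z * w).im

lemma cross_eq (z w : ℂ) : cross z w = z.re * w.im - z.im * w.re := by
  simp [cross]; ring

lemma cross_add_right (u z w : ℂ) : cross u (z + w) = cross u z + cross u w := by
  simp [cross_eq]; ring

lemma cross_sub_right (u z w : ℂ) : cross u (z - w) = cross u z - cross u w := by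
  simp [cross_eq]; ring

lemma cross_add_left (u z w : ℂ) : cross (z + w) u = cross z u + cross w u := by
  simp [cross_eq]; ring

lemma cross_neg_right (u z : ℂ) : cross u (-z) = -cross u z := by
  simp [cross_eq]; ring

lemma cross_neg_left (u z : ℂ) : cross (-u) z = -cross u z := by
  simp [cross_eq]; ring

lemma cross_smul_right (t : ℝ) (u z : ℂ) : cross u (t • z) = t * cross u z := by
  simp [cross_eq]; ring

lemma cross_smul_left (t : ℝ) (u z : ℂ) : cross (t • u) z = t * cross u z := by
  simp [cross_eq]; ring

lemma cross_self (u : ℂ) : cross u u = 0 := by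
  simp [cross_eq]; ring

lemma cross_zero_right (u : ℂ) : cross u 0 = 0 := by simp [cross_eq]

lemma cross_zero_left (u : ℂ) : cross 0 u = 0 := by simp [cross_eq]

lemma cross_swap (u v : ℂ) : cross u v = -cross v u := by simp [cross_eq]; ring

lemma cross_mul_mul (u z w : ℂ) : cross (u * z) (u * w) = ‖u‖ ^ 2 * cross z w := by
  rw [← Complex.normSq_eq_norm_sq, Complex.normSq_apply]
  simp [cross_eq]; ring

lemma cross_conj_conj (z w : ℂ) : cross (conj z) (conj w) = -cross z w := by
  simp [cross_eq]; ring

lemma continuous_cross (u : ℂ) : Continuous (cross u) := by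
  unfold cross; fun_prop

lemma isLinearMap_cross (u : ℂ) : IsLinearMap ℝ (cross u) :=
  ⟨cross_add_right u, fun t z => cross_smul_right t u z⟩

lemma cross_I_mul_pos {u : ℂ} (hu : u ≠ 0) : 0 < cross u (Complex.I * u) := by
  have : cross u (Complex.I * u) = Complex.normSq u := by
    simp [cross_eq, Complex.normSq_apply]
  rw [this]; exact Complex.normSq_pos.2 hu

lemma ne_zero_of_cross_pos {u v : ℂ} (h : 0 < cross u v) : u ≠ 0 := by
  rintro rfl; simp [cross_zero_left] at h

/-- Cramer's rule in the plane. -/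
lemma eq_combination {e f : ℂ} (h : 0 < cross e f) (z : ℂ) :
    z = (cross z f / cross e f) • e + (cross e z / cross e f) • f := by
  have h' := h.ne'
  rw [cross_eq] at h'
  apply Complex.ext
  · simp only [Complex.add_re, Complex.smul_re, smul_eq_mul, cross_eq]
    rw [div_mul_eq_mul_div, div_mul_eq_mul_div, ← add_div, eq_div_iff h']; ring
  · simp only [Complex.add_im, Complex.smul_im, smul_eq_mul, cross_eq]
    rw [div_mul_eq_mul_div, div_mul_eq_mul_div, ← add_div, eq_div_iff h']; ring

/-! ### Convex polygons as intersections of half-planes -/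

/-- Strict convexity of a polygon whose vertices are listed counterclockwise. -/
def IsCCW {n : ℕ} (P : Polygon ℂ n) : Prop :=
  ∀ i j : Fin n, j ≠ i → j ≠ finRotate n i →
    0 < cross (P (finRotate n i) - P i) (P j - P i)

lemma IsCCW.isConvexPolygon {n : ℕ} {P : Polygon ℂ n} (h : IsCCW P) : IsConvexPolygon P :=
  ⟨1, Or.inl rfl, fun i j h1 h2 => by simpa [cross] using h i j h1 h2⟩

lemma finRotate_ne_self {n : ℕ} (hn : 3 ≤ n) (i : Fin n) : finRotate n i ≠ i := by
  obtain ⟨k, rfl⟩ := Nat.exists_eq_add_of_le' hn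
  rw [finRotate_apply]
  intro h
  simp at h

lemma finRotate_finRotate_ne_self {n : ℕ} (hn : 3 ≤ n) (i : Fin n) :
    finRotate n (finRotate n i) ≠ i := by
  obtain ⟨k, rfl⟩ := Nat.exists_eq_add_of_le' hn
  rw [finRotate_apply, finRotate_apply, add_assoc]
  intro h
  have : (1 + 1 : Fin (k + 3)) = 0 := by simpa using h
  rw [Fin.ext_iff, Fin.val_add] at this
  simp only [Fin.val_one, Fin.val_zero] at this
  rw [Nat.mod_eq_of_lt (by omega)] at this
  omega

lemma finRotate_ne_symm {n : ℕ} (hn : 3 ≤ n) (i : Fin n) :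
    finRotate n i ≠ (finRotate n).symm i := by
  intro h
  apply finRotate_finRotate_ne_self hn i
  rw [h, Equiv.apply_symm_apply]

lemma symm_ne_self {n : ℕ} (hn : 3 ≤ n) (i : Fin n) : (finRotate n).symm i ≠ i := by
  intro h
  apply finRotate_ne_self hn i
  conv_lhs => rw [← h]
  rw [Equiv.apply_symm_apply]

section CCW

variable {n : ℕ} {P : Polygon ℂ n}

/-- The inward affine functional of the edge from `P i` to its successor. -/
def edgeFn (P : Polygon ℂ n) (i : Fin n) (w : ℂ) : ℝ :=
  cross (P (finRotate n i) - P i) (w - P i)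

lemma continuous_edgeFn (P : Polygon ℂ n) (i : Fin n) : Continuous (edgeFn P i) :=
  (continuous_cross _).comp (by fun_prop)

lemma edgeFn_self (P : Polygon ℂ n) (i : Fin n) : edgeFn P i (P i) = 0 := by
  simp [edgeFn, cross_zero_right]

lemma edgeFn_next (P : Polygon ℂ n) (i : Fin n) : edgeFn P i (P (finRotate n i)) = 0 := by
  simp [edgeFn, cross_self]

lemma edgeFn_symm_self (P : Polygon ℂ n) (i : Fin n) :
    edgeFn P ((finRotate n).symm i) (P i) = 0 := by
  have := edgeFn_next P ((finRotate n).symm i)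
  rwa [Equiv.apply_symm_apply] at this

/-- Edge functionals are affine. -/
lemma edgeFn_combo (P : Polygon ℂ n) (i : Fin n) (z w : ℂ) (s t : ℝ) (h : s + t = 1) :
    edgeFn P i (s • z + t • w) = s * edgeFn P i z + t * edgeFn P i w := by
  obtain rfl : s = 1 - t := by linarith
  simp [edgeFn, cross_eq]; ring

lemma edgeFn_add (P : Polygon ℂ n) (i : Fin n) (z w : ℂ) :
    edgeFn P i (z + w) = edgeFn P i z + cross (P (finRotate n i) - P i) w := by
  simp [edgeFn, cross_eq]; ring

lemma IsCCW.edgeFn_nonneg (h : IsCCW P) (i j : Fin n) : 0 ≤ edgeFn P i (P j) := by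
  by_cases h1 : j = i
  · rw [h1, edgeFn_self]
  by_cases h2 : j = finRotate n i
  · rw [h2, edgeFn_next]
  exact (h i j h1 h2).le

lemma vertex_mem_region (P : Polygon ℂ n) (i : Fin n) : P i ∈ region P :=
  subset_convexHull ℝ _ ⟨i, rfl⟩

lemma convex_region (P : Polygon ℂ n) : Convex ℝ (region P) := convex_convexHull ℝ _

lemma isCompact_region (P : Polygon ℂ n) : IsCompact (region P) :=
  (Set.finite_range _).isCompact_convexHull (𝕜 := ℝ)

lemma isClosed_region (P : Polygon ℂ n) : IsClosed (region P) := (isCompact_region P).isClosed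

lemma segment_subset_region (P : Polygon ℂ n) (i j : Fin n) :
    segment ℝ (P i) (P j) ⊆ region P :=
  (convex_region P).segment_subset (vertex_mem_region P i) (vertex_mem_region P j)

/-- An affine functional that is bounded below at the vertices is bounded below on the region. -/
lemma le_cross_of_mem_region {u : ℂ} {t : ℝ} (h : ∀ i, t ≤ cross u (P i)) {z : ℂ}
    (hz : z ∈ region P) : t ≤ cross u z := by
  have : region P ⊆ {w | t ≤ cross u w} :=
    convexHull_min (by rintro _ ⟨i, rfl⟩; exact h i) (convex_halfSpace_ge (isLinearMap_cross u) t)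
  exact this hz

lemma IsCCW.edgeFn_nonneg_of_mem (h : IsCCW P) (i : Fin n) {z : ℂ} (hz : z ∈ region P) :
    0 ≤ edgeFn P i z := by
  have := le_cross_of_mem_region (P := P) (u := P (finRotate n i) - P i)
    (t := cross (P (finRotate n i) - P i) (P i)) (fun j => by
      have := h.edgeFn_nonneg i j
      rw [edgeFn, cross_sub_right] at this; linarith) hz
  rw [edgeFn, cross_sub_right]; linarith

lemma IsCCW.prev_pos (h : IsCCW P) (hn : 3 ≤ n) (i : Fin n) :
    0 < cross (P (finRotate n i) - P i) (P ((finRotate n).symm i) - P i) :=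
  h i _ (symm_ne_self hn i) (finRotate_ne_symm hn i).symm

/-- A point in the angle at the vertex `P i`, in coordinates along the two edges. -/
lemma IsCCW.exists_coords (h : IsCCW P) (hn : 3 ≤ n) (i : Fin n) (w : ℂ) :
    ∃ x y : ℝ, w = P i + x • (P (finRotate n i) - P i) + y • (P ((finRotate n).symm i) - P i) ∧
      edgeFn P i w = y * cross (P (finRotate n i) - P i) (P ((finRotate n).symm i) - P i) ∧
      edgeFn P ((finRotate n).symm i) w =
        x * cross (P (finRotate n i) - P i) (P ((finRotate n).symm i) - P i) := by
  have hp := h.prev_pos hn i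
  have hc := eq_combination hp (w - P i)
  set e := P (finRotate n i) - P i
  set f := P ((finRotate n).symm i) - P i with hf
  refine ⟨_, _, by rw [add_assoc, ← hc]; ring, ?_, ?_⟩
  · rw [div_mul_cancel₀ _ hp.ne']; rfl
  · rw [div_mul_cancel₀ _ hp.ne', edgeFn, Equiv.apply_symm_apply]
    have : P ((finRotate n).symm i) = P i + f := by rw [hf]; ring
    rw [this]
    simp [cross_eq]; ring

/-- The region of a strictly convex polygon is the intersection of the half-planes of its edges.
A point outside would be separated from the region by a linear functional; at a vertex where this
functional is maximal it cannot increase along either edge, hence nowhere in the angle there. -/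
theorem IsCCW.mem_region_iff (h : IsCCW P) (hn : 3 ≤ n) {w : ℂ} :
    w ∈ region P ↔ ∀ i, 0 ≤ edgeFn P i w := by
  refine ⟨fun hw i => h.edgeFn_nonneg_of_mem i hw, fun hw => ?_⟩
  by_contra hnot
  obtain ⟨f, u, hu1, hu2⟩ :=
    geometric_hahn_banach_closed_point (convex_region P) (isClosed_region P) hnot
  have : Nonempty (Fin n) := ⟨⟨0, by omega⟩⟩
  obtain ⟨i, hi⟩ := Finite.exists_max (fun j : Fin n => f (P j))
  obtain ⟨x, y, hxy, hy, hx⟩ := h.exists_coords hn i w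
  have hp := h.prev_pos hn i
  have hy0 : 0 ≤ y := by
    by_contra hneg
    have := hw i
    rw [hy] at this
    nlinarith
  have hx0 : 0 ≤ x := by
    by_contra hneg
    have := hw ((finRotate n).symm i)
    rw [hx] at this
    nlinarith
  have h1 := hi (finRotate n i)
  have h2 := hi ((finRotate n).symm i)
  have h3 := hu1 _ (vertex_mem_region P i)
  have h4 : f w = f (P i) + x * (f (P (finRotate n i)) - f (P i)) +
      y * (f (P ((finRotate n).symm i)) - f (P i)) := by
    conv_lhs => rw [hxy]
    simp only [map_add, map_smul, map_sub, smul_eq_mul]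
  nlinarith [mul_nonneg hx0 (sub_nonneg.2 h1), mul_nonneg hy0 (sub_nonneg.2 h2)]

lemma IsCCW.edge_ne_zero (h : IsCCW P) (hn : 3 ≤ n) (i : Fin n) : P (finRotate n i) - P i ≠ 0 :=
  ne_zero_of_cross_pos (h.prev_pos hn i)

/-- The interior of the region consists of the points strictly inside every edge. -/
theorem IsCCW.mem_interior_iff (h : IsCCW P) (hn : 3 ≤ n) {w : ℂ} :
    w ∈ interior (region P) ↔ ∀ i, 0 < edgeFn P i w := by
  constructor
  · intro hw i
    refine lt_of_le_of_ne (h.edgeFn_nonneg_of_mem i (interior_subset hw)) (fun h0 => ?_)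
    set e := P (finRotate n i) - P i with he
    have hc : ContinuousAt (fun t : ℝ => w - t • (Complex.I * e)) 0 := by fun_prop
    have hmem : ∀ᶠ t : ℝ in 𝓝 0, w - t • (Complex.I * e) ∈ region P := by
      apply hc
      simpa using mem_interior_iff_mem_nhds.1 hw
    obtain ⟨t, ht, htpos⟩ :=
      ((hmem.filter_mono nhdsWithin_le_nhds).and (self_mem_nhdsWithin (s := Ioi (0 : ℝ)))).exists
    have h1 := h.edgeFn_nonneg_of_mem i ht
    rw [sub_eq_add_neg, edgeFn_add, ← h0, cross_neg_right, cross_smul_right] at h1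
    have h2 := mul_pos htpos (cross_I_mul_pos (h.edge_ne_zero hn i))
    linarith
  · intro hw
    have ho : IsOpen {w | ∀ i, 0 < edgeFn P i w} := by
      rw [show {w | ∀ i, 0 < edgeFn P i w} = ⋂ i, {w | 0 < edgeFn P i w} by ext; simp]
      exact isOpen_iInter_of_finite fun i => isOpen_lt continuous_const (continuous_edgeFn P i)
    exact mem_interior.2 ⟨_, fun z hz => (h.mem_region_iff hn).2 fun i => (hz i).le, ho, hw⟩

/-- A point of the region on the line of an edge lies on that edge. -/
lemma IsCCW.mem_segment (h : IsCCW P) (hn : 3 ≤ n) {i : Fin n} {w : ℂ} (hw : w ∈ region P)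
    (h0 : edgeFn P i w = 0) : w ∈ segment ℝ (P i) (P (finRotate n i)) := by
  obtain ⟨x, y, hxy, hy, hx⟩ := h.exists_coords hn i w
  have hp := h.prev_pos hn i
  obtain rfl : y = 0 := by
    rw [h0] at hy
    rcases mul_eq_zero.1 hy.symm with h' | h'
    · exact h'
    · exact absurd h' hp.ne'
  have hx0 : 0 ≤ x := by
    have := h.edgeFn_nonneg_of_mem ((finRotate n).symm i) hw
    rw [hx] at this
    exact nonneg_of_mul_nonneg_left this hp
  have hw' : w = (1 - x) • P i + x • P (finRotate n i) := by
    rw [hxy]; simp only [smul_sub, zero_smul, sub_smul, one_smul]; ring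
  have hx1 : x ≤ 1 := by
    have h1 := h.edgeFn_nonneg_of_mem (finRotate n i) hw
    rw [hw', edgeFn_combo _ _ _ _ _ _ (by ring), edgeFn_self, mul_zero, add_zero] at h1
    have h2 : 0 < edgeFn P (finRotate n i) (P i) :=
      h _ _ (finRotate_ne_self hn i).symm (finRotate_finRotate_ne_self hn i).symm
    have := nonneg_of_mul_nonneg_left h1 h2
    linarith
  exact ⟨1 - x, x, by linarith, hx0, by ring, hw'.symm⟩

/-- At a relatively interior point of an edge, the other edge functionals are positive. -/
lemma IsCCW.edgeFn_pos_of_mem_openSegment (h : IsCCW P) (hn : 3 ≤ n) {i i' : Fin n}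
    (hne : i' ≠ i) {w : ℂ} (hw : w ∈ openSegment ℝ (P i) (P (finRotate n i))) :
    0 < edgeFn P i' w := by
  obtain ⟨s, t, hs, ht, hst, rfl⟩ := hw
  rw [edgeFn_combo _ _ _ _ _ _ hst]
  have h1 := h.edgeFn_nonneg i' i
  have h2 := h.edgeFn_nonneg i' (finRotate n i)
  by_cases hi : i = finRotate n i'
  · have : 0 < edgeFn P i' (P (finRotate n i)) := by
      refine h _ _ ?_ ?_
      · rw [hi]; exact finRotate_finRotate_ne_self hn i'
      · rw [hi]; exact finRotate_ne_self hn _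
    have h3 := mul_pos ht this
    have h4 := mul_nonneg hs.le h1
    linarith
  · have : 0 < edgeFn P i' (P i) := h _ _ hne.symm hi
    have h3 := mul_pos hs this
    have h4 := mul_nonneg ht.le h2
    linarith

lemma edgeFn_of_mem_openSegment {i : Fin n} {w : ℂ}
    (hw : w ∈ openSegment ℝ (P i) (P (finRotate n i))) : edgeFn P i w = 0 := by
  obtain ⟨s, t, hs, ht, hst, rfl⟩ := hw
  rw [edgeFn_combo _ _ _ _ _ _ hst, edgeFn_self, edgeFn_next]; ring

/-- Near a relatively interior point of an edge, the region is the half-plane of that edge. -/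
lemma IsCCW.eventually_mem_region (h : IsCCW P) (hn : 3 ≤ n) {i : Fin n} {z : ℂ}
    (hz : z ∈ openSegment ℝ (P i) (P (finRotate n i))) :
    ∀ᶠ w in 𝓝 z, 0 ≤ edgeFn P i w → w ∈ region P := by
  have : ∀ i', ∀ᶠ w in 𝓝 z, i' ≠ i → 0 < edgeFn P i' w := by
    intro i'
    by_cases hne : i' = i
    · simp [hne]
    · have := (continuous_edgeFn P i').continuousAt.eventually
        (lt_mem_nhds (h.edgeFn_pos_of_mem_openSegment hn hne hz))
      filter_upwards [this] with w hw _ using hw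
  filter_upwards [eventually_all.2 this] with w hw h0
  refine (h.mem_region_iff hn).2 fun i' => ?_
  by_cases hne : i' = i
  · rwa [hne]
  · exact (hw i' hne).le

/-- A point of the region is an interior point, a vertex, or relatively interior to an edge. -/
lemma IsCCW.trichotomy (h : IsCCW P) (hn : 3 ≤ n) {z : ℂ} (hz : z ∈ region P) :
    region P ∈ 𝓝 z ∨ (∃ i, z = P i) ∨ ∃ i, z ∈ openSegment ℝ (P i) (P (finRotate n i)) := by
  by_cases hpos : ∀ i, 0 < edgeFn P i z
  · exact Or.inl (mem_interior_iff_mem_nhds.1 ((h.mem_interior_iff hn).2 hpos))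
  · push Not at hpos
    obtain ⟨i, hi⟩ := hpos
    have h0 := le_antisymm hi (h.edgeFn_nonneg_of_mem i hz)
    have hs := h.mem_segment hn hz h0
    rw [← insert_endpoints_openSegment] at hs
    rcases hs with hs | hs | hs
    · exact Or.inr (Or.inl ⟨_, hs⟩)
    · exact Or.inr (Or.inl ⟨_, hs⟩)
    · exact Or.inr (Or.inr ⟨_, hs⟩)

lemma IsCCW.interior_nonempty (h : IsCCW P) (hn : 3 ≤ n) : (interior (region P)).Nonempty := by
  have i : Fin n := ⟨0, by omega⟩
  set j := finRotate n i
  set k := finRotate n j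
  -- the midpoint of an edge, pushed towards the inside
  have hm : (1 / 2 : ℝ) • P i + (1 / 2 : ℝ) • P j ∈ openSegment ℝ (P i) (P j) :=
    ⟨1 / 2, 1 / 2, by norm_num, by norm_num, by norm_num, rfl⟩
  set z := (1 / 2 : ℝ) • P i + (1 / 2 : ℝ) • P j
  have hk : 0 < edgeFn P i (P k) :=
    h _ _ (finRotate_finRotate_ne_self hn i) (finRotate_ne_self hn _)
  refine ⟨(1 / 2 : ℝ) • z + (1 / 2 : ℝ) • P k, (h.mem_interior_iff hn).2 fun i' => ?_⟩
  rw [edgeFn_combo _ _ _ _ _ _ (by norm_num)]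
  have h2 := h.edgeFn_nonneg i' k
  by_cases hne : i' = i
  · subst hne
    rw [edgeFn_of_mem_openSegment hm]; linarith
  · have := h.edgeFn_pos_of_mem_openSegment hn hne hm
    linarith

lemma IsCCW.closure_interior (h : IsCCW P) (hn : 3 ≤ n) :
    closure (interior (region P)) = region P := by
  rw [(convex_region P).closure_interior_eq_closure_of_nonempty_interior (h.interior_nonempty hn),
    (isClosed_region P).closure_eq]

/-- A direction pointing strictly into the angle at a vertex leads into the interior. -/
lemma IsCCW.eventually_mem_interior (h : IsCCW P) (hn : 3 ≤ n) (i : Fin n) {d : ℂ}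
    (h1 : 0 < cross (P (finRotate n i) - P i) d)
    (h2 : 0 < cross d (P ((finRotate n).symm i) - P i)) :
    ∀ᶠ t : ℝ in 𝓝[>] 0, P i + t • d ∈ interior (region P) := by
  have key : ∀ i', ∀ᶠ t : ℝ in 𝓝[>] 0, 0 < edgeFn P i' (P i + t • d) := by
    intro i'
    by_cases hi : i' = i
    · subst hi
      filter_upwards [self_mem_nhdsWithin] with t ht
      rw [edgeFn_add, edgeFn_self, cross_smul_right, zero_add]
      exact mul_pos ht h1
    by_cases hi' : i' = (finRotate n).symm i
    · subst hi'
      filter_upwards [self_mem_nhdsWithin] with t ht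
      rw [edgeFn_add, edgeFn_symm_self, cross_smul_right, zero_add, Equiv.apply_symm_apply]
      refine mul_pos ht ?_
      rwa [cross_swap, ← cross_neg_left, neg_sub] at h2
    · have hpos : 0 < edgeFn P i' (P i) := by
        refine h _ _ (Ne.symm hi) ?_
        rintro rfl
        rw [Equiv.symm_apply_apply] at hi'
        exact hi' rfl
      have hc : ContinuousAt (fun t : ℝ => edgeFn P i' (P i + t • d)) 0 :=
        ((continuous_edgeFn P i').comp (by fun_prop)).continuousAt
      refine (hc.eventually (lt_mem_nhds ?_)).filter_mono nhdsWithin_le_nhds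
      simpa using hpos
  filter_upwards [eventually_all.2 key] with t ht using (h.mem_interior_iff hn).2 ht

/-- Edge points are not interior. -/
lemma IsCCW.not_mem_interior_of_mem_segment (h : IsCCW P) (hn : 3 ≤ n) {i : Fin n} {z : ℂ}
    (hz : z ∈ segment ℝ (P i) (P (finRotate n i))) : z ∉ interior (region P) := by
  intro hi
  have := (h.mem_interior_iff hn).1 hi i
  obtain ⟨s, t, hs, ht, hst, rfl⟩ := hz
  rw [edgeFn_combo _ _ _ _ _ _ hst, edgeFn_self, edgeFn_next] at this
  simp at this

/-- The vertices of a strictly convex polygon are not relatively interior to segments in it. -/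
lemma IsCCW.vertex_not_mem_openSegment (h : IsCCW P) (hn : 3 ≤ n) (i : Fin n) {z w : ℂ}
    (hz : z ∈ region P) (hw : w ∈ region P) (hi : P i ∈ openSegment ℝ z w) : z = w := by
  obtain ⟨s, t, hs, ht, hst, hP⟩ := hi
  have aux : ∀ i', edgeFn P i' (P i) = 0 → edgeFn P i' z = 0 ∧ edgeFn P i' w = 0 := by
    intro i' h0
    rw [← hP, edgeFn_combo _ _ _ _ _ _ hst] at h0
    have h1 := h.edgeFn_nonneg_of_mem i' hz
    have h2 := h.edgeFn_nonneg_of_mem i' hw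
    constructor <;> nlinarith [mul_nonneg hs.le h1, mul_nonneg ht.le h2]
  have hp := h.prev_pos hn i
  have aux2 : ∀ v, edgeFn P i v = 0 → edgeFn P ((finRotate n).symm i) v = 0 → v = P i := by
    intro v h1 h2
    obtain ⟨x, y, hxy, hy, hx⟩ := h.exists_coords hn i v
    rw [h1] at hy; rw [h2] at hx
    have hy' : y = 0 := (mul_eq_zero.1 hy.symm).resolve_right hp.ne'
    have hx' : x = 0 := (mul_eq_zero.1 hx.symm).resolve_right hp.ne'
    rw [hxy, hx', hy']; simp
  have a1 := aux i (edgeFn_self P i)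
  have a2 := aux ((finRotate n).symm i) (edgeFn_symm_self P i)
  rw [aux2 z a1.1 a2.1, aux2 w a1.2 a2.2]

end CCW

/-! ### Centrally symmetric hexagons and their halves -/

/-- The hexagon with first vertex `v` and consecutive edge vectors `a, b, c, -a, -b, -c`. -/
def zonogon (v a b c : ℂ) : Polygon ℂ 6 :=
  ⟨![v, v + a, v + a + b, v + a + b + c, v + b + c, v + c]⟩

/-- The pentagon cut off from `zonogon v a b c` by the line through its centre that meets the first
edge at `v + t • a`. -/
def pentagon (v a b c : ℂ) (t : ℝ) : Polygon ℂ 5 :=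
  ⟨![v + t • a, v + a, v + a + b, v + a + b + c, v + a + b + c - t • a]⟩

/-- The directions of `a, b, c` turn counterclockwise by less than a half-turn in total. -/
def Turning (a b c : ℂ) : Prop := 0 < cross a b ∧ 0 < cross b c ∧ 0 < cross a c

section Zonogon

variable {v a b c : ℂ}

lemma zonogon_isCCW (h : Turning a b c) : IsCCW (zonogon v a b c) := by
  obtain ⟨h1, h2, h3⟩ := h
  rw [cross_eq] at h1 h2 h3
  intro i j hij hij'
  fin_cases i <;> fin_cases j <;> first
    | exact absurd rfl hij
    | exact absurd rfl hij'
    | (simp [zonogon, cross_eq]; linarith)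

lemma pentagon_isCCW (h : Turning a b c) {t : ℝ} (ht0 : 0 < t) (ht1 : t < 1) :
    IsCCW (pentagon v a b c t) := by
  obtain ⟨h1, h2, h3⟩ := h
  rw [cross_eq] at h1 h2 h3
  have ht1' : 0 < 1 - t := by linarith
  have e1 := mul_pos ht0 h1
  have e2 := mul_pos ht0 h2
  have e3 := mul_pos ht0 h3
  have f1 := mul_pos ht1' h1
  have f2 := mul_pos ht1' h2
  have f3 := mul_pos ht1' h3
  have g1 := mul_pos ht0 f1
  have g3 := mul_pos ht0 f3
  have k1 := mul_pos ht0 e1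
  have k3 := mul_pos ht0 e3
  intro i j hij hij'
  fin_cases i <;> fin_cases j <;> first
    | exact absurd rfl hij
    | exact absurd rfl hij'
    | (simp [pentagon, cross_eq]; linarith)

lemma mem_region_zonogon (h : Turning a b c) {w : ℂ} :
    w ∈ region (zonogon v a b c) ↔
      (0 ≤ cross a (w - v) ∧ 0 ≤ cross b (w - (v + a)) ∧ 0 ≤ cross c (w - (v + a + b)) ∧
      0 ≤ cross (-a) (w - (v + a + b + c)) ∧ 0 ≤ cross (-b) (w - (v + b + c)) ∧
      0 ≤ cross (-c) (w - (v + c))) := by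
  rw [(zonogon_isCCW h).mem_region_iff (by norm_num)]
  have e0 : edgeFn (zonogon v a b c) 0 w = cross a (w - v) := by
    simp [edgeFn, zonogon]
  have e1 : edgeFn (zonogon v a b c) 1 w = cross b (w - (v + a)) := by
    simp [edgeFn, zonogon]
  have e2 : edgeFn (zonogon v a b c) 2 w = cross c (w - (v + a + b)) := by
    simp [edgeFn, zonogon]
  have e3 : edgeFn (zonogon v a b c) 3 w = cross (-a) (w - (v + a + b + c)) := by
    simp [edgeFn, zonogon, cross_eq]
  have e4 : edgeFn (zonogon v a b c) 4 w = cross (-b) (w - (v + b + c)) := by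
    simp [edgeFn, zonogon, cross_eq]
  have e5 : edgeFn (zonogon v a b c) 5 w = cross (-c) (w - (v + c)) := by
    simp [edgeFn, zonogon, cross_eq]
  rw [← e0, ← e1, ← e2, ← e3, ← e4, ← e5]
  constructor
  · intro hw; exact ⟨hw 0, hw 1, hw 2, hw 3, hw 4, hw 5⟩
  · rintro ⟨h0, h1, h2, h3, h4, h5⟩ i
    fin_cases i <;> assumption

lemma mem_region_pentagon (h : Turning a b c) {t : ℝ} (ht0 : 0 < t) (ht1 : t < 1) {w : ℂ} :
    w ∈ region (pentagon v a b c t) ↔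
      (0 ≤ cross a (w - v) ∧ 0 ≤ cross b (w - (v + a)) ∧ 0 ≤ cross c (w - (v + a + b)) ∧
      0 ≤ cross (-a) (w - (v + a + b + c)) ∧
      0 ≤ cross ((v + t • a) - (v + a + b + c - t • a)) (w - (v + t • a))) := by
  rw [(pentagon_isCCW h ht0 ht1).mem_region_iff (by norm_num)]
  have e0 : edgeFn (pentagon v a b c t) 0 w = (1 - t) * cross a (w - v) := by
    simp [edgeFn, pentagon, cross_eq]; ring
  have e1 : edgeFn (pentagon v a b c t) 1 w = cross b (w - (v + a)) := by
    simp [edgeFn, pentagon]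
  have e2 : edgeFn (pentagon v a b c t) 2 w = cross c (w - (v + a + b)) := by
    simp [edgeFn, pentagon]
  have e3 : edgeFn (pentagon v a b c t) 3 w = t * cross (-a) (w - (v + a + b + c)) := by
    simp [edgeFn, pentagon, cross_eq]; ring
  have e4 : edgeFn (pentagon v a b c t) 4 w =
      cross ((v + t • a) - (v + a + b + c - t • a)) (w - (v + t • a)) := by
    simp [edgeFn, pentagon, cross_eq]; ring
  have ht1' : 0 < 1 - t := by linarith
  constructor
  · intro hw
    refine ⟨?_, e1 ▸ hw 1, e2 ▸ hw 2, ?_, e4 ▸ hw 4⟩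
    · have := hw 0; rw [e0] at this; exact nonneg_of_mul_nonneg_right this ht1'
    · have := hw 3; rw [e3] at this; exact nonneg_of_mul_nonneg_right this ht0
  · rintro ⟨h0, h1, h2, h3, h4⟩ i
    fin_cases i
    · exact e0 ▸ mul_nonneg ht1'.le h0
    · exact e1 ▸ h1
    · exact e2 ▸ h2
    · exact e3 ▸ mul_nonneg ht0.le h3
    · exact e4 ▸ h4

/-- A hexagon of this kind can be listed starting from any of its vertices. -/
lemma exists_rebase (h : Turning a b c) (i : Fin 6) :
    ∃ v' a' b' c', Turning a' b' c' ∧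
      (∀ j, zonogon v a b c (i + j) = zonogon v' a' b' c' j) ∧
      region (zonogon v' a' b' c') = region (zonogon v a b c) ∧
      v' + v' + a' + b' + c' = v + v + a + b + c ∧
      a' = zonogon v a b c (i + 1) - zonogon v a b c i := by
  have key : ∀ v' a' b' c', (∀ j, zonogon v a b c (i + j) = zonogon v' a' b' c' j) →
      region (zonogon v' a' b' c') = region (zonogon v a b c) ∧
      a' = zonogon v a b c (i + 1) - zonogon v a b c i := by
    intro v' a' b' c' hj
    constructor
    · unfold region
      congr 1
      ext z
      constructor
      · rintro ⟨j, rfl⟩; exact ⟨i + j, hj j⟩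
      · rintro ⟨j, rfl⟩; exact ⟨j - i, by rw [← hj]; congr 1; abel⟩
    · have h0 := hj 0
      rw [add_zero] at h0
      rw [hj, h0]; simp [zonogon]
  obtain ⟨h1, h2, h3⟩ := h
  have main : ∃ v' a' b' c', Turning a' b' c' ∧
      (∀ j, zonogon v a b c (i + j) = zonogon v' a' b' c' j) ∧
      v' + v' + a' + b' + c' = v + v + a + b + c := by
    rw [cross_eq] at h1 h2 h3
    fin_cases i
    · refine ⟨v, a, b, c, ?_, ?_, by ring⟩
      · refine ⟨?_, ?_, ?_⟩ <;> rw [cross_eq] <;> assumption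
      · intro j; fin_cases j <;> rfl
    · refine ⟨v + a, b, c, -a, ?_, ?_, by ring⟩
      · refine ⟨?_, ?_, ?_⟩ <;> rw [cross_eq] <;> simp <;> linarith
      · intro j; fin_cases j <;> simp [zonogon] <;> ring
    · refine ⟨v + a + b, c, -a, -b, ?_, ?_, by ring⟩
      · refine ⟨?_, ?_, ?_⟩ <;> rw [cross_eq] <;> simp <;> linarith
      · intro j; fin_cases j <;> simp [zonogon] <;> ring
    · refine ⟨v + a + b + c, -a, -b, -c, ?_, ?_, by ring⟩
      · refine ⟨?_, ?_, ?_⟩ <;> rw [cross_eq] <;> simp <;> linarith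
      · intro j; fin_cases j <;> simp [zonogon] <;> ring
    · refine ⟨v + b + c, -b, -c, a, ?_, ?_, by ring⟩
      · refine ⟨?_, ?_, ?_⟩ <;> rw [cross_eq] <;> simp <;> linarith
      · intro j; fin_cases j <;> simp [zonogon] <;> ring
    · refine ⟨v + c, -c, a, b, ?_, ?_, by ring⟩
      · refine ⟨?_, ?_, ?_⟩ <;> rw [cross_eq] <;> simp <;> linarith
      · intro j; fin_cases j <;> simp [zonogon] <;> ring
  obtain ⟨v', a', b', c', hp, hj, hc⟩ := main
  exact ⟨v', a', b', c', hp, hj, (key _ _ _ _ hj).1, hc, (key _ _ _ _ hj).2⟩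

lemma hexagonCenter_zonogon :
    hexagonCenter (zonogon v a b c) = (1 / 2 : ℝ) • (v + v + a + b + c) := by
  rw [hexagonCenter, midpoint_eq_smul_add]
  simp [zonogon]; ring

/-- A bisecting line meets opposite edges at points symmetric about the centre; the two parts are
pentagons of the standard form. -/
lemma IsBisection.exists_pentagon (h : Turning a b c) {i : Fin 6} {x y : ℂ}
    (hb : IsBisection (zonogon v a b c) i x y) :
    ∃ (v' a' b' c' : ℂ) (t : ℝ), Turning a' b' c' ∧ 0 < t ∧ t < 1 ∧
      region (zonogon v' a' b' c') = region (zonogon v a b c) ∧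
      v' + v' + a' + b' + c' = v + v + a + b + c ∧
      a' = zonogon v a b c (i + 1) - zonogon v a b c i ∧
      x = v' + t • a' ∧ y = v' + a' + b' + c' - t • a' ∧
      firstHalf (zonogon v a b c) i x y = pentagon v' a' b' c' t ∧
      secondHalf (zonogon v a b c) i x y =
        pentagon (v' + a' + b' + c') (-a') (-b') (-c') t := by
  obtain ⟨v', a', b', c', hp, hj, hr, hc, ha'⟩ := exists_rebase (v := v) h i
  obtain ⟨hx, hy, ho⟩ := hb
  have q0 : zonogon v a b c i = v' := by
    have := hj 0; rw [add_zero] at this; rw [this]; rfl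
  have q1 : zonogon v a b c (i + 1) = v' + a' := hj 1
  have q2 : zonogon v a b c (i + 2) = v' + a' + b' := hj 2
  have q3 : zonogon v a b c (i + 3) = v' + a' + b' + c' := hj 3
  have q4 : zonogon v a b c (i + 4) = v' + b' + c' := hj 4
  have q5 : zonogon v a b c (i + 5) = v' + c' := hj 5
  rw [q0, q1] at hx
  rw [q3, q4] at hy
  rw [hexagonCenter_zonogon, ← hc] at ho
  obtain ⟨t', t, ht', ht, htt, rfl⟩ := hx
  obtain ⟨s', s, hs', hs, hss, rfl⟩ := hy
  obtain ⟨r', r, hr', hr, hrr, hro⟩ := ho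
  obtain rfl : t' = 1 - t := by linarith
  obtain rfl : s' = 1 - s := by linarith
  obtain rfl : r' = 1 - r := by linarith
  have hpos : 0 < cross a' (b' + c') := by rw [cross_add_right]; linarith [hp.1, hp.2.2]
  -- the centre lies halfway between the two edge lines
  have h1 : r = 1 / 2 := by
    have := congrArg (fun z => cross a' (z - v')) hro
    have e : (r - 1 / 2) * cross a' (b' + c') = 0 := by
      simp [cross_eq] at this
      rw [cross_eq, Complex.add_re, Complex.add_im]
      linarith
    rcases mul_eq_zero.1 e with h' | h'
    · linarith
    · exact absurd h' hpos.ne'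
  subst h1
  have h2 : s = t := by
    have := congrArg (fun z => cross (z - v') (b' + c')) hro
    have e : (t - s) * cross a' (b' + c') = 0 := by
      simp [cross_eq] at this
      rw [cross_eq, Complex.add_re, Complex.add_im]
      linarith
    rcases mul_eq_zero.1 e with h' | h'
    · linarith
    · exact absurd h' hpos.ne'
  subst h2
  have ex : (1 - s) • v' + s • (v' + a') = v' + s • a' := by module
  have ey : (1 - s) • (v' + a' + b' + c') + s • (v' + b' + c') =
      v' + a' + b' + c' - s • a' := by module
  refine ⟨v', a', b', c', s, hp, ht, by linarith, by assumption, hc, ha', ex, ey, ?_, ?_⟩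
  · rw [ex, ey, firstHalf, pentagon, q1, q2, q3]
  · rw [ex, ey, secondHalf, pentagon, q4, q5, q0]
    congr 1
    ext j
    fin_cases j <;> simp <;> ring

/-- Everything needed about the two halves: they are strictly convex, they are the parts of the
hexagon on the two sides of the cut, and the half-turn about the centre interchanges them. -/
lemma IsBisection.halves (h : Turning a b c) {i : Fin 6} {x y : ℂ}
    (hb : IsBisection (zonogon v a b c) i x y) :
    IsCCW (firstHalf (zonogon v a b c) i x y) ∧ IsCCW (secondHalf (zonogon v a b c) i x y) ∧
    region (firstHalf (zonogon v a b c) i x y) =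
      region (zonogon v a b c) ∩ {z | 0 ≤ cross (x - y) (z - x)} ∧
    region (secondHalf (zonogon v a b c) i x y) =
      region (zonogon v a b c) ∩ {z | cross (x - y) (z - x) ≤ 0} ∧
    ∀ j, secondHalf (zonogon v a b c) i x y j =
      (v + v + a + b + c) - firstHalf (zonogon v a b c) i x y j := by
  obtain ⟨v', a', b', c', t, hp, ht0, ht1, hr, hc, ha', hx, hy, hf, hs⟩ := hb.exists_pentagon h
  have hp' : Turning (-a') (-b') (-c') := by
    obtain ⟨h1, h2, h3⟩ := hp
    refine ⟨?_, ?_, ?_⟩ <;> rw [cross_neg_left, cross_neg_right, neg_neg] <;> assumption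
  rw [hf, hs, ← hr, hx, hy]
  obtain ⟨h1, h2, h3⟩ := id hp
  rw [cross_eq] at h1 h2 h3
  have m1 := mul_pos ht0 h1
  have m3 := mul_pos ht0 h3
  have n1 := mul_pos (sub_pos.2 ht1) h1
  have n3 := mul_pos (sub_pos.2 ht1) h3
  refine ⟨pentagon_isCCW hp ht0 ht1, pentagon_isCCW hp' ht0 ht1, ?_, ?_, ?_⟩
  · refine Subset.antisymm (fun w hw => ⟨?_, ?_⟩) ?_
    · refine convexHull_min ?_ (convex_region (zonogon v' a' b' c')) hw
      rintro _ ⟨j, rfl⟩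
      rw [mem_region_zonogon hp]
      fin_cases j <;> simp [pentagon, cross_eq] <;> (repeat' apply And.intro) <;> linarith
    · exact ((mem_region_pentagon hp ht0 ht1).1 hw).2.2.2.2
    · rintro w ⟨hw, hL⟩
      obtain ⟨k1, k2, k3, k4, k5, k6⟩ := (mem_region_zonogon hp).1 hw
      exact (mem_region_pentagon hp ht0 ht1).2 ⟨k1, k2, k3, k4, hL⟩
  · refine Subset.antisymm (fun w hw => ⟨?_, ?_⟩) ?_
    · refine convexHull_min ?_ (convex_region (zonogon v' a' b' c')) hw
      rintro _ ⟨j, rfl⟩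
      rw [mem_region_zonogon hp]
      fin_cases j <;> simp [pentagon, cross_eq] <;> (repeat' apply And.intro) <;> linarith
    · have := ((mem_region_pentagon hp' ht0 ht1).1 hw).2.2.2.2
      simp [cross_eq] at this ⊢
      linarith
    · rintro w ⟨hw, hL⟩
      obtain ⟨k1, k2, k3, k4, k5, k6⟩ := (mem_region_zonogon hp).1 hw
      refine (mem_region_pentagon hp' ht0 ht1).2 ⟨?_, ?_, ?_, ?_, ?_⟩
      · convert k4 using 1
      · convert k5 using 2; ring
      · convert k6 using 2; ring
      · rw [neg_neg]; convert k1 using 2; ring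
      · simp [cross_eq] at hL ⊢
        linarith
  · intro j
    rw [← hc]
    fin_cases j <;> simp [pentagon] <;> ring

end Zonogon

/-! ### Separating lines -/

/-- A nonzero linear functional is strictly below its bound in the interior. -/
lemma lt_of_mem_interior {A : Set ℂ} {u : ℂ} (hu : u ≠ 0) {t : ℝ} (hA : ∀ z ∈ A, cross u z ≤ t)
    {z : ℂ} (hz : z ∈ interior A) : cross u z < t := by
  have hc : ContinuousAt (fun s : ℝ => z + s • (Complex.I * u)) 0 := by fun_prop
  have hmem : ∀ᶠ s : ℝ in 𝓝 0, z + s • (Complex.I * u) ∈ A := by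
    apply hc
    simpa using mem_interior_iff_mem_nhds.1 hz
  obtain ⟨s, hs, hspos⟩ :=
    ((hmem.filter_mono nhdsWithin_le_nhds).and (self_mem_nhdsWithin (s := Ioi (0 : ℝ)))).exists
  have h1 := hA _ hs
  rw [cross_add_right, cross_smul_right] at h1
  have := mul_pos hspos (cross_I_mul_pos hu)
  linarith

lemma disjoint_interior_of_sep {A B : Set ℂ} {u : ℂ} (hu : u ≠ 0) {t : ℝ}
    (hA : ∀ z ∈ A, cross u z ≤ t) (hB : ∀ z ∈ B, t ≤ cross u z) :
    Disjoint (interior A) (interior B) := by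
  rw [Set.disjoint_left]
  intro z hz hz'
  have h1 := lt_of_mem_interior hu hA hz
  have h2 := lt_of_mem_interior (u := -u) (t := -t) (neg_ne_zero.2 hu)
    (fun w hw => by rw [cross_neg_left]; linarith [hB w hw]) hz'
  rw [cross_neg_left] at h2
  linarith

/-- Two tiles fit together: they do not overlap, and they are disjoint or share exactly one vertex
or exactly one edge. -/
def Compat (P Q : Polygon ℂ 6) : Prop :=
  Disjoint (interior (region P)) (interior (region Q)) ∧
    (region P ∩ region Q = ∅ ∨
    (∃ i j, P i = Q j ∧ region P ∩ region Q = {P i}) ∨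
    (∃ i j, P.edgeSet ℝ i = Q.edgeSet ℝ j ∧ region P ∩ region Q = P.edgeSet ℝ i))

lemma Compat.symm {P Q : Polygon ℂ 6} (h : Compat P Q) : Compat Q P := by
  obtain ⟨h1, h2⟩ := h
  refine ⟨h1.symm, ?_⟩
  rw [inter_comm]
  rcases h2 with h | ⟨i, j, hij, h⟩ | ⟨i, j, hij, h⟩
  · exact Or.inl h
  · exact Or.inr (Or.inl ⟨j, i, hij.symm, by rw [h, hij]⟩)
  · exact Or.inr (Or.inr ⟨j, i, hij.symm, by rw [h, hij]⟩)

section Sep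

variable {P Q : Polygon ℂ 6} {u : ℂ} {t : ℝ}

lemma compat_of_inter_empty (hu : u ≠ 0) (hP : ∀ z ∈ region P, cross u z ≤ t)
    (hQ : ∀ z ∈ region Q, t ≤ cross u z) (h : ∀ z ∈ region P, z ∈ region Q → False) :
    Compat P Q := by
  refine ⟨disjoint_interior_of_sep hu hP hQ, Or.inl ?_⟩
  ext z
  exact ⟨fun hz => h z hz.1 hz.2, fun hz => hz.elim⟩

lemma compat_of_vertex (hu : u ≠ 0) (hP : ∀ z ∈ region P, cross u z ≤ t)
    (hQ : ∀ z ∈ region Q, t ≤ cross u z) (i j : Fin 6) (hij : P i = Q j)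
    (h : ∀ z ∈ region P, z ∈ region Q → z = P i) : Compat P Q := by
  refine ⟨disjoint_interior_of_sep hu hP hQ, Or.inr (Or.inl ⟨i, j, hij, ?_⟩)⟩
  ext z
  refine ⟨fun hz => h z hz.1 hz.2, ?_⟩
  rintro rfl
  exact ⟨vertex_mem_region P i, hij ▸ vertex_mem_region Q j⟩

lemma compat_of_edge (hu : u ≠ 0) (hP : ∀ z ∈ region P, cross u z ≤ t)
    (hQ : ∀ z ∈ region Q, t ≤ cross u z) (i j : Fin 6) (hij : P i = Q (finRotate 6 j))
    (hij' : P (finRotate 6 i) = Q j)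
    (h : ∀ z ∈ region P, z ∈ region Q → z ∈ segment ℝ (P i) (P (finRotate 6 i))) :
    Compat P Q := by
  refine ⟨disjoint_interior_of_sep hu hP hQ, Or.inr (Or.inr ⟨i, j, ?_, ?_⟩)⟩
  · rw [Polygon.edgeSet, Polygon.edgeSet, affineSegment_eq_segment, affineSegment_eq_segment,
      hij, hij', segment_symm]
  · rw [Polygon.edgeSet, affineSegment_eq_segment]
    refine Subset.antisymm (fun z hz => h z hz.1 hz.2) (fun z hz => ?_)
    refine ⟨segment_subset_region P _ _ hz, segment_subset_region Q (finRotate 6 j) j ?_⟩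
    rwa [hij, hij'] at hz

end Sep

/-- The region of a centrally symmetric hexagon lies in the zonotope of its edge vectors. -/
lemma exists_coeffs {v a b c z : ℂ} (hz : z ∈ region (zonogon v a b c)) :
    ∃ α β γ : ℝ, 0 ≤ α ∧ α ≤ 1 ∧ 0 ≤ β ∧ β ≤ 1 ∧ 0 ≤ γ ∧ γ ≤ 1 ∧
      z = v + α • a + β • b + γ • c := by
  have hconv : Convex ℝ {z : ℂ | ∃ α β γ : ℝ, 0 ≤ α ∧ α ≤ 1 ∧ 0 ≤ β ∧ β ≤ 1 ∧ 0 ≤ γ ∧ γ ≤ 1 ∧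
      z = v + α • a + β • b + γ • c} := by
    rintro _ ⟨α, β, γ, h1, h2, h3, h4, h5, h6, rfl⟩ _ ⟨α', β', γ', h1', h2', h3', h4', h5', h6', rfl⟩
      s t hs ht hst
    obtain rfl : s = 1 - t := by linarith
    refine ⟨(1 - t) * α + t * α', (1 - t) * β + t * β', (1 - t) * γ + t * γ',
      by positivity, ?_, by positivity, ?_, by positivity, ?_, by module⟩ <;> nlinarith
  refine convexHull_min ?_ hconv hz
  rintro _ ⟨i, rfl⟩
  fin_cases i
  · exact ⟨0, 0, 0, by simp [zonogon]⟩
  · exact ⟨1, 0, 0, by simp [zonogon]⟩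
  · exact ⟨1, 1, 0, by simp [zonogon]⟩
  · exact ⟨1, 1, 1, by simp [zonogon]⟩
  · exact ⟨0, 1, 1, by simp [zonogon]⟩
  · exact ⟨0, 0, 1, by simp [zonogon]⟩

lemma eq_zero_of_combo {s₁ s₂ x y : ℝ} (h₁ : 0 < s₁) (h₂ : 0 < s₂) (hx : 0 ≤ x) (hy : 0 ≤ y)
    (h : x * s₁ + y * s₂ = 0) : x = 0 ∧ y = 0 := by
  have a1 := mul_nonneg hx h₁.le
  have a2 := mul_nonneg hy h₂.le
  constructor
  · exact (mul_eq_zero.1 (by linarith : x * s₁ = 0)).resolve_right h₁.ne'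
  · exact (mul_eq_zero.1 (by linarith : y * s₂ = 0)).resolve_right h₂.ne'

/-! ### Fitting tiles of one sector -/

section Lattice

variable {a b c : ℂ}

/-- The line of the `a`-edge between vertices `3` and `4` separates the tiles. -/
lemma compat_lattice_up (h : Turning a b c) (v : ℂ) {j l : ℤ} (hj : 0 ≤ j) (hl : 1 ≤ l) :
    Compat (zonogon v a b c) (zonogon (v + (j : ℝ) • (a + b) + (l : ℝ) • (b + c)) a b c) := by
  obtain ⟨h1, h2, h3⟩ := h
  have hj' : (0 : ℝ) ≤ j := by exact_mod_cast hj
  have hl' : (1 : ℝ) ≤ l := by exact_mod_cast hl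
  have ha := ne_zero_of_cross_pos h1
  have hP : ∀ z ∈ region (zonogon v a b c), cross a z ≤ cross a v + cross a b + cross a c := by
    intro z hz
    obtain ⟨α, β, γ, k1, k2, k3, k4, k5, k6, rfl⟩ := exists_coeffs hz
    simp only [cross_add_right, cross_smul_right, cross_self]
    nlinarith
  have hQ : ∀ z ∈ region (zonogon (v + (j : ℝ) • (a + b) + (l : ℝ) • (b + c)) a b c),
      cross a v + cross a b + cross a c ≤ cross a z := by
    intro z hz
    obtain ⟨α, β, γ, k1, k2, k3, k4, k5, k6, rfl⟩ := exists_coeffs hz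
    simp only [cross_add_right, cross_smul_right, cross_self]
    nlinarith [mul_nonneg hj' h1.le, mul_nonneg (sub_nonneg.2 hl') h1.le,
      mul_nonneg (sub_nonneg.2 hl') h3.le, mul_nonneg k3 h1.le, mul_nonneg k5 h3.le]
  have hPQ : ∀ z ∈ region (zonogon v a b c),
      z ∈ region (zonogon (v + (j : ℝ) • (a + b) + (l : ℝ) • (b + c)) a b c) →
      j = 0 ∧ l = 1 ∧ ∃ α : ℝ, 0 ≤ α ∧ α ≤ 1 ∧ z = v + α • a + b + c := by
    intro z hz hz'
    obtain ⟨α, β, γ, k1, k2, k3, k4, k5, k6, rfl⟩ := exists_coeffs hz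
    obtain ⟨α', β', γ', k1', k2', k3', k4', k5', k6', e⟩ := exists_coeffs hz'
    have e' := congrArg (cross a) e
    simp only [cross_add_right, cross_smul_right, cross_self] at e'
    obtain ⟨e1, e2⟩ := eq_zero_of_combo h1 h3
      (x := j + (l - 1) + (1 - β) + β') (y := (l - 1) + (1 - γ) + γ')
      (by linarith) (by linarith) (by linarith)
    have ej : (j : ℝ) = 0 := by linarith
    have el : (l : ℝ) = 1 := by linarith
    have eβ : β = 1 := by linarith
    have eγ : γ = 1 := by linarith
    exact ⟨by exact_mod_cast ej, by exact_mod_cast el, α, k1, k2, by rw [eβ, eγ]; simp⟩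
  by_cases hjl : j = 0 ∧ l = 1
  · obtain ⟨rfl, rfl⟩ := hjl
    refine compat_of_edge ha hP hQ 3 0 ?_ ?_ ?_
    · simp [zonogon]; ring
    · simp [zonogon]; ring
    · intro z hz hz'
      obtain ⟨-, -, α, h1, h2, rfl⟩ := hPQ z hz hz'
      refine ⟨α, 1 - α, h1, by linarith, by ring, ?_⟩
      simp [zonogon]; ring
  · exact compat_of_inter_empty ha hP hQ fun z hz hz' =>
      hjl ⟨(hPQ z hz hz').1, (hPQ z hz hz').2.1⟩

/-- The line of the `c`-edge between vertices `2` and `3` separates the tiles. -/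
lemma compat_lattice_right (h : Turning a b c) (v : ℂ) {j : ℤ} (hj : 1 ≤ j) :
    Compat (zonogon v a b c) (zonogon (v + (j : ℝ) • (a + b) + ((0 : ℤ) : ℝ) • (b + c)) a b c) := by
  obtain ⟨h1, h2, h3⟩ := h
  have hj' : (1 : ℝ) ≤ j := by exact_mod_cast hj
  have hc : -c ≠ 0 := fun h => h3.ne' (by rw [neg_eq_zero.1 h, cross_zero_right])
  have e1 : cross (-c) a = cross a c := by rw [cross_swap, cross_neg_right, neg_neg]
  have e2 : cross (-c) b = cross b c := by rw [cross_swap, cross_neg_right, neg_neg]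
  have e3 : cross (-c) c = 0 := by rw [cross_neg_left, cross_self, neg_zero]
  have hP : ∀ z ∈ region (zonogon v a b c),
      cross (-c) z ≤ cross (-c) v + cross b c + cross a c := by
    intro z hz
    obtain ⟨α, β, γ, k1, k2, k3, k4, k5, k6, rfl⟩ := exists_coeffs hz
    simp only [cross_add_right, cross_smul_right, e1, e2, e3]
    nlinarith
  have hQ : ∀ z ∈ region (zonogon (v + (j : ℝ) • (a + b) + ((0 : ℤ) : ℝ) • (b + c)) a b c),
      cross (-c) v + cross b c + cross a c ≤ cross (-c) z := by
    intro z hz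
    obtain ⟨α, β, γ, k1, k2, k3, k4, k5, k6, rfl⟩ := exists_coeffs hz
    simp only [cross_add_right, cross_smul_right, e1, e2, e3, Int.cast_zero]
    nlinarith [mul_nonneg (sub_nonneg.2 hj') h2.le, mul_nonneg (sub_nonneg.2 hj') h3.le,
      mul_nonneg k1 h3.le, mul_nonneg k3 h2.le]
  have hPQ : ∀ z ∈ region (zonogon v a b c),
      z ∈ region (zonogon (v + (j : ℝ) • (a + b) + ((0 : ℤ) : ℝ) • (b + c)) a b c) →
      j = 1 ∧ ∃ γ : ℝ, 0 ≤ γ ∧ γ ≤ 1 ∧ z = v + a + b + γ • c := by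
    intro z hz hz'
    obtain ⟨α, β, γ, k1, k2, k3, k4, k5, k6, rfl⟩ := exists_coeffs hz
    obtain ⟨α', β', γ', k1', k2', k3', k4', k5', k6', e⟩ := exists_coeffs hz'
    have e' := congrArg (cross (-c)) e
    simp only [cross_add_right, cross_smul_right, e1, e2, e3, Int.cast_zero] at e'
    obtain ⟨f1, f2⟩ := eq_zero_of_combo h2 h3
      (x := (j - 1) + (1 - β) + β') (y := (j - 1) + (1 - α) + α')
      (by linarith) (by linarith) (by linarith)
    have ej : (j : ℝ) = 1 := by linarith
    have eβ : β = 1 := by linarith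
    have eα : α = 1 := by linarith
    exact ⟨by exact_mod_cast ej, γ, k5, k6, by rw [eβ, eα]; simp⟩
  by_cases hj1 : j = 1
  · subst hj1
    refine compat_of_edge hc hP hQ 2 5 ?_ ?_ ?_
    · simp [zonogon]; ring
    · simp [zonogon]; ring
    · intro z hz hz'
      obtain ⟨-, γ, h1, h2, rfl⟩ := hPQ z hz hz'
      refine ⟨1 - γ, γ, by linarith, h1, by ring, ?_⟩
      simp [zonogon]; ring
  · exact compat_of_inter_empty hc hP hQ fun z hz hz' => hj1 (hPQ z hz hz').1

/-- The line of the `b`-edge between vertices `4` and `5` separates the tiles. -/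
lemma compat_lattice_left (h : Turning a b c) (v : ℂ) {j l : ℤ} (hj : j ≤ -1) (hl : 1 ≤ l) :
    Compat (zonogon v a b c) (zonogon (v + (j : ℝ) • (a + b) + (l : ℝ) • (b + c)) a b c) := by
  obtain ⟨h1, h2, h3⟩ := h
  have hj' : (j : ℝ) ≤ -1 := by exact_mod_cast hj
  have hl' : (1 : ℝ) ≤ l := by exact_mod_cast hl
  have hb := ne_zero_of_cross_pos h2
  have e1 := cross_swap b a
  have hP : ∀ z ∈ region (zonogon v a b c), cross b z ≤ cross b v + cross b c := by
    intro z hz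
    obtain ⟨α, β, γ, k1, k2, k3, k4, k5, k6, rfl⟩ := exists_coeffs hz
    simp only [cross_add_right, cross_smul_right, cross_self, e1]
    nlinarith
  have hQ : ∀ z ∈ region (zonogon (v + (j : ℝ) • (a + b) + (l : ℝ) • (b + c)) a b c),
      cross b v + cross b c ≤ cross b z := by
    intro z hz
    obtain ⟨α, β, γ, k1, k2, k3, k4, k5, k6, rfl⟩ := exists_coeffs hz
    simp only [cross_add_right, cross_smul_right, cross_self, e1]
    nlinarith [mul_nonneg (by linarith : 0 ≤ -1 - (j : ℝ)) h1.le,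
      mul_nonneg (sub_nonneg.2 hl') h2.le, mul_nonneg (sub_nonneg.2 k2) h1.le,
      mul_nonneg k5 h2.le]
  have hPQ : ∀ z ∈ region (zonogon v a b c),
      z ∈ region (zonogon (v + (j : ℝ) • (a + b) + (l : ℝ) • (b + c)) a b c) →
      j = -1 ∧ l = 1 ∧ ∃ β : ℝ, 0 ≤ β ∧ β ≤ 1 ∧ z = v + β • b + c := by
    intro z hz hz'
    obtain ⟨α, β, γ, k1, k2, k3, k4, k5, k6, rfl⟩ := exists_coeffs hz
    obtain ⟨α', β', γ', k1', k2', k3', k4', k5', k6', e⟩ := exists_coeffs hz'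
    have e' := congrArg (cross b) e
    simp only [cross_add_right, cross_smul_right, cross_self, e1] at e'
    obtain ⟨f1, f2⟩ := eq_zero_of_combo h1 h2
      (x := (-1 - j) + α + (1 - α')) (y := (l - 1) + (1 - γ) + γ')
      (by linarith) (by linarith) (by linarith)
    have ej : (j : ℝ) = -1 := by linarith
    have el : (l : ℝ) = 1 := by linarith
    have eα : α = 0 := by linarith
    have eγ : γ = 1 := by linarith
    exact ⟨by exact_mod_cast ej, by exact_mod_cast el, β, k3, k4, by rw [eα, eγ]; simp⟩
  by_cases hjl : j = -1 ∧ l = 1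
  · obtain ⟨rfl, rfl⟩ := hjl
    refine compat_of_edge hb hP hQ 4 1 ?_ ?_ ?_
    · simp [zonogon]; ring
    · simp [zonogon]; ring
    · intro z hz hz'
      obtain ⟨-, -, β, h1, h2, rfl⟩ := hPQ z hz hz'
      refine ⟨β, 1 - β, h1, by linarith, by ring, ?_⟩
      simp [zonogon]; ring
  · exact compat_of_inter_empty hb hP hQ fun z hz hz' =>
      hjl ⟨(hPQ z hz hz').1, (hPQ z hz hz').2.1⟩

/-- Distinct translates of a centrally symmetric hexagon by its lattice fit together. -/
lemma compat_lattice (h : Turning a b c) (v : ℂ) {j l j' l' : ℤ} (hne : j ≠ j' ∨ l ≠ l') :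
    Compat (zonogon (v + (j : ℝ) • (a + b) + (l : ℝ) • (b + c)) a b c)
      (zonogon (v + (j' : ℝ) • (a + b) + (l' : ℝ) • (b + c)) a b c) := by
  -- one of the two differences lies in the half-plane treated above
  have key : ∀ j l j' l' : ℤ, (l < l' ∨ l = l' ∧ j < j') →
      Compat (zonogon (v + (j : ℝ) • (a + b) + (l : ℝ) • (b + c)) a b c)
        (zonogon (v + (j' : ℝ) • (a + b) + (l' : ℝ) • (b + c)) a b c) := by
    intro j l j' l' hlt
    have e : v + (j' : ℝ) • (a + b) + (l' : ℝ) • (b + c) =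
        (v + (j : ℝ) • (a + b) + (l : ℝ) • (b + c)) + ((j' - j : ℤ) : ℝ) • (a + b) +
          ((l' - l : ℤ) : ℝ) • (b + c) := by
      push_cast; module
    rw [e]
    rcases hlt with hlt | ⟨rfl, hlt⟩
    · by_cases hj : j ≤ j'
      · exact compat_lattice_up h _ (by omega) (by omega)
      · exact compat_lattice_left h _ (by omega) (by omega)
    · rw [sub_self]
      exact compat_lattice_right h _ (by omega)
  by_cases hlt : l < l' ∨ l = l' ∧ j < j'
  · exact key _ _ _ _ hlt
  · exact (key _ _ _ _ (by omega)).symm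

end Lattice

/-! ### Fitting tiles of different sectors -/

section Adjacent

variable {a b c d : ℂ} {s₁ s₂ κ : ℝ}

/-- Tiles of two neighbouring sectors fit together. Depending on the positions of the tiles, the
line of a `b`-edge or of a `c`-edge of the common zigzag boundary separates them. -/
lemma compat_adjacent (h₁ : 0 < s₁) (h₂ : 0 < s₂) (hκ : 0 ≤ κ) (hab : cross a b = s₁)
    (hbc : cross b c = s₁) (hcd : cross c d = s₁) (hac : cross a c = s₂) (hbd : cross b d = s₂)
    (hrel : a + c = κ • b) (v : ℂ) (j l l' : ℕ) (j' : ℤ) :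
    Compat (zonogon (v + (j : ℝ) • (a + b) + (l : ℝ) • (b + c)) a b c)
      (zonogon (v + c + (j' : ℝ) • (b + c) + (l' : ℝ) • (c + d)) b c d) := by
  have hj0 : (0 : ℝ) ≤ j := Nat.cast_nonneg j
  have hl0 : (0 : ℝ) ≤ l := Nat.cast_nonneg l
  have hl'0 : (0 : ℝ) ≤ l' := Nat.cast_nonneg l'
  have hb : b ≠ 0 := ne_zero_of_cross_pos (by rw [hbc]; exact h₁)
  have hc : c ≠ 0 := ne_zero_of_cross_pos (by rw [hcd]; exact h₁)
  have hba : cross b a = -s₁ := by rw [cross_swap, hab]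
  have hca : cross c a = -s₂ := by rw [cross_swap, hac]
  have hcb : cross c b = -s₁ := by rw [cross_swap, hbc]
  rcases le_or_gt ((l : ℤ) - j) j' with hlt | hlt
  · have hlt' : (l : ℝ) - j ≤ j' := by exact_mod_cast hlt
    have hP : ∀ z ∈ region (zonogon (v + (j : ℝ) • (a + b) + (l : ℝ) • (b + c)) a b c),
        cross b z ≤ cross b v + (l - j + 1) * s₁ := by
      intro z hz
      obtain ⟨α, β, γ, k1, k2, k3, k4, k5, k6, rfl⟩ := exists_coeffs hz
      simp only [cross_add_right, cross_smul_right, cross_self, hba, hbc]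
      nlinarith
    have hQ : ∀ z ∈ region (zonogon (v + c + (j' : ℝ) • (b + c) + (l' : ℝ) • (c + d)) b c d),
        cross b v + (l - j + 1) * s₁ ≤ cross b z := by
      intro z hz
      obtain ⟨α, β, γ, k1, k2, k3, k4, k5, k6, rfl⟩ := exists_coeffs hz
      simp only [cross_add_right, cross_smul_right, cross_self, hbc, hbd]
      nlinarith [mul_nonneg (sub_nonneg.2 hlt') h₁.le, mul_nonneg hl'0 h₁.le,
        mul_nonneg hl'0 h₂.le, mul_nonneg k3 h₁.le, mul_nonneg k5 h₂.le]
    have hPQ : ∀ z ∈ region (zonogon (v + (j : ℝ) • (a + b) + (l : ℝ) • (b + c)) a b c),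
        z ∈ region (zonogon (v + c + (j' : ℝ) • (b + c) + (l' : ℝ) • (c + d)) b c d) →
        j = 0 ∧ l' = 0 ∧ j' = l ∧ ∃ β : ℝ, 0 ≤ β ∧ β ≤ 1 ∧
          z = v + (l : ℝ) • (b + c) + β • b + c := by
      intro z hz hz'
      obtain ⟨α, β, γ, k1, k2, k3, k4, k5, k6, rfl⟩ := exists_coeffs hz
      obtain ⟨α', β', γ', k1', k2', k3', k4', k5', k6', e⟩ := exists_coeffs hz'
      have e' := congrArg (cross b) e
      simp only [cross_add_right, cross_smul_right, cross_self, hba, hbc, hbd] at e'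
      obtain ⟨f1, f2⟩ := eq_zero_of_combo h₁ h₂
        (x := (j' - (l - j)) + l' + β' + (1 - γ) + α) (y := l' + γ')
        (by linarith) (by linarith) (by linarith)
      have el' : (l' : ℝ) = 0 := by linarith
      have ej' : (j' : ℝ) = l - j := by linarith
      have eα : α = 0 := by linarith
      have eγ : γ = 1 := by linarith
      have eβ' : β' = 0 := by linarith
      have eγ' : γ' = 0 := by linarith
      subst eα eγ eβ' eγ'
      rw [el', ej'] at e
      have ea : a = κ • b - c := by rw [← hrel]; ring
      have e3 : (j * (2 + κ) + β - α') • b = 0 := by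
        rw [ea] at e
        simp only [Complex.real_smul] at e ⊢
        push_cast at e ⊢
        linear_combination e
      have e4 := (smul_eq_zero.1 e3).resolve_right hb
      have ej : (j : ℝ) = 0 := by
        by_contra hne
        have : (1 : ℝ) ≤ j := by
          have : j ≠ 0 := by exact_mod_cast hne
          exact_mod_cast Nat.one_le_iff_ne_zero.2 this
        nlinarith
      have ej'' : (j' : ℝ) = l := by rw [ej', ej]; ring
      refine ⟨by exact_mod_cast ej, by exact_mod_cast el', by exact_mod_cast ej'', β, k3, k4, ?_⟩
      rw [ej]; simp
    by_cases hcase : j = 0 ∧ l' = 0 ∧ j' = l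
    · obtain ⟨rfl, rfl, rfl⟩ := hcase
      refine compat_of_edge hb hP hQ 4 0 ?_ ?_ ?_
      · simp [zonogon]; ring
      · simp [zonogon]; ring
      · intro z hz hz'
        obtain ⟨-, -, -, β, h1, h2, rfl⟩ := hPQ z hz hz'
        refine ⟨β, 1 - β, h1, by linarith, by ring, ?_⟩
        simp [zonogon]; ring
    · exact compat_of_inter_empty hb hP hQ fun z hz hz' =>
        let h := hPQ z hz hz'; hcase ⟨h.1, h.2.1, h.2.2.1⟩
  · have hlt' : (j' : ℝ) + 1 ≤ l - j := by
      have : j' + 1 ≤ (l : ℤ) - j := hlt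
      exact_mod_cast this
    have hP : ∀ z ∈ region (zonogon (v + (j : ℝ) • (a + b) + (l : ℝ) • (b + c)) a b c),
        cross c z ≤ cross c v - l * s₁ := by
      intro z hz
      obtain ⟨α, β, γ, k1, k2, k3, k4, k5, k6, rfl⟩ := exists_coeffs hz
      simp only [cross_add_right, cross_smul_right, cross_self, hca, hcb]
      nlinarith [mul_nonneg hj0 h₁.le, mul_nonneg hj0 h₂.le, mul_nonneg k1 h₂.le,
        mul_nonneg k3 h₁.le]
    have hQ : ∀ z ∈ region (zonogon (v + c + (j' : ℝ) • (b + c) + (l' : ℝ) • (c + d)) b c d),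
        cross c v - l * s₁ ≤ cross c z := by
      intro z hz
      obtain ⟨α, β, γ, k1, k2, k3, k4, k5, k6, rfl⟩ := exists_coeffs hz
      simp only [cross_add_right, cross_smul_right, cross_self, hcb, hcd]
      nlinarith [mul_nonneg (by linarith : 0 ≤ (l : ℝ) - j' - 1) h₁.le,
        mul_nonneg (sub_nonneg.2 k2) h₁.le, mul_nonneg hl'0 h₁.le, mul_nonneg k5 h₁.le]
    have hPQ : ∀ z ∈ region (zonogon (v + (j : ℝ) • (a + b) + (l : ℝ) • (b + c)) a b c),
        z ∈ region (zonogon (v + c + (j' : ℝ) • (b + c) + (l' : ℝ) • (c + d)) b c d) →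
        j = 0 ∧ l' = 0 ∧ j' = l - 1 ∧ ∃ γ : ℝ, 0 ≤ γ ∧ γ ≤ 1 ∧
          z = v + (l : ℝ) • (b + c) + γ • c := by
      intro z hz hz'
      obtain ⟨α, β, γ, k1, k2, k3, k4, k5, k6, rfl⟩ := exists_coeffs hz
      obtain ⟨α', β', γ', k1', k2', k3', k4', k5', k6', e⟩ := exists_coeffs hz'
      have e' := congrArg (cross c) e
      simp only [cross_add_right, cross_smul_right, cross_self, hca, hcb, hcd] at e'
      obtain ⟨f1, f2⟩ := eq_zero_of_combo h₁ h₂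
        (x := (l - j' - 1) + l' + j + (1 - α') + γ' + β) (y := j + α)
        (by linarith) (by linarith) (by linarith)
      have ej : (j : ℝ) = 0 := by linarith
      have el' : (l' : ℝ) = 0 := by linarith
      have ej' : (j' : ℝ) = l - 1 := by linarith
      have eα : α = 0 := by linarith
      have eβ : β = 0 := by linarith
      refine ⟨by exact_mod_cast ej, by exact_mod_cast el', by exact_mod_cast ej', γ, k5, k6, ?_⟩
      rw [ej, eα, eβ]; simp
    by_cases hcase : j = 0 ∧ l' = 0 ∧ j' = l - 1
    · obtain ⟨rfl, rfl, rfl⟩ := hcase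
      refine compat_of_edge hc hP hQ 5 1 ?_ ?_ ?_
      · simp [zonogon]; ring
      · simp [zonogon]; ring
      · intro z hz hz'
        obtain ⟨-, -, -, γ, h1, h2, rfl⟩ := hPQ z hz hz'
        refine ⟨γ, 1 - γ, h1, by linarith, by ring, ?_⟩
        simp [zonogon]; ring
    · exact compat_of_inter_empty hc hP hQ fun z hz hz' =>
        let h := hPQ z hz hz'; hcase ⟨h.1, h.2.1, h.2.2.1⟩

end Adjacent

section Far

variable {a b c a' b' c' : ℂ}

/-- Tiles of sectors that are not neighbours are separated by the `c`-line through the corner of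
the first sector. -/
lemma compat_far (h : Turning a b c) (hq₀ : 0 ≤ cross c a') (hq₁ : 0 < cross c b')
    (hq₂ : 0 ≤ cross c c') {p p' : ℂ} (j l j' l' : ℕ)
    (hp : 0 < cross c (p' - p) ∨ p = p' ∧
      (a' = c ∧ 0 < cross c c' ∨ 0 < cross c a' ∧ (0 < cross c c' ∨ c' = -c))) :
    Compat (zonogon (p + (j : ℝ) • (a + b) + (l : ℝ) • (b + c)) a b c)
      (zonogon (p' + (j' : ℝ) • (a' + b') + (l' : ℝ) • (b' + c')) a' b' c') := by
  obtain ⟨h1, h2, h3⟩ := h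
  have hj0 : (0 : ℝ) ≤ j := Nat.cast_nonneg j
  have hl0 : (0 : ℝ) ≤ l := Nat.cast_nonneg l
  have hj'0 : (0 : ℝ) ≤ j' := Nat.cast_nonneg j'
  have hl'0 : (0 : ℝ) ≤ l' := Nat.cast_nonneg l'
  have hc : c ≠ 0 := ne_zero_of_cross_pos hq₁
  have hca := cross_swap c a
  have hcb := cross_swap c b
  have hP : ∀ z ∈ region (zonogon (p + (j : ℝ) • (a + b) + (l : ℝ) • (b + c)) a b c),
      cross c z ≤ cross c p := by
    intro z hz
    obtain ⟨α, β, γ, k1, k2, k3, k4, k5, k6, rfl⟩ := exists_coeffs hz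
    simp only [cross_add_right, cross_smul_right, cross_self, hca, hcb]
    nlinarith [mul_nonneg hj0 h3.le, mul_nonneg hj0 h2.le, mul_nonneg hl0 h2.le,
      mul_nonneg k1 h3.le, mul_nonneg k3 h2.le]
  have hQ : ∀ z ∈ region (zonogon (p' + (j' : ℝ) • (a' + b') + (l' : ℝ) • (b' + c')) a' b' c'),
      cross c p' ≤ cross c z := by
    intro z hz
    obtain ⟨α, β, γ, k1, k2, k3, k4, k5, k6, rfl⟩ := exists_coeffs hz
    simp only [cross_add_right, cross_smul_right]
    nlinarith [mul_nonneg hj'0 hq₀, mul_nonneg hj'0 hq₁.le, mul_nonneg hl'0 hq₁.le,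
      mul_nonneg hl'0 hq₂, mul_nonneg k1 hq₀, mul_nonneg k3 hq₁.le, mul_nonneg k5 hq₂]
  rcases hp with hp | ⟨rfl, hp⟩
  · rw [cross_sub_right] at hp
    refine compat_of_inter_empty hc hP (fun z hz => (by linarith [hQ z hz])) ?_
    intro z hz hz'
    linarith [hP z hz, hQ z hz']
  -- the two sectors have the same corner
  have hPQ : ∀ z ∈ region (zonogon (p + (j : ℝ) • (a + b) + (l : ℝ) • (b + c)) a b c),
      z ∈ region (zonogon (p + (j' : ℝ) • (a' + b') + (l' : ℝ) • (b' + c')) a' b' c') →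
      (j = 0 ∧ l = 0 ∧ j' = 0 ∧ l' = 0) ∧ ∃ γ α' γ' : ℝ, 0 ≤ γ ∧ γ ≤ 1 ∧ 0 ≤ γ' ∧
        α' * cross c a' = 0 ∧ γ' * cross c c' = 0 ∧ z = p + γ • c ∧
        z = p + α' • a' + γ' • c' := by
    intro z hz hz'
    obtain ⟨α, β, γ, k1, k2, k3, k4, k5, k6, rfl⟩ := exists_coeffs hz
    obtain ⟨α', β', γ', k1', k2', k3', k4', k5', k6', e⟩ := exists_coeffs hz'
    have e' := congrArg (cross c) e
    simp only [cross_add_right, cross_smul_right, cross_self, hca, hcb] at e'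
    have n1 := mul_nonneg hj0 h3.le
    have n2 := mul_nonneg hj0 h2.le
    have n3 := mul_nonneg hl0 h2.le
    have n4 := mul_nonneg k1 h3.le
    have n5 := mul_nonneg k3 h2.le
    have n6 := mul_nonneg hj'0 hq₀
    have n7 := mul_nonneg hj'0 hq₁.le
    have n8 := mul_nonneg hl'0 hq₁.le
    have n9 := mul_nonneg hl'0 hq₂
    have n10 := mul_nonneg k1' hq₀
    have n11 := mul_nonneg k3' hq₁.le
    have n12 := mul_nonneg k5' hq₂
    have ej : (j : ℝ) = 0 :=
      (mul_eq_zero.1 (by linarith : (j : ℝ) * cross b c = 0)).resolve_right h2.ne'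
    have el : (l : ℝ) = 0 :=
      (mul_eq_zero.1 (by linarith : (l : ℝ) * cross b c = 0)).resolve_right h2.ne'
    have ej' : (j' : ℝ) = 0 :=
      (mul_eq_zero.1 (by linarith : (j' : ℝ) * cross c b' = 0)).resolve_right hq₁.ne'
    have el' : (l' : ℝ) = 0 :=
      (mul_eq_zero.1 (by linarith : (l' : ℝ) * cross c b' = 0)).resolve_right hq₁.ne'
    have eα : α = 0 := (mul_eq_zero.1 (by linarith : α * cross a c = 0)).resolve_right h3.ne'
    have eβ : β = 0 := (mul_eq_zero.1 (by linarith : β * cross b c = 0)).resolve_right h2.ne'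
    have eβ' : β' = 0 := (mul_eq_zero.1 (by linarith : β' * cross c b' = 0)).resolve_right hq₁.ne'
    refine ⟨⟨by exact_mod_cast ej, by exact_mod_cast el, by exact_mod_cast ej',
      by exact_mod_cast el'⟩, γ, α', γ', k5, k6, k5', by linarith, by linarith, ?_, ?_⟩
    · rw [ej, el, eα, eβ]; simp
    · rw [e, ej', el', eβ']; simp
  by_cases hcase : j = 0 ∧ l = 0 ∧ j' = 0 ∧ l' = 0
  swap
  · exact compat_of_inter_empty hc hP hQ fun z hz hz' => hcase (hPQ z hz hz').1
  obtain ⟨rfl, rfl, rfl, rfl⟩ := hcase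
  rcases hp with ⟨rfl, hp⟩ | ⟨hp, hp'⟩
  · refine compat_of_edge hc hP hQ 5 0 ?_ ?_ ?_
    · simp [zonogon]
    · simp [zonogon]
    · intro z hz hz'
      obtain ⟨-, γ, α', γ', g1, g2, g3, g4, g5, g6, g7⟩ := hPQ z hz hz'
      refine ⟨γ, 1 - γ, g1, by linarith, by ring, ?_⟩
      rw [g6]
      simp [zonogon]; ring
  · refine compat_of_vertex hc hP hQ 0 0 ?_ ?_
    · simp [zonogon]
    · intro z hz hz'
      obtain ⟨-, γ, α', γ', g1, g2, g3, g4, g5, g6, g7⟩ := hPQ z hz hz'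
      have eα : α' = 0 := (mul_eq_zero.1 g4).resolve_right hp.ne'
      have : z = p := by
        rcases hp' with hp' | rfl
        · rw [g7, eα, (mul_eq_zero.1 g5).resolve_right hp'.ne']; simp
        · have e : (γ + γ') • c = 0 := by
            have := g6.symm.trans g7
            rw [eα] at this
            simp only [Complex.real_smul] at this ⊢
            push_cast at this ⊢
            linear_combination this
          have := (smul_eq_zero.1 e).resolve_right hc
          rw [g6, show γ = 0 by linarith]; simp
      rw [this]; simp [zonogon]

end Far

/-! ### The edge directions -/

/-- The rotation factor `exp (2πik/m)`. -/
def rot (m : ℕ) (k : ℤ) : Circle := Circle.exp (2 * Real.pi * k / m)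

/-- The vector of length `r` in the direction `2πk/m`. -/
def edgeVec (m : ℕ) (r : ℝ) (k : ℤ) : ℂ := r * rot m k

section EdgeVec

variable {m : ℕ} {r : ℝ}

lemma rot_zero (m : ℕ) : rot m 0 = 1 := by simp [rot]

lemma rot_add (m : ℕ) (i j : ℤ) : rot m (i + j) = rot m i * rot m j := by
  rw [rot, rot, rot, ← Circle.exp_add]; congr 1; push_cast; ring

lemma rot_neg (m : ℕ) (i : ℤ) : rot m (-i) = (rot m i)⁻¹ := by
  rw [rot, rot, ← Circle.exp_neg]; congr 1; push_cast; ring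

lemma rot_self (hm : m ≠ 0) : rot m m = 1 := by
  have : (m : ℝ) ≠ 0 := by exact_mod_cast hm
  rw [rot, show 2 * Real.pi * ((m : ℤ) : ℝ) / m = 2 * Real.pi by push_cast; field_simp]
  exact Circle.exp_two_pi

lemma rot_mul_self (hm : m ≠ 0) (q : ℤ) : rot m (m * q) = 1 := by
  induction q using Int.induction_on with
  | zero => simp [rot_zero]
  | succ i ih => rw [mul_add, mul_one, rot_add, ih, rot_self hm, one_mul]
  | pred i ih => rw [mul_sub, mul_one, sub_eq_add_neg, rot_add, ih, rot_neg, rot_self hm]; simp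

lemma rot_add_mul (hm : m ≠ 0) (k q : ℤ) : rot m (k + m * q) = rot m k := by
  rw [rot_add, rot_mul_self hm, mul_one]

lemma coe_rot (m : ℕ) (k : ℤ) :
    (rot m k : ℂ) = Complex.exp (2 * Real.pi * Complex.I * k / m) := by
  rw [rot, Circle.coe_exp]; congr 1; push_cast; ring

lemma conj_rot (m : ℕ) (k : ℤ) : conj (rot m k : ℂ) = rot m (-k) := by
  rw [rot_neg, Circle.coe_inv_eq_conj]

lemma rot_re (m : ℕ) (k : ℤ) : (rot m k : ℂ).re = Real.cos (k * (2 * Real.pi / m)) := by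
  rw [rot, Circle.coe_exp, Complex.exp_ofReal_mul_I_re]; congr 1; ring

lemma rot_im (m : ℕ) (k : ℤ) : (rot m k : ℂ).im = Real.sin (k * (2 * Real.pi / m)) := by
  rw [rot, Circle.coe_exp, Complex.exp_ofReal_mul_I_im]; congr 1; ring

lemma rot_mul_edgeVec (i k : ℤ) : (rot m i : ℂ) * edgeVec m r k = edgeVec m r (i + k) := by
  rw [edgeVec, edgeVec, rot_add, Circle.coe_mul]; ring

lemma edgeVec_add_mul (hm : m ≠ 0) (k q : ℤ) : edgeVec m r (k + m * q) = edgeVec m r k := by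
  rw [edgeVec, edgeVec, rot_add_mul hm]

lemma edgeVec_zero : edgeVec m r 0 = r := by simp [edgeVec, rot_zero]

lemma conj_edgeVec (k : ℤ) : conj (edgeVec m r k) = edgeVec m r (-k) := by
  rw [edgeVec, edgeVec, map_mul, conj_rot, Complex.conj_ofReal]

lemma cross_edgeVec (i j : ℤ) :
    cross (edgeVec m r i) (edgeVec m r j) = r ^ 2 * Real.sin ((j - i : ℤ) * (2 * Real.pi / m)) := by
  rw [cross, conj_edgeVec, edgeVec, edgeVec, sub_eq_add_neg, add_comm j, ← rot_im, rot_add]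
  rw [show (r : ℂ) * (rot m (-i) : ℂ) * (r * (rot m j : ℂ)) =
    ((r ^ 2 : ℝ) : ℂ) * ((rot m (-i) * rot m j : Circle) : ℂ) by
      rw [Circle.coe_mul]; push_cast; ring, Complex.im_ofReal_mul]

lemma sin_mul_pos {d : ℤ} (hd : 0 < d) (hdm : 2 * d < m) :
    0 < Real.sin (d * (2 * Real.pi / m)) := by
  have hm : (0 : ℝ) < m := by exact_mod_cast (by omega : (0 : ℤ) < m)
  have h1 : (0 : ℝ) < d := by exact_mod_cast hd
  have h2 : 2 * (d : ℝ) < m := by exact_mod_cast hdm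
  have hpi := Real.pi_pos
  refine Real.sin_pos_of_pos_of_lt_pi (by positivity) ?_
  rw [show (d : ℝ) * (2 * Real.pi / m) = (2 * d) * Real.pi / m by ring, div_lt_iff₀ hm]
  nlinarith

lemma cross_edgeVec_pos (hr : 0 < r) {i j : ℤ} (h : i < j) (h' : 2 * (j - i) < m) :
    0 < cross (edgeVec m r i) (edgeVec m r j) := by
  rw [cross_edgeVec]
  exact mul_pos (by positivity) (sin_mul_pos (by omega) h')

lemma edgeVec_antipode (hm : m ≠ 0) {i j : ℤ} (h : 2 * (j - i) = m) :
    edgeVec m r j = -edgeVec m r i := by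
  have : rot m (j - i) = Circle.exp Real.pi := by
    have hm' : (m : ℝ) ≠ 0 := by exact_mod_cast hm
    have h2 : 2 * ((j - i : ℤ) : ℝ) = m := by exact_mod_cast h
    rw [rot]; congr 1
    rw [show 2 * Real.pi * ((j - i : ℤ) : ℝ) = Real.pi * (2 * ((j - i : ℤ) : ℝ)) by ring, h2]
    field_simp
  rw [show j = (j - i) + i by ring, ← rot_mul_edgeVec, this, Circle.coe_exp, Complex.exp_pi_mul_I]
  ring

lemma cross_edgeVec_nonneg (hr : 0 < r) {i j : ℤ} (h : i ≤ j) (h' : 2 * (j - i) ≤ m) :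
    0 ≤ cross (edgeVec m r i) (edgeVec m r j) := by
  rcases h.eq_or_lt with rfl | h
  · rw [cross_self]
  rcases h'.eq_or_lt with h' | h'
  · rw [edgeVec_antipode (by rintro rfl; simp at h'; omega) h', cross_neg_right, cross_self,
      neg_zero]
  · exact (cross_edgeVec_pos hr h h').le

lemma edgeVec_ne_zero (hr : 0 < r) (k : ℤ) : edgeVec m r k ≠ 0 :=
  mul_ne_zero (by exact_mod_cast hr.ne') (Circle.coe_ne_zero _)

lemma norm_edgeVec (hr : 0 < r) (k : ℤ) : ‖edgeVec m r k‖ = r := by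
  rw [edgeVec, norm_mul, Circle.norm_coe, mul_one, Complex.norm_real, Real.norm_of_nonneg hr.le]

lemma turning_edgeVec (hm : 5 ≤ m) (hr : 0 < r) (k : ℤ) :
    Turning (edgeVec m r k) (edgeVec m r (k + 1)) (edgeVec m r (k + 2)) :=
  ⟨cross_edgeVec_pos hr (by omega) (by omega), cross_edgeVec_pos hr (by omega) (by omega),
    cross_edgeVec_pos hr (by omega) (by omega)⟩

/-- The sum of two edge vectors two steps apart is a multiple of the one between them. -/
lemma edgeVec_add_edgeVec (k : ℤ) :
    edgeVec m r k + edgeVec m r (k + 2) =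
      (2 * Real.cos (2 * Real.pi / m)) • edgeVec m r (k + 1) := by
  have h1 : edgeVec m r k = rot m (-1) * edgeVec m r (k + 1) := by
    rw [rot_mul_edgeVec]; congr 1; ring
  have h2 : edgeVec m r (k + 2) = rot m 1 * edgeVec m r (k + 1) := by
    rw [rot_mul_edgeVec]; congr 1; ring
  rw [h1, h2, ← add_mul, Complex.real_smul]
  congr 1
  apply Complex.ext
  · rw [Complex.add_re, rot_re, rot_re, Complex.ofReal_re]
    simp; ring
  · rw [Complex.add_im, rot_im, rot_im, Complex.ofReal_im]
    simp

lemma cos_pos_of_five_le (hm : 5 ≤ m) : 0 < Real.cos (2 * Real.pi / m) := by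
  have hm' : (5 : ℝ) ≤ m := by exact_mod_cast hm
  have hpi := Real.pi_pos
  apply Real.cos_pos_of_mem_Ioo
  constructor
  · have : 0 < 2 * Real.pi / m := by positivity
    linarith
  · rw [div_lt_iff₀ (by linarith)]; nlinarith

end EdgeVec

/-! ### Fans of sectors -/

/-- The hexagon with first vertex `v` whose edges have the directions `k, k + 1, k + 2`. -/
def tile (m : ℕ) (r : ℝ) (k : ℤ) (v : ℂ) : Polygon ℂ 6 :=
  zonogon v (edgeVec m r k) (edgeVec m r (k + 1)) (edgeVec m r (k + 2))

/-- The position of the tile `(j, l)` in the sector with number `k` and corner `p k`. -/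
def corner (m : ℕ) (r : ℝ) (p : ℤ → ℂ) (k : ℤ) (j l : ℕ) : ℂ :=
  p k + (j : ℝ) • (edgeVec m r k + edgeVec m r (k + 1)) +
    (l : ℝ) • (edgeVec m r (k + 1) + edgeVec m r (k + 2))

/-- The tile `(j, l)` of the sector with number `k`. -/
def fanTile (m : ℕ) (r : ℝ) (p : ℤ → ℂ) (k : ℤ) (j l : ℕ) : Polygon ℂ 6 :=
  tile m r k (corner m r p k j l)

/-- The corners `p k` of `m` sectors that fit together around a point or a hole. Sector `k` lies in
the angle at `p k` between the directions `k` and `k + 2`; its boundary with sector `k + 1` is a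
zigzag that starts with an extra edge on one side or the other. -/
structure IsFan (m : ℕ) (r : ℝ) (p : ℤ → ℂ) : Prop where
  period : ∀ k, p (k + m) = p k
  adj : ∀ k, p (k + 1) = p k + edgeVec m r (k + 2) ∨ p k = p (k + 1) + edgeVec m r (k + 1)
  far : ∀ k d : ℤ, 2 ≤ d → 2 * d ≤ m →
    0 < cross (edgeVec m r (k + 2)) (p (k + d) - p k) ∨ p k = p (k + d)

section Fan

variable {m : ℕ} {r : ℝ} {p : ℤ → ℂ}

lemma IsFan.period_mul (hp : IsFan m r p) (k q : ℤ) : p (k + m * q) = p k := by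
  induction q using Int.induction_on with
  | zero => simp
  | succ i ih => rw [mul_add, mul_one, ← add_assoc, hp.period, ih]
  | pred i ih =>
    rw [← ih, ← hp.period (k + m * (-i - 1))]; congr 1; ring

lemma IsFan.fanTile_add_mul (hp : IsFan m r p) (hm : m ≠ 0) (k q : ℤ) (j l : ℕ) :
    fanTile m r p (k + m * q) j l = fanTile m r p k j l := by
  have h1 : k + m * q + 1 = (k + 1) + m * q := by ring
  have h2 : k + m * q + 2 = (k + 2) + m * q := by ring
  simp only [fanTile, tile, corner, h1, h2, edgeVec_add_mul hm, hp.period_mul]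

lemma tile_isCCW (hm : 5 ≤ m) (hr : 0 < r) (k : ℤ) (v : ℂ) : IsCCW (tile m r k v) :=
  zonogon_isCCW (turning_edgeVec hm hr k)

lemma IsFan.compat_next (hp : IsFan m r p) (hm : 5 ≤ m) (hr : 0 < r) (k : ℤ) (j l j' l' : ℕ) :
    Compat (fanTile m r p k j l) (fanTile m r p (k + 1) j' l') := by
  have key : ∀ j'' : ℤ, Compat (fanTile m r p k j l)
      (zonogon (p k + edgeVec m r (k + 2) +
        (j'' : ℝ) • (edgeVec m r (k + 1) + edgeVec m r (k + 2)) +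
        (l' : ℝ) • (edgeVec m r (k + 2) + edgeVec m r (k + 3)))
        (edgeVec m r (k + 1)) (edgeVec m r (k + 2)) (edgeVec m r (k + 3))) := by
    intro j''
    have hs : ∀ i j : ℤ, cross (edgeVec m r i) (edgeVec m r j) =
        cross (edgeVec m r k) (edgeVec m r (k + (j - i))) := by
      intro i j
      rw [cross_edgeVec, cross_edgeVec]; congr 3; ring_nf
    refine compat_adjacent (s₁ := cross (edgeVec m r k) (edgeVec m r (k + 1)))
      (s₂ := cross (edgeVec m r k) (edgeVec m r (k + 2)))
      (κ := 2 * Real.cos (2 * Real.pi / m)) (cross_edgeVec_pos hr (by omega) (by omega))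
      (cross_edgeVec_pos hr (by omega) (by omega)) (by linarith [cos_pos_of_five_le hm])
      rfl ?_ ?_ rfl ?_ (edgeVec_add_edgeVec k) _ _ _ _ _
    · rw [hs]; congr 2; ring
    · rw [hs]; congr 2; ring
    · rw [hs]; congr 2; ring
  have e2 : k + 1 + 1 = k + 2 := by ring
  have e3 : k + 1 + 2 = k + 3 := by ring
  rcases hp.adj k with h | h
  · convert key j' using 1
    simp only [fanTile, tile, corner, h, e2, e3, Int.cast_natCast]
  · convert key (j' - 1) using 1
    simp only [fanTile, tile, corner, h, e2, e3]
    congr 1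
    push_cast
    module

lemma IsFan.compat_far (hp : IsFan m r p) (hm : 5 ≤ m) (hr : 0 < r) (k : ℤ) {d : ℤ} (hd : 2 ≤ d)
    (hdm : 2 * d ≤ m) (j l j' l' : ℕ) :
    Compat (fanTile m r p k j l) (fanTile m r p (k + d) j' l') := by
  refine PolygonPattern.compat_far (turning_edgeVec hm hr k)
    (cross_edgeVec_nonneg hr (by omega) (by omega))
    (cross_edgeVec_pos hr (by omega) (by omega))
    (cross_edgeVec_nonneg hr (by omega) (by omega)) _ _ _ _ ?_
  rcases hp.far k d hd hdm with h | h
  · exact Or.inl h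
  refine Or.inr ⟨h, ?_⟩
  rcases hd.eq_or_lt with rfl | hd'
  · exact Or.inl ⟨rfl, cross_edgeVec_pos hr (by omega) (by omega)⟩
  refine Or.inr ⟨cross_edgeVec_pos hr (by omega) (by omega), ?_⟩
  rcases hdm.eq_or_lt with h' | h'
  · exact Or.inr (edgeVec_antipode (by omega) (by omega))
  · exact Or.inl (cross_edgeVec_pos hr (by omega) (by omega))

/-- Any two different tiles of a fan fit together. -/
theorem IsFan.eq_or_compat (hp : IsFan m r p) (hm : 5 ≤ m) (hr : 0 < r) (k k' : ℤ)
    (j l j' l' : ℕ) :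
    ((m : ℤ) ∣ k' - k ∧ j = j' ∧ l = l') ∨
      Compat (fanTile m r p k j l) (fanTile m r p k' j' l') := by
  have hm0 : m ≠ 0 := by omega
  -- sectors at an oriented distance of at most half a turn
  have key : ∀ (k d : ℤ) (j l j' l' : ℕ), 0 < d → 2 * d ≤ m →
      Compat (fanTile m r p k j l) (fanTile m r p (k + d) j' l') := by
    intro k d j l j' l' hd hdm
    rcases (by omega : d = 1 ∨ 2 ≤ d) with rfl | hd2
    · exact hp.compat_next hm hr k j l j' l'
    · exact hp.compat_far hm hr k hd2 hdm j l j' l'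
  have hdiv := Int.emod_add_mul_ediv (k' - k) m
  have hnn := Int.emod_nonneg (k' - k) (by omega : (m : ℤ) ≠ 0)
  have hlt := Int.emod_lt_of_pos (k' - k) (by omega : (0 : ℤ) < m)
  set d := (k' - k) % m
  set q := (k' - k) / m
  have ek' : k' = (k + d) + m * q := by linarith
  rcases hnn.eq_or_lt with h0 | hpos
  · rw [← h0, add_zero] at ek'
    by_cases hjl : j = j' ∧ l = l'
    · exact Or.inl ⟨⟨q, by linarith⟩, hjl⟩
    · right
      rw [ek', hp.fanTile_add_mul hm0]
      have := compat_lattice (turning_edgeVec hm hr k) (p k) (j := j) (l := l) (j' := j')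
        (l' := l') (by omega)
      simpa [fanTile, tile, corner] using this
  · right
    by_cases h2 : 2 * d ≤ m
    · rw [ek', hp.fanTile_add_mul hm0]
      exact key k d j l j' l' hpos h2
    · have ek : k = (k' + (m - d)) + m * (-q - 1) := by rw [ek']; ring
      rw [ek, hp.fanTile_add_mul hm0]
      exact (key k' (m - d) j' l' j l (by omega) (by omega)).symm

end Fan

/-! ### Covering by matching edges -/

/-- The directed segment from `u` to `u + e` is an edge of `P`, in the order of its vertices. -/
def HasEdge {n : ℕ} (P : Polygon ℂ n) (u e : ℂ) : Prop :=
  ∃ i, P i = u ∧ P (finRotate n i) = u + e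

/-- Two strictly convex polygons on the two sides of a common edge cover a neighbourhood of each of
its relatively interior points. -/
lemma union_mem_nhds_of_hasEdge {n n' : ℕ} {P : Polygon ℂ n} {Q : Polygon ℂ n'} (hP : IsCCW P)
    (hQ : IsCCW Q) (hn : 3 ≤ n) (hn' : 3 ≤ n') {u e z : ℂ} (h : HasEdge P u e)
    (h' : HasEdge Q (u + e) (-e)) (hz : z ∈ openSegment ℝ u (u + e)) :
    region P ∪ region Q ∈ 𝓝 z := by
  obtain ⟨i, hi, hi'⟩ := h
  obtain ⟨j, hj, hj'⟩ := h'
  rw [add_neg_cancel_right] at hj'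
  have h1 := hP.eventually_mem_region hn (i := i) (z := z) (by rwa [hi, hi'])
  have h2 := hQ.eventually_mem_region hn' (i := j) (z := z)
    (by rw [hj, hj', openSegment_symm]; exact hz)
  filter_upwards [h1, h2] with w hw1 hw2
  rcases le_total 0 (edgeFn P i w) with h0 | h0
  · exact Or.inl (hw1 h0)
  · refine Or.inr (hw2 ?_)
    have : edgeFn Q j w = -edgeFn P i w := by
      rw [edgeFn, edgeFn, hi, hi', hj, hj']
      simp [cross_eq]; ring
    linarith

/-- A closed set that is a neighbourhood of each of its points outside a countable set is the whole
plane, because the complement of a countable set is connected and dense. -/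
lemma eq_univ_of_mem_nhds {U V : Set ℂ} (hU : IsClosed U) (hV : V.Countable)
    (hne : (interior U).Nonempty) (h : ∀ z ∈ U, z ∉ V → U ∈ 𝓝 z) : U = univ := by
  have hrank : 1 < Module.rank ℝ ℂ := by rw [Complex.rank_real_complex]; norm_num
  have hconn := (hV.isConnected_compl_of_one_lt_rank hrank).isPreconnected
  have hdense : Dense Vᶜ := hV.dense_compl ℝ
  have hsub : Vᶜ ⊆ interior U := by
    refine hconn.subset_left_of_subset_union isOpen_interior hU.isOpen_compl ?_ ?_ ?_
    · exact disjoint_compl_right.mono_left interior_subset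
    · intro z hz
      by_cases hzU : z ∈ U
      · exact Or.inl (mem_interior_iff_mem_nhds.2 (h z hzU hz))
      · exact Or.inr hzU
    · rw [inter_comm]; exact hdense.inter_open_nonempty _ isOpen_interior hne
  have := hdense.mono (hsub.trans interior_subset)
  rw [← hU.closure_eq]
  exact this.closure_eq

lemma hasEdge_zonogon {v a b c u e : ℂ} (h : HasEdge (zonogon v a b c) u e) :
    (u = v ∧ e = a) ∨ (u = v + a ∧ e = b) ∨ (u = v + a + b ∧ e = c) ∨
    (u = v + a + b + c ∧ e = -a) ∨ (u = v + b + c ∧ e = -b) ∨ (u = v + c ∧ e = -c) := by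
  obtain ⟨i, rfl, hi⟩ := h
  have he : e = zonogon v a b c (finRotate 6 i) - zonogon v a b c i := by rw [hi]; ring
  clear hi
  subst he
  fin_cases i
  · left; simp [zonogon]
  · right; left; simp [zonogon]
  · right; right; left; simp [zonogon]
  · right; right; right; left; simp [zonogon]
  · right; right; right; right; left; simp [zonogon]
  · right; right; right; right; right; simp [zonogon]

section

variable {v a b c u e : ℂ}

lemma hasEdge_zero (h : u = v) (he : e = a) : HasEdge (zonogon v a b c) u e :=
  ⟨0, by simp [zonogon, h], by simp [zonogon, h, he]⟩

lemma hasEdge_one (h : u = v + a) (he : e = b) : HasEdge (zonogon v a b c) u e :=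
  ⟨1, by simp [zonogon, h], by simp [zonogon, h, he]⟩

lemma hasEdge_two (h : u = v + a + b) (he : e = c) : HasEdge (zonogon v a b c) u e :=
  ⟨2, by simp [zonogon, h], by simp [zonogon, h, he]⟩

lemma hasEdge_three (h : u = v + a + b + c) (he : e = -a) : HasEdge (zonogon v a b c) u e :=
  ⟨3, by simp [zonogon, h], by simp [zonogon, h, he]; ring⟩

lemma hasEdge_four (h : u = v + b + c) (he : e = -b) : HasEdge (zonogon v a b c) u e :=
  ⟨4, by simp [zonogon, h], by simp [zonogon, h, he]; ring⟩

lemma hasEdge_five (h : u = v + c) (he : e = -c) : HasEdge (zonogon v a b c) u e :=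
  ⟨5, by simp [zonogon, h], by simp [zonogon, h, he]⟩

end

section Fan

variable {m : ℕ} {r : ℝ} {p : ℤ → ℂ}

/-- Each directed edge of a tile is an edge of another tile in the opposite direction, except
possibly the edges at the corners of the sectors where the zigzag boundaries begin. -/
lemma IsFan.exists_hasEdge (hp : IsFan m r p) {k : ℤ} {j l : ℕ} {u e : ℂ}
    (h : HasEdge (fanTile m r p k j l) u e) :
    (∃ k' j' l', HasEdge (fanTile m r p k' j' l') (u + e) (-e)) ∨
    (u = p k ∧ e = edgeVec m r k ∧ p (k - 1) = p k + edgeVec m r k) ∨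
    (u = p k + edgeVec m r (k + 2) ∧ e = -edgeVec m r (k + 2) ∧
      p (k + 1) = p k + edgeVec m r (k + 2)) := by
  have i1 : k - 1 + 1 = k := by ring
  have i2 : k - 1 + 2 = k + 1 := by ring
  have i3 : k + 1 + 1 = k + 2 := by ring
  have hprev := hp.adj (k - 1)
  rw [i1, i2] at hprev
  have hnext := hp.adj k
  rcases hasEdge_zonogon h with h | h | h | h | h | h <;> obtain ⟨rfl, rfl⟩ := h
  · rcases l with _ | l
    · rcases hprev with hpr | hpr
      · refine Or.inl ⟨k - 1, 0, j, hasEdge_four ?_ ?_⟩ <;> simp only [i1, i2]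
        simp only [corner, hpr, i1, i2]; push_cast; module
      · rcases j with _ | j
        · exact Or.inr (Or.inl ⟨by simp [corner], rfl, hpr⟩)
        · refine Or.inl ⟨k - 1, 0, j, hasEdge_four ?_ ?_⟩ <;> simp only [i1, i2]
          simp only [corner, hpr, i1, i2]; push_cast; module
    · refine Or.inl ⟨k, j, l, hasEdge_three ?_ rfl⟩
      simp only [corner]; push_cast; module
  · rcases l with _ | l
    · left
      rcases hprev with hpr | hpr
      · refine ⟨k - 1, 0, j + 1, hasEdge_five ?_ (by simp only [i2])⟩
        simp only [corner, hpr, i1, i2]; push_cast; module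
      · refine ⟨k - 1, 0, j, hasEdge_five ?_ (by simp only [i2])⟩
        simp only [corner, hpr, i1, i2]; push_cast; module
    · refine Or.inl ⟨k, j + 1, l, hasEdge_four ?_ rfl⟩
      simp only [corner]; push_cast; module
  · refine Or.inl ⟨k, j + 1, l, hasEdge_five ?_ rfl⟩
    simp only [corner]; push_cast; module
  · refine Or.inl ⟨k, j, l + 1, hasEdge_zero ?_ (by rw [neg_neg])⟩
    simp only [corner]; push_cast; module
  · rcases j with _ | j
    · left
      rcases hnext with hpr | hpr
      · refine ⟨k + 1, l, 0, hasEdge_zero ?_ (by rw [neg_neg])⟩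
        simp only [corner, hpr, i3]; push_cast; module
      · refine ⟨k + 1, l + 1, 0, hasEdge_zero ?_ (by rw [neg_neg])⟩
        simp only [corner, hpr, i3]; push_cast; module
    · refine Or.inl ⟨k, j, l + 1, hasEdge_one ?_ (by rw [neg_neg])⟩
      simp only [corner]; push_cast; module
  · rcases j with _ | j
    · rcases hnext with hpr | hpr
      · rcases l with _ | l
        · exact Or.inr (Or.inr ⟨by simp [corner], rfl, hpr⟩)
        · refine Or.inl ⟨k + 1, l, 0, hasEdge_one ?_ (by simp only [i3, neg_neg])⟩
          simp only [corner, hpr, i3]; push_cast; module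
      · refine Or.inl ⟨k + 1, l, 0, hasEdge_one ?_ (by simp only [i3, neg_neg])⟩
        simp only [corner, hpr, i3]; push_cast; module
    · refine Or.inl ⟨k, j, l, hasEdge_two ?_ (by rw [neg_neg])⟩
      simp only [corner]; push_cast; module

/-- The union of all tiles of a fan. -/
def fanUnion (m : ℕ) (r : ℝ) (p : ℤ → ℂ) : Set ℂ :=
  ⋃ k : ℤ, ⋃ x : ℕ × ℕ, region (fanTile m r p k x.1 x.2)

lemma region_subset_fanUnion (k : ℤ) (j l : ℕ) :
    region (fanTile m r p k j l) ⊆ fanUnion m r p :=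
  fun _ hz => mem_iUnion.2 ⟨k, mem_iUnion.2 ⟨(j, l), hz⟩⟩

/-- The component along the middle direction of a sector. -/
lemma cross_neg_I_edgeVec (i j : ℤ) :
    cross (-Complex.I * edgeVec m r i) (edgeVec m r j) =
      r ^ 2 * Real.cos ((j - i : ℤ) * (2 * Real.pi / m)) := by
  rw [← rot_re, sub_eq_add_neg, add_comm, rot_add, cross, map_mul, conj_edgeVec, edgeVec, edgeVec]
  rw [show conj (-Complex.I) * ((r : ℂ) * (rot m (-i) : ℂ)) * (r * (rot m j : ℂ)) =
    ((r ^ 2 : ℝ) : ℂ) * (Complex.I * ((rot m (-i) * rot m j : Circle) : ℂ)) by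
      rw [Circle.coe_mul]; simp; ring, Complex.im_ofReal_mul, Complex.I_mul_im]

lemma cross_neg_I_edgeVec_self (i : ℤ) :
    cross (-Complex.I * edgeVec m r i) (edgeVec m r i) = r ^ 2 := by
  rw [cross_neg_I_edgeVec]; simp

lemma cross_neg_I_edgeVec_pred (i : ℤ) :
    cross (-Complex.I * edgeVec m r (i + 1)) (edgeVec m r i) =
      r ^ 2 * Real.cos (2 * Real.pi / m) := by
  rw [cross_neg_I_edgeVec, show i - (i + 1) = -1 by ring]; simp

lemma cross_neg_I_edgeVec_succ (i : ℤ) :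
    cross (-Complex.I * edgeVec m r (i + 1)) (edgeVec m r (i + 2)) =
      r ^ 2 * Real.cos (2 * Real.pi / m) := by
  rw [cross_neg_I_edgeVec, show i + 2 - (i + 1) = 1 by ring]; simp

/-- Tiles far out in a sector are far away from its corner. -/
lemma add_mul_le_of_mem_fanTile (hm : 5 ≤ m) {k : ℤ} {j l : ℕ} {z : ℂ}
    (hz : z ∈ region (fanTile m r p k j l)) :
    ((j : ℝ) + l) * r ^ 2 ≤ cross (-Complex.I * edgeVec m r (k + 1)) (z - p k) := by
  obtain ⟨α, β, γ, k1, k2, k3, k4, k5, k6, rfl⟩ := exists_coeffs hz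
  simp only [corner, cross_sub_right, cross_add_right, cross_smul_right,
    cross_neg_I_edgeVec_self, cross_neg_I_edgeVec_pred, cross_neg_I_edgeVec_succ]
  have hC := (cos_pos_of_five_le hm).le
  have h1 : 0 ≤ r ^ 2 * Real.cos (2 * Real.pi / m) := by positivity
  have h2 : 0 ≤ r ^ 2 := by positivity
  have hj : (0 : ℝ) ≤ j := Nat.cast_nonneg j
  have hl : (0 : ℝ) ≤ l := Nat.cast_nonneg l
  nlinarith [mul_nonneg hj h1, mul_nonneg hl h1, mul_nonneg k1 h1, mul_nonneg k3 h2,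
    mul_nonneg k5 h1]

lemma IsFan.isClosed_fanUnion (hp : IsFan m r p) (hm : 5 ≤ m) (hr : 0 < r) :
    IsClosed (fanUnion m r p) := by
  have e : fanUnion m r p =
      ⋃ k ∈ Finset.range m, ⋃ x : ℕ × ℕ, region (fanTile m r p k x.1 x.2) := by
    refine Subset.antisymm ?_ ?_
    · refine iUnion_subset fun k => ?_
      have h1 := Int.emod_nonneg k (by omega : (m : ℤ) ≠ 0)
      have h2 := Int.emod_lt_of_pos k (by omega : (0 : ℤ) < m)
      obtain ⟨q, hq⟩ := Int.eq_ofNat_of_zero_le h1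
      have hk : k = q + m * (k / m) := by rw [← hq, Int.emod_add_mul_ediv]
      rw [hk]
      simp only [hp.fanTile_add_mul (by omega : m ≠ 0)]
      exact subset_biUnion_of_mem (u := fun k : ℕ => ⋃ x : ℕ × ℕ, region (fanTile m r p k x.1 x.2))
        (by simpa using (by omega : q < m))
    · exact iUnion₂_subset fun k _ => subset_iUnion
        (fun k : ℤ => ⋃ x : ℕ × ℕ, region (fanTile m r p k x.1 x.2)) k
  rw [e]
  refine isClosed_biUnion_finset fun k _ => LocallyFinite.isClosed_iUnion ?_ fun x =>
    isClosed_region _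
  intro z
  refine ⟨Metric.ball z 1, Metric.ball_mem_nhds z one_pos, ?_⟩
  obtain ⟨N, hN⟩ := exists_nat_ge ((‖z - p k‖ + 1) / r)
  refine ((Finset.range (N + 1) ×ˢ Finset.range (N + 1)).finite_toSet).subset ?_
  rintro ⟨j, l⟩ ⟨w, hw, hwz⟩
  have h1 := add_mul_le_of_mem_fanTile hm hw
  have h2 : cross (-Complex.I * edgeVec m r (k + 1)) (w - p k) ≤ r * ‖w - p k‖ := by
    refine (Complex.im_le_norm _).trans ?_
    rw [norm_mul, Complex.norm_conj, norm_mul, norm_neg, Complex.norm_I, one_mul, norm_edgeVec hr]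
  have h3 : ‖w - p k‖ ≤ ‖z - p k‖ + 1 := by
    have : w - p k = (w - z) + (z - p k) := by ring
    rw [this]
    refine (norm_add_le _ _).trans ?_
    have := mem_ball_iff_norm.1 hwz
    linarith
  have h4 : (j : ℝ) + l ≤ (‖z - p k‖ + 1) / r := by
    rw [le_div_iff₀ hr]
    have : ((j : ℝ) + l) * r * r ≤ (‖z - p k‖ + 1) * r := by nlinarith
    exact le_of_mul_le_mul_right this hr
  have h5 : j + l ≤ N := by exact_mod_cast h4.trans hN
  simp only [Finset.coe_product, Finset.coe_range, mem_prod, mem_Iio]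
  omega

/-- If the remaining edges at the corners are matched as well, by tiles or by an additional closed
set `K` that fills a hole, then the plane is covered. -/
theorem IsFan.fanUnion_union_eq_univ (hp : IsFan m r p) (hm : 5 ≤ m) (hr : 0 < r) {K : Set ℂ}
    (hK : IsClosed K)
    (hK' : ∀ z ∈ K, (∀ k, z ≠ p k) → fanUnion m r p ∪ K ∈ 𝓝 z)
    (h1 : ∀ k, p (k - 1) = p k + edgeVec m r k →
      ∀ z ∈ openSegment ℝ (p k) (p k + edgeVec m r k), fanUnion m r p ∪ K ∈ 𝓝 z)
    (h2 : ∀ k, p (k + 1) = p k + edgeVec m r (k + 2) →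
      ∀ z ∈ openSegment ℝ (p k) (p k + edgeVec m r (k + 2)), fanUnion m r p ∪ K ∈ 𝓝 z) :
    fanUnion m r p ∪ K = univ := by
  have hn : 3 ≤ 6 := by norm_num
  refine eq_univ_of_mem_nhds (V := ⋃ k : ℤ, ⋃ x : ℕ × ℕ, range (fanTile m r p k x.1 x.2).vertices)
    ((hp.isClosed_fanUnion hm hr).union hK) ?_ ?_ ?_
  · exact countable_iUnion fun k => countable_iUnion fun x => (finite_range _).countable
  · refine ((tile_isCCW hm hr 0 (corner m r p 0 0 0)).interior_nonempty hn).mono ?_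
    exact interior_mono ((region_subset_fanUnion 0 0 0).trans subset_union_left)
  · intro z hz hzV
    rcases hz with hz | hz
    · obtain ⟨k, hz⟩ := mem_iUnion.1 hz
      obtain ⟨⟨j, l⟩, hz⟩ := mem_iUnion.1 hz
      have hccw := tile_isCCW hm hr k (corner m r p k j l)
      rcases hccw.trichotomy hn hz with h | ⟨i, h⟩ | ⟨i, h⟩
      · exact mem_of_superset h ((region_subset_fanUnion k j l).trans subset_union_left)
      · exact (hzV (mem_iUnion.2 ⟨k, mem_iUnion.2 ⟨(j, l), i, h.symm⟩⟩)).elim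
      · set P := fanTile m r p k j l
        have hE : HasEdge P (P i) (P (finRotate 6 i) - P i) := ⟨i, rfl, by ring⟩
        have h' : z ∈ openSegment ℝ (P i) (P i + (P (finRotate 6 i) - P i)) := by
          rwa [add_sub_cancel]
        rcases hp.exists_hasEdge hE with ⟨k', j', l', hE'⟩ | ⟨e1, e2, e3⟩ | ⟨e1, e2, e3⟩
        · refine mem_of_superset (union_mem_nhds_of_hasEdge hccw
            (tile_isCCW hm hr k' (corner m r p k' j' l')) hn hn hE hE' h') ?_
          exact (union_subset (region_subset_fanUnion _ _ _)
            (region_subset_fanUnion _ _ _)).trans subset_union_left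
        · rw [e2, e1] at h'
          exact h1 k e3 z h'
        · rw [e2, e1, add_neg_cancel_right, openSegment_symm] at h'
          exact h2 k e3 z h'
    · refine hK' z hz fun k hk => hzV (mem_iUnion.2 ⟨k, mem_iUnion.2 ⟨(0, 0), 0, ?_⟩⟩)
      rw [hk]; simp [fanTile, tile, zonogon, corner]

/-! ### Placements and tilings -/

/-- The orientation preserving isometry `z ↦ v + u * z`. -/
def directIso (u : Circle) (v : ℂ) : ℂ ≃ᵢ ℂ :=
  (rotation u).toIsometryEquiv.trans (IsometryEquiv.addLeft v)

/-- The orientation reversing isometry `z ↦ v + u * conj z`. -/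
def oppositeIso (u : Circle) (v : ℂ) : ℂ ≃ᵢ ℂ :=
  (Complex.conjLIE.trans (rotation u)).toIsometryEquiv.trans (IsometryEquiv.addLeft v)

@[simp] lemma directIso_apply (u : Circle) (v z : ℂ) : directIso u v z = v + u * z := by
  simp [directIso]

@[simp] lemma oppositeIso_apply (u : Circle) (v z : ℂ) :
    oppositeIso u v z = v + u * conj z := by
  simp [oppositeIso]

/-- The hexagon of the tilings in standard position. -/
def stdHexagon (m : ℕ) (r : ℝ) : Polygon ℂ 6 := tile m r 0 0

/-- The motions that place the standard hexagon as the tiles of a fan. -/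
def fanPlacements (m : ℕ) (r : ℝ) (p : ℤ → ℂ) : Set (ℂ ≃ᵢ ℂ) :=
  {g | ∃ (k : ℤ) (j l : ℕ), g = directIso (rot m k) (corner m r p k j l)}

lemma movePolygon_zonogon_direct (u : Circle) (v v' a b c : ℂ) :
    movePolygon (directIso u v) (zonogon v' a b c) =
      zonogon (v + u * v') (u * a) (u * b) (u * c) := by
  unfold movePolygon
  congr 1
  ext i
  fin_cases i <;> simp [zonogon] <;> ring

lemma movePolygon_stdHexagon (k : ℤ) (v : ℂ) :
    movePolygon (directIso (rot m k) v) (stdHexagon m r) = tile m r k v := by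
  rw [stdHexagon, tile, movePolygon_zonogon_direct]
  simp only [rot_mul_edgeVec, mul_zero, add_zero, zero_add, tile]

lemma mem_copies_fanPlacements {P : Polygon ℂ 6} :
    P ∈ copies (fanPlacements m r p) (stdHexagon m r) ↔
      ∃ k j l, P = fanTile m r p k j l := by
  constructor
  · rintro ⟨_, ⟨k, j, l, rfl⟩, rfl⟩
    exact ⟨k, j, l, movePolygon_stdHexagon _ _⟩
  · rintro ⟨k, j, l, rfl⟩
    exact ⟨_, ⟨k, j, l, rfl⟩, (movePolygon_stdHexagon _ _).symm⟩

lemma IsFan.eq_of_dvd (hp : IsFan m r p) (hm : m ≠ 0) {k k' : ℤ} (h : (m : ℤ) ∣ k' - k)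
    (j l : ℕ) : fanTile m r p k j l = fanTile m r p k' j l := by
  obtain ⟨q, hq⟩ := h
  rw [show k' = k + m * q by linarith, hp.fanTile_add_mul hm]

lemma IsFan.compat_of_ne (hp : IsFan m r p) (hm : 5 ≤ m) (hr : 0 < r) {P Q : Polygon ℂ 6}
    (hP : P ∈ copies (fanPlacements m r p) (stdHexagon m r))
    (hQ : Q ∈ copies (fanPlacements m r p) (stdHexagon m r)) (hne : region P ≠ region Q) :
    Compat P Q := by
  obtain ⟨k, j, l, rfl⟩ := mem_copies_fanPlacements.1 hP
  obtain ⟨k', j', l', rfl⟩ := mem_copies_fanPlacements.1 hQ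
  refine (hp.eq_or_compat hm hr k k' j l j' l').resolve_left ?_
  rintro ⟨hd, rfl, rfl⟩
  exact hne (by rw [hp.eq_of_dvd (by omega) hd])

lemma biUnion_copies_eq :
    ⋃ P ∈ copies (fanPlacements m r p) (stdHexagon m r), region P = fanUnion m r p := by
  ext z
  simp only [mem_iUnion, fanUnion, mem_copies_fanPlacements]
  constructor
  · rintro ⟨_, ⟨k, j, l, rfl⟩, hz⟩
    exact ⟨k, (j, l), hz⟩
  · rintro ⟨k, x, hz⟩
    exact ⟨_, ⟨k, x.1, x.2, rfl⟩, hz⟩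

lemma IsFan.tiles (hp : IsFan m r p) (hm : 5 ≤ m) (hr : 0 < r) :
    Tiles (copies (fanPlacements m r p) (stdHexagon m r)) (fanUnion m r p) :=
  ⟨biUnion_copies_eq, fun _ hP _ hQ hne => (hp.compat_of_ne hm hr hP hQ hne).1⟩

lemma IsFan.edgeToEdge (hp : IsFan m r p) (hm : 5 ≤ m) (hr : 0 < r) :
    EdgeToEdge (copies (fanPlacements m r p) (stdHexagon m r)) :=
  fun _ hP _ hQ hne => (hp.compat_of_ne hm hr hP hQ hne).2

end Fan

/-! ### Isometries and symmetries -/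

/-- Every isometry of the plane is a rotation followed by a translation, or a reflection followed
by a translation. -/
lemma eq_directIso_or_oppositeIso (g : ℂ ≃ᵢ ℂ) :
    ∃ u : Circle, g = directIso u (g 0) ∨ g = oppositeIso u (g 0) := by
  have h0 : (g.trans (IsometryEquiv.addLeft (-(g 0)))) 0 = 0 := by simp
  obtain ⟨u, hu⟩ := linear_isometry_complex
    ((g.trans (IsometryEquiv.addLeft (-(g 0)))).toRealLinearIsometryEquivOfMapZero h0)
  have key : ∀ z, g z = g 0 +
      (g.trans (IsometryEquiv.addLeft (-(g 0)))).toRealLinearIsometryEquivOfMapZero h0 z := by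
    intro z; simp
  refine ⟨u, hu.imp (fun h => ?_) (fun h => ?_)⟩
  · ext1 z; rw [key z, h]; simp
  · ext1 z; rw [key z, h]; simp

lemma isometryEquiv_image_openSegment (g : ℂ ≃ᵢ ℂ) (z w : ℂ) :
    g '' openSegment ℝ z w = openSegment ℝ (g z) (g w) := by
  have := _root_.image_openSegment ℝ (g.toRealAffineIsometryEquiv.toAffineEquiv : ℂ →ᵃ[ℝ] ℂ) z w
  simpa using this

lemma mem_openSegment_image {g : ℂ ≃ᵢ ℂ} {x z w : ℂ} :
    g x ∈ openSegment ℝ (g z) (g w) ↔ x ∈ openSegment ℝ z w := by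
  rw [← isometryEquiv_image_openSegment, g.injective.mem_set_image]

lemma region_movePolygon {n : ℕ} (g : ℂ ≃ᵢ ℂ) (P : Polygon ℂ n) :
    region (movePolygon g P) = g '' region P := by
  have h := (g.toRealAffineIsometryEquiv.toAffineEquiv : ℂ →ᵃ[ℝ] ℂ).image_convexHull
    (range P.vertices)
  have e : range (movePolygon g P).vertices = g '' range P.vertices := by
    rw [← range_comp]; rfl
  rw [region, e, region]
  simpa using h.symm

lemma interior_region_movePolygon {n : ℕ} (g : ℂ ≃ᵢ ℂ) (P : Polygon ℂ n) :
    interior (region (movePolygon g P)) = g '' interior (region P) := by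
  rw [region_movePolygon]
  exact (g.toHomeomorph.image_interior _).symm

lemma movePolygon_trans {n : ℕ} (g h : ℂ ≃ᵢ ℂ) (P : Polygon ℂ n) :
    movePolygon (g.trans h) P = movePolygon h (movePolygon g P) := rfl

section Symmetries

variable {n : ℕ} {T : Set (Polygon ℂ n)} {g h : ℂ ≃ᵢ ℂ}

lemma mem_symmetries_iff : g ∈ symmetries T ↔
    (∀ P ∈ T, ∃ Q ∈ T, g '' region P = region Q) ∧
      (∀ Q ∈ T, ∃ P ∈ T, g '' region P = region Q) := by
  constructor
  · intro hg
    have hg' : (fun K : Set ℂ => g '' K) '' (region '' T) = region '' T := hg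
    constructor
    · intro P hP
      have : g '' region P ∈ region '' T := by
        rw [← hg']; exact ⟨_, ⟨P, hP, rfl⟩, rfl⟩
      obtain ⟨Q, hQ, e⟩ := this
      exact ⟨Q, hQ, e.symm⟩
    · intro Q hQ
      have : region Q ∈ (fun K : Set ℂ => g '' K) '' (region '' T) := by
        rw [hg']; exact ⟨Q, hQ, rfl⟩
      obtain ⟨_, ⟨P, hP, rfl⟩, e⟩ := this
      exact ⟨P, hP, e⟩
  · rintro ⟨h1, h2⟩
    change (fun K : Set ℂ => g '' K) '' (region '' T) = region '' T
    ext K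
    constructor
    · rintro ⟨_, ⟨P, hP, rfl⟩, rfl⟩
      obtain ⟨Q, hQ, e⟩ := h1 P hP
      exact ⟨Q, hQ, e.symm⟩
    · rintro ⟨Q, hQ, rfl⟩
      obtain ⟨P, hP, e⟩ := h2 Q hQ
      exact ⟨_, ⟨P, hP, rfl⟩, e⟩

lemma mem_symmetries_of_maps (h1 : ∀ P ∈ T, ∃ Q ∈ T, g '' region P = region Q)
    (h2 : ∀ P ∈ T, ∃ Q ∈ T, g.symm '' region P = region Q) : g ∈ symmetries T := by
  refine mem_symmetries_iff.2 ⟨h1, fun Q hQ => ?_⟩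
  obtain ⟨P, hP, e⟩ := h2 Q hQ
  refine ⟨P, hP, ?_⟩
  rw [← e, ← image_comp]
  simp

lemma symm_mem_symmetries (hg : g ∈ symmetries T) : g.symm ∈ symmetries T := by
  obtain ⟨h1, h2⟩ := mem_symmetries_iff.1 hg
  refine mem_symmetries_iff.2 ⟨fun P hP => ?_, fun Q hQ => ?_⟩
  · obtain ⟨Q, hQ, e⟩ := h2 P hP
    refine ⟨Q, hQ, ?_⟩
    rw [← e, ← image_comp]; simp
  · obtain ⟨P, hP, e⟩ := h1 Q hQ
    refine ⟨P, hP, ?_⟩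
    rw [← e, ← image_comp]; simp

lemma trans_mem_symmetries (hg : g ∈ symmetries T) (hh : h ∈ symmetries T) :
    g.trans h ∈ symmetries T := by
  obtain ⟨g1, g2⟩ := mem_symmetries_iff.1 hg
  obtain ⟨h1, h2⟩ := mem_symmetries_iff.1 hh
  refine mem_symmetries_iff.2 ⟨fun P hP => ?_, fun Q hQ => ?_⟩
  · obtain ⟨Q, hQ, e⟩ := g1 P hP
    obtain ⟨R, hR, e'⟩ := h1 Q hQ
    refine ⟨R, hR, ?_⟩
    rw [← e', ← e, ← image_comp]; rfl
  · obtain ⟨R, hR, e⟩ := h2 Q hQ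
    obtain ⟨P, hP, e'⟩ := g2 R hR
    refine ⟨P, hP, ?_⟩
    rw [← e, ← e', ← image_comp]; rfl

/-- The points that are interior to some tile. -/
def openPart (T : Set (Polygon ℂ n)) : Set ℂ := ⋃ P ∈ T, interior (region P)

lemma mem_openPart {z : ℂ} : z ∈ openPart T ↔ ∃ P ∈ T, z ∈ interior (region P) := by
  simp [openPart]

lemma apply_mem_openPart (hg : g ∈ symmetries T) {z : ℂ} (hz : z ∈ openPart T) :
    g z ∈ openPart T := by
  obtain ⟨P, hP, hz⟩ := mem_openPart.1 hz
  obtain ⟨Q, hQ, e⟩ := (mem_symmetries_iff.1 hg).1 P hP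
  refine mem_openPart.2 ⟨Q, hQ, ?_⟩
  rw [← e]
  have : g '' interior (region P) = interior (g '' region P) := g.toHomeomorph.image_interior _
  rw [← this]
  exact ⟨z, hz, rfl⟩

lemma apply_mem_openPart_iff (hg : g ∈ symmetries T) {z : ℂ} :
    g z ∈ openPart T ↔ z ∈ openPart T := by
  refine ⟨fun h => ?_, apply_mem_openPart hg⟩
  simpa using apply_mem_openPart (symm_mem_symmetries hg) h

/-- The boundary points of a tile are not interior to any other tile of a tiling. -/
lemma not_mem_openPart {S : Set ℂ} (hT : Tiles T S) {P : Polygon ℂ n} (hP : P ∈ T)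
    (hcl : closure (interior (region P)) = region P) {z : ℂ} (hz : z ∈ region P)
    (hz' : z ∉ interior (region P)) : z ∉ openPart T := by
  intro h
  obtain ⟨Q, hQ, hzQ⟩ := mem_openPart.1 h
  have hne : region P ≠ region Q := fun e => hz' (by rw [e]; exact hzQ)
  rw [← hcl] at hz
  obtain ⟨w, hw, hw'⟩ := mem_closure_iff.1 hz _ isOpen_interior hzQ
  exact Set.disjoint_left.1 (hT.2 P hP Q hQ hne) hw' hw

variable {G : Set (ℂ ≃ᵢ ℂ)} {P : Polygon ℂ n}

/-- A motion that permutes the placements by composition is a symmetry. -/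
lemma mem_symmetries_of_comp {ρ : ℂ ≃ᵢ ℂ} (h1 : ∀ g ∈ G, g.trans ρ ∈ G)
    (h2 : ∀ g ∈ G, g.trans ρ.symm ∈ G) : ρ ∈ symmetries (copies G P) := by
  have key : ∀ τ : ℂ ≃ᵢ ℂ, (∀ g ∈ G, g.trans τ ∈ G) →
      ∀ Q ∈ copies G P, ∃ R ∈ copies G P, τ '' region Q = region R := by
    rintro τ hτ _ ⟨g, hg, rfl⟩
    exact ⟨_, ⟨_, hτ g hg, rfl⟩, by rw [movePolygon_trans, region_movePolygon τ]⟩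
  exact mem_symmetries_of_maps (key _ h1) (key _ h2)

/-- An involution that permutes the placements by conjugation and preserves the prototile is a
symmetry. -/
lemma mem_symmetries_of_conj {σ : ℂ ≃ᵢ ℂ} (hσ : ∀ z, σ (σ z) = z)
    (h1 : ∀ g ∈ G, (σ.trans g).trans σ ∈ G) (hP : σ '' region P = region P) :
    σ ∈ symmetries (copies G P) := by
  have hsymm : σ.symm = σ := by
    ext1 z
    rw [IsometryEquiv.symm_apply_eq, hσ]
  have key : ∀ Q ∈ copies G P, ∃ R ∈ copies G P, σ '' region Q = region R := by
    rintro _ ⟨g, hg, rfl⟩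
    refine ⟨_, ⟨_, h1 g hg, rfl⟩, ?_⟩
    rw [movePolygon_trans, movePolygon_trans, region_movePolygon σ, region_movePolygon g,
      region_movePolygon g, region_movePolygon σ, hP]
  exact mem_symmetries_of_maps key (by rwa [hsymm])

lemma union_mem_symmetries {T' : Set (Polygon ℂ n)} (hg : g ∈ symmetries T)
    (hg' : g ∈ symmetries T') : g ∈ symmetries (T ∪ T') := by
  change _ '' _ = _ at hg hg' ⊢
  rw [image_union, image_union, hg, hg']

end Symmetries

/-! ### Bisected fans -/

section Bisected

variable {m : ℕ} {r : ℝ} {p : ℤ → ℂ} {i : Fin 6} {x y : ℂ}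

lemma stdHexagon_isCCW (hm : 5 ≤ m) (hr : 0 < r) : IsCCW (stdHexagon m r) :=
  tile_isCCW hm hr 0 0

lemma stdHexagon_halves (hm : 5 ≤ m) (hr : 0 < r) (hb : IsBisection (stdHexagon m r) i x y) :
    IsCCW (firstHalf (stdHexagon m r) i x y) ∧ IsCCW (secondHalf (stdHexagon m r) i x y) ∧
    region (firstHalf (stdHexagon m r) i x y) =
      region (stdHexagon m r) ∩ {z | 0 ≤ cross (x - y) (z - x)} ∧
    region (secondHalf (stdHexagon m r) i x y) =
      region (stdHexagon m r) ∩ {z | cross (x - y) (z - x) ≤ 0} := by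
  obtain ⟨h1, h2, h3, h4, -⟩ := IsBisection.halves (turning_edgeVec hm hr 0) hb
  exact ⟨h1, h2, h3, h4⟩

lemma stdHexagon_halves_union (hm : 5 ≤ m) (hr : 0 < r)
    (hb : IsBisection (stdHexagon m r) i x y) :
    region (firstHalf (stdHexagon m r) i x y) ∪ region (secondHalf (stdHexagon m r) i x y) =
      region (stdHexagon m r) := by
  obtain ⟨-, -, h3, h4⟩ := stdHexagon_halves hm hr hb
  rw [h3, h4, ← inter_union_distrib_left]
  refine inter_eq_left.2 fun z _ => ?_
  rcases le_total 0 (cross (x - y) (z - x)) with h | h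
  · exact Or.inl h
  · exact Or.inr h

lemma sub_ne_zero_of_isBisection (hm : 5 ≤ m) (hr : 0 < r)
    (hb : IsBisection (stdHexagon m r) i x y) : x - y ≠ 0 :=
  (stdHexagon_halves hm hr hb).1.edge_ne_zero (by norm_num) 4

/-- The interiors of the two halves are the parts of the interior strictly beside the cut. -/
lemma mem_interior_halves (hm : 5 ≤ m) (hr : 0 < r) (hb : IsBisection (stdHexagon m r) i x y)
    {z : ℂ} :
    (z ∈ interior (region (firstHalf (stdHexagon m r) i x y)) ↔
      z ∈ interior (region (stdHexagon m r)) ∧ 0 < cross (x - y) (z - x)) ∧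
    (z ∈ interior (region (secondHalf (stdHexagon m r) i x y)) ↔
      z ∈ interior (region (stdHexagon m r)) ∧ cross (x - y) (z - x) < 0) := by
  obtain ⟨-, -, h3, h4⟩ := stdHexagon_halves hm hr hb
  have hne := sub_ne_zero_of_isBisection hm hr hb
  have hc : Continuous fun z => cross (x - y) (z - x) := (continuous_cross _).comp (by fun_prop)
  rw [h3, h4, interior_inter, interior_inter]
  refine ⟨and_congr_right fun _ => ⟨fun h => ?_, fun h => ?_⟩,
    and_congr_right fun _ => ⟨fun h => ?_, fun h => ?_⟩⟩
  · have := lt_of_mem_interior (u := -(x - y)) (t := -cross (x - y) x) (neg_ne_zero.2 hne)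
      (fun w hw => ?_) h
    · rw [cross_neg_left] at this; rw [cross_sub_right]; linarith
    · have hw' : 0 ≤ cross (x - y) (w - x) := hw
      rw [cross_sub_right] at hw'; rw [cross_neg_left]; linarith
  · exact mem_interior.2 ⟨{z | 0 < cross (x - y) (z - x)},
      fun w (hw : 0 < cross (x - y) (w - x)) => hw.le,
      isOpen_lt continuous_const hc, h⟩
  · have := lt_of_mem_interior (u := x - y) (t := cross (x - y) x) hne (fun w hw => ?_) h
    · rw [cross_sub_right]; linarith
    · have hw' : cross (x - y) (w - x) ≤ 0 := hw
      rw [cross_sub_right] at hw'; linarith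
  · exact mem_interior.2 ⟨{z | cross (x - y) (z - x) < 0},
      fun w (hw : cross (x - y) (w - x) < 0) => hw.le,
      isOpen_lt hc continuous_const, h⟩

/-- Different placements of a fan give tiles with disjoint interiors. -/
lemma IsFan.disjoint_of_ne (hp : IsFan m r p) (hm : 5 ≤ m) (hr : 0 < r) {g g' : ℂ ≃ᵢ ℂ}
    (hg : g ∈ fanPlacements m r p) (hg' : g' ∈ fanPlacements m r p) (hne : g ≠ g') :
    Disjoint (g '' interior (region (stdHexagon m r)))
      (g' '' interior (region (stdHexagon m r))) := by
  obtain ⟨k, j, l, rfl⟩ := hg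
  obtain ⟨k', j', l', rfl⟩ := hg'
  rw [← interior_region_movePolygon, ← interior_region_movePolygon, movePolygon_stdHexagon,
    movePolygon_stdHexagon]
  refine ((hp.eq_or_compat hm hr k k' j l j' l').resolve_left ?_).1
  rintro ⟨⟨q, hq⟩, rfl, rfl⟩
  apply hne
  have hk : k' = k + m * q := by linarith
  have hm0 : m ≠ 0 := by omega
  have h1 : k + m * q + 1 = (k + 1) + m * q := by ring
  have h2 : k + m * q + 2 = (k + 2) + m * q := by ring
  rw [hk, rot_add_mul hm0, corner, corner, hp.period_mul, h1, h2, edgeVec_add_mul hm0,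
    edgeVec_add_mul hm0, edgeVec_add_mul hm0]

lemma mem_bisectedPattern {G : Set (ℂ ≃ᵢ ℂ)} {H : Polygon ℂ 6} {P : Polygon ℂ 5} :
    P ∈ bisectedPattern G H i x y ↔ ∃ g ∈ G, ∃ Q, (Q = firstHalf H i x y ∨ Q = secondHalf H i x y) ∧
      P = movePolygon g Q := by
  constructor
  · rintro (⟨g, hg, rfl⟩ | ⟨g, hg, rfl⟩)
    · exact ⟨g, hg, _, Or.inl rfl, rfl⟩
    · exact ⟨g, hg, _, Or.inr rfl, rfl⟩
  · rintro ⟨g, hg, Q, rfl | rfl, rfl⟩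
    · exact Or.inl ⟨g, hg, rfl⟩
    · exact Or.inr ⟨g, hg, rfl⟩

lemma half_interior_subset (hm : 5 ≤ m) (hr : 0 < r) (hb : IsBisection (stdHexagon m r) i x y)
    {Q : Polygon ℂ 5} (hQ : Q = firstHalf (stdHexagon m r) i x y ∨
      Q = secondHalf (stdHexagon m r) i x y) :
    interior (region Q) ⊆ interior (region (stdHexagon m r)) := by
  refine interior_mono ?_
  rw [← stdHexagon_halves_union hm hr hb]
  rcases hQ with rfl | rfl
  · exact subset_union_left
  · exact subset_union_right

lemma IsFan.tiles_bisected (hp : IsFan m r p) (hm : 5 ≤ m) (hr : 0 < r)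
    (hb : IsBisection (stdHexagon m r) i x y) :
    Tiles (bisectedPattern (fanPlacements m r p) (stdHexagon m r) i x y) (fanUnion m r p) := by
  constructor
  · rw [← biUnion_copies_eq]
    ext z
    simp only [mem_iUnion, exists_prop]
    constructor
    · rintro ⟨P, hP, hz⟩
      obtain ⟨g, hg, Q, hQ, rfl⟩ := mem_bisectedPattern.1 hP
      refine ⟨_, ⟨g, hg, rfl⟩, ?_⟩
      rw [region_movePolygon] at hz ⊢
      rw [← stdHexagon_halves_union hm hr hb, image_union]
      rcases hQ with rfl | rfl
      · exact Or.inl hz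
      · exact Or.inr hz
    · rintro ⟨_, ⟨g, hg, rfl⟩, hz⟩
      rw [region_movePolygon, ← stdHexagon_halves_union hm hr hb, image_union] at hz
      rcases hz with hz | hz
      · exact ⟨_, mem_bisectedPattern.2 ⟨g, hg, _, Or.inl rfl, rfl⟩, by rwa [region_movePolygon]⟩
      · exact ⟨_, mem_bisectedPattern.2 ⟨g, hg, _, Or.inr rfl, rfl⟩, by rwa [region_movePolygon]⟩
  · intro P hP P' hP' hne
    obtain ⟨g, hg, Q, hQ, rfl⟩ := mem_bisectedPattern.1 hP
    obtain ⟨g', hg', Q', hQ', rfl⟩ := mem_bisectedPattern.1 hP'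
    rw [interior_region_movePolygon, interior_region_movePolygon]
    by_cases hgg : g = g'
    · subst hgg
      rw [disjoint_image_iff g.injective, Set.disjoint_left]
      intro z hz hz'
      have hh := mem_interior_halves hm hr hb (z := z)
      rcases hQ with rfl | rfl <;> rcases hQ' with rfl | rfl
      · exact hne rfl
      · linarith [(hh.1.1 hz).2, (hh.2.1 hz').2]
      · linarith [(hh.1.1 hz').2, (hh.2.1 hz).2]
      · exact hne rfl
    · exact (hp.disjoint_of_ne hm hr hg hg' hgg).mono
        (image_mono (half_interior_subset hm hr hb hQ))
        (image_mono (half_interior_subset hm hr hb hQ'))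

lemma openPart_bisected_subset (hm : 5 ≤ m) (hr : 0 < r)
    (hb : IsBisection (stdHexagon m r) i x y) {z : ℂ}
    (hz : z ∈ openPart (bisectedPattern (fanPlacements m r p) (stdHexagon m r) i x y)) :
    z ∈ openPart (copies (fanPlacements m r p) (stdHexagon m r)) := by
  obtain ⟨P, hP, hz⟩ := mem_openPart.1 hz
  obtain ⟨g, hg, Q, hQ, rfl⟩ := mem_bisectedPattern.1 hP
  refine mem_openPart.2 ⟨_, ⟨g, hg, rfl⟩, ?_⟩
  rw [interior_region_movePolygon] at hz ⊢
  exact image_mono (half_interior_subset hm hr hb hQ) hz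

/-- Inside a tile, the points off the interiors of the pentagons are those of the cut. -/
lemma IsFan.mem_openPart_bisected_iff (hp : IsFan m r p) (hm : 5 ≤ m) (hr : 0 < r)
    (hb : IsBisection (stdHexagon m r) i x y) {g : ℂ ≃ᵢ ℂ} (hg : g ∈ fanPlacements m r p) {z : ℂ}
    (hz : z ∈ interior (region (stdHexagon m r))) :
    g z ∈ openPart (bisectedPattern (fanPlacements m r p) (stdHexagon m r) i x y) ↔
      cross (x - y) (z - x) ≠ 0 := by
  have hh := mem_interior_halves hm hr hb (z := z)
  constructor
  · intro h
    obtain ⟨P, hP, hzP⟩ := mem_openPart.1 h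
    obtain ⟨g', hg', Q, hQ, rfl⟩ := mem_bisectedPattern.1 hP
    rw [interior_region_movePolygon] at hzP
    by_cases hgg : g = g'
    · subst hgg
      rw [g.injective.mem_set_image] at hzP
      rcases hQ with rfl | rfl
      · exact (hh.1.1 hzP).2.ne'
      · exact (hh.2.1 hzP).2.ne
    · exact (Set.disjoint_left.1 (hp.disjoint_of_ne hm hr hg hg' hgg) ⟨z, hz, rfl⟩
        (image_mono (half_interior_subset hm hr hb hQ) hzP)).elim
  · intro h
    rcases h.lt_or_gt with h | h
    · refine mem_openPart.2 ⟨_, mem_bisectedPattern.2 ⟨g, hg, _, Or.inr rfl, rfl⟩, ?_⟩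
      rw [interior_region_movePolygon]
      exact ⟨z, hh.2.2 ⟨hz, h⟩, rfl⟩
    · refine mem_openPart.2 ⟨_, mem_bisectedPattern.2 ⟨g, hg, _, Or.inl rfl, rfl⟩, ?_⟩
      rw [interior_region_movePolygon]
      exact ⟨z, hh.1.2 ⟨hz, h⟩, rfl⟩

/-- The cut does not pass through a vertex of the hexagon. -/
lemma cross_vertex_ne_zero (hm : 5 ≤ m) (hr : 0 < r) (hb : IsBisection (stdHexagon m r) i x y)
    (j : Fin 6) : cross (x - y) (stdHexagon m r j - x) ≠ 0 := by
  obtain ⟨h1, h2, -, -⟩ := stdHexagon_halves hm hr hb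
  set H := stdHexagon m r
  have e : ∀ z, cross (x - y) (z - y) = cross (x - y) (z - x) := by
    intro z
    have : z - y = (z - x) + (x - y) := by ring
    rw [this, cross_add_right, cross_self, add_zero]
  have e' : ∀ z, cross (y - x) (z - x) = -cross (x - y) (z - x) := by
    intro z; rw [← neg_sub, cross_neg_left]
  have a1 : 0 < cross (x - y) (H (i + 1) - y) := h1 4 1 (by decide) (by decide)
  have a2 : 0 < cross (x - y) (H (i + 2) - y) := h1 4 2 (by decide) (by decide)
  have a3 : 0 < cross (x - y) (H (i + 3) - y) := h1 4 3 (by decide) (by decide)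
  have a4 : 0 < cross (y - x) (H (i + 4) - x) := h2 4 1 (by decide) (by decide)
  have a5 : 0 < cross (y - x) (H (i + 5) - x) := h2 4 2 (by decide) (by decide)
  have a0 : 0 < cross (y - x) (H i - x) := h2 4 3 (by decide) (by decide)
  rw [e] at a1 a2 a3
  rw [e'] at a4 a5 a0
  obtain ⟨d, rfl⟩ : ∃ d, j = i + d := ⟨j - i, by abel⟩
  fin_cases d
  · have : i + ⟨0, by norm_num⟩ = i := add_zero i
    simp only [this]; linarith
  · exact a1.ne'
  · exact a2.ne'
  · exact a3.ne'
  · exact (by linarith : cross (x - y) (H (i + 4) - x) < 0).ne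
  · exact (by linarith : cross (x - y) (H (i + 5) - x) < 0).ne

/-- Near the vertices of the hexagons, bisection changes nothing. -/
lemma IsFan.eventually_mem_openPart (hp : IsFan m r p) (hm : 5 ≤ m) (hr : 0 < r)
    (hb : IsBisection (stdHexagon m r) i x y) (k : ℤ) (j l : ℕ) (q : Fin 6) :
    ∀ᶠ z in 𝓝 (fanTile m r p k j l q), z ∈ interior (region (fanTile m r p k j l)) →
      z ∈ openPart (bisectedPattern (fanPlacements m r p) (stdHexagon m r) i x y) := by
  set g := directIso (rot m k) (corner m r p k j l) with hg
  have hgG : g ∈ fanPlacements m r p := ⟨k, j, l, rfl⟩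
  have ht : fanTile m r p k j l = movePolygon g (stdHexagon m r) :=
    (movePolygon_stdHexagon _ _).symm
  have hc : Continuous fun z => cross (x - y) (g.symm z - x) :=
    (continuous_cross _).comp (g.symm.continuous.sub continuous_const)
  have h0 : cross (x - y) (g.symm (fanTile m r p k j l q) - x) ≠ 0 := by
    rw [ht]
    change cross (x - y) (g.symm (g (stdHexagon m r q)) - x) ≠ 0
    rw [g.symm_apply_apply]
    exact cross_vertex_ne_zero hm hr hb q
  filter_upwards [hc.continuousAt.eventually_ne h0] with z hz hzi
  rw [ht, interior_region_movePolygon] at hzi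
  obtain ⟨w, hw, rfl⟩ := hzi
  rw [hp.mem_openPart_bisected_iff hm hr hb hgG hw]
  rwa [g.symm_apply_apply] at hz

/-- If a cut ends inside an edge that the neighbouring tile does not cut, the pentagons are not
edge-to-edge: the end of the cut is a vertex on one side only. -/
lemma IsFan.not_edgeToEdge_of_pair (hp : IsFan m r p) (hm : 5 ≤ m) (hr : 0 < r)
    (hb : IsBisection (stdHexagon m r) i x y) {g g' : ℂ ≃ᵢ ℂ} (hg : g ∈ fanPlacements m r p)
    (hg' : g' ∈ fanPlacements m r p) (hne : g ≠ g') {e' : Fin 6} (he : e' ≠ i) (he' : e' ≠ i + 3)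
    {z z' : ℂ} (hz : z = x ∨ z = y)
    (hz' : z' ∈ openSegment ℝ (stdHexagon m r e') (stdHexagon m r (e' + 1)))
    (hzz : g z = g' z') :
    ¬ EdgeToEdge (bisectedPattern (fanPlacements m r p) (stdHexagon m r) i x y) := by
  intro hE
  have hccw := stdHexagon_isCCW hm hr
  set H := stdHexagon m r with hH
  have hrot : ∀ q : Fin 6, finRotate 6 q = q + 1 := fun q => finRotate_apply q
  have hi4 : i + 4 = i + 3 + 1 := by rw [add_assoc]; rfl
  rw [← hrot] at hz'
  -- the end of the cut is not a vertex of the pentagons of the other tile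
  have hvert : ∀ Q, (Q = firstHalf H i x y ∨ Q = secondHalf H i x y) → ∀ q, Q q ≠ z' := by
    intro Q hQ q hq
    have hQv : Q q = x ∨ Q q = y ∨ ∃ s, Q q = H s := by
      rcases hQ with rfl | rfl <;> fin_cases q
      · exact Or.inl rfl
      · exact Or.inr (Or.inr ⟨i + 1, rfl⟩)
      · exact Or.inr (Or.inr ⟨i + 2, rfl⟩)
      · exact Or.inr (Or.inr ⟨i + 3, rfl⟩)
      · exact Or.inr (Or.inl rfl)
      · exact Or.inr (Or.inl rfl)
      · exact Or.inr (Or.inr ⟨i + 4, rfl⟩)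
      · exact Or.inr (Or.inr ⟨i + 5, rfl⟩)
      · exact Or.inr (Or.inr ⟨i, rfl⟩)
      · exact Or.inl rfl
    have h0 := edgeFn_of_mem_openSegment hz'
    rw [← hq] at h0 hz'
    rcases hQv with h | h | ⟨s, h⟩
    · have hx := hb.1
      rw [← hrot] at hx
      have := hccw.edgeFn_pos_of_mem_openSegment (by norm_num) he hx
      rw [h] at h0; linarith
    · have hy := hb.2.1
      rw [hi4, ← hrot] at hy
      have := hccw.edgeFn_pos_of_mem_openSegment (by norm_num) he' hy
      rw [h] at h0; linarith
    · rw [h] at hz'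
      have := hccw.vertex_not_mem_openSegment (by norm_num) s (vertex_mem_region H _)
        (vertex_mem_region H _) hz'
      exact hccw.edge_ne_zero (by norm_num) e' (by rw [this, sub_self])
  -- a pentagon of the other tile that contains the end of the cut
  have hz'H : z' ∈ region H :=
    segment_subset_region H _ _ (openSegment_subset_segment ℝ _ _ hz')
  obtain ⟨Q, hQ, hz'Q⟩ : ∃ Q, (Q = firstHalf H i x y ∨ Q = secondHalf H i x y) ∧
      z' ∈ region Q := by
    rw [← stdHexagon_halves_union hm hr hb] at hz'H
    rcases hz'H with h | h
    · exact ⟨_, Or.inl rfl, h⟩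
    · exact ⟨_, Or.inr rfl, h⟩
  set F := firstHalf H i x y with hF
  have hFccw : IsCCW F := (stdHexagon_halves hm hr hb).1
  obtain ⟨q, hq⟩ : ∃ q, F q = z := by
    rcases hz with rfl | rfl
    · exact ⟨0, rfl⟩
    · exact ⟨4, rfl⟩
  have hzF : z ∈ region F := hq ▸ vertex_mem_region F q
  have hQne : region (movePolygon g F) ≠ region (movePolygon g' Q) := by
    intro h
    have h1 : interior (region (movePolygon g F)) = interior (region (movePolygon g' Q)) := by
      rw [h]
    rw [interior_region_movePolygon, interior_region_movePolygon] at h1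
    obtain ⟨w, hw⟩ := hFccw.interior_nonempty (by norm_num)
    have hw' : g w ∈ g' '' interior (region Q) := h1 ▸ ⟨w, hw, rfl⟩
    exact Set.disjoint_left.1 (hp.disjoint_of_ne hm hr hg hg' hne)
      ⟨w, half_interior_subset hm hr hb (Or.inl rfl) hw, rfl⟩
      (image_mono (half_interior_subset hm hr hb hQ) hw')
  have hmem : g z ∈ region (movePolygon g F) ∩ region (movePolygon g' Q) := by
    rw [region_movePolygon, region_movePolygon]
    exact ⟨⟨z, hzF, rfl⟩, ⟨z', hz'Q, hzz.symm⟩⟩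
  have hfin : ∀ s, movePolygon g' Q s ≠ g z := by
    intro s hs
    exact hvert Q hQ s (g'.injective (hs.trans hzz))
  rcases hE _ (mem_bisectedPattern.2 ⟨g, hg, F, Or.inl rfl, rfl⟩) _
    (mem_bisectedPattern.2 ⟨g', hg', Q, hQ, rfl⟩) hQne with h | ⟨s, t, hst, h⟩ | ⟨s, t, hst, h⟩
  · rw [h] at hmem; exact hmem
  · rw [h, hst] at hmem
    exact hfin t hmem.symm
  · have hsub : (movePolygon g' Q).edgeSet ℝ t ⊆ region (movePolygon g F) := by
      rw [← hst, ← h]; exact inter_subset_left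
    rw [h, hst] at hmem
    rw [Polygon.edgeSet, affineSegment_eq_segment] at hmem hsub
    rw [← insert_endpoints_openSegment] at hmem
    have hl := hsub (left_mem_segment ℝ _ _)
    have hr' := hsub (right_mem_segment ℝ _ _)
    rcases hmem with hm' | hm' | hm'
    · exact hfin _ hm'.symm
    · exact hfin _ hm'.symm
    · -- the end of the cut is an extreme point of the first pentagon
      rw [region_movePolygon] at hl hr'
      obtain ⟨w1, hw1, e1⟩ := hl
      obtain ⟨w2, hw2, e2⟩ := hr'
      rw [← e1, ← e2, mem_openSegment_image, ← hq] at hm'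
      have := hFccw.vertex_not_mem_openSegment (by norm_num) q hw1 hw2 hm'
      rw [← this, openSegment_same] at hm'
      exact hfin t (by rw [← e1, ← hq]; exact congrArg g hm'.symm)

/-- The bisected tiles of a fan are never edge-to-edge: along the boundary between two sectors, every
kind of cut meets an edge that is not cut from the other side. -/
theorem IsFan.not_edgeToEdge (hp : IsFan m r p) (hm : 5 ≤ m) (hr : 0 < r)
    (hb : IsBisection (stdHexagon m r) i x y) :
    ¬ EdgeToEdge (bisectedPattern (fanPlacements m r p) (stdHexagon m r) i x y) := by
  have hccw := stdHexagon_isCCW hm hr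
  have hplace : ∀ (k : ℤ) (j l : ℕ) (q : Fin 6),
      directIso (rot m k) (corner m r p k j l) (stdHexagon m r q) = fanTile m r p k j l q := by
    intro k j l q
    rw [fanTile, ← movePolygon_stdHexagon]; rfl
  have hadj := hp.adj (-1)
  have i1 : (-1 : ℤ) + 1 = 0 := by norm_num
  have i2 : (-1 : ℤ) + 2 = 1 := by norm_num
  rw [i1, i2] at hadj
  set H := stdHexagon m r
  -- a pair of tiles in which a `0`-edge meets a `4`-edge
  have pair1 : ∃ g ∈ fanPlacements m r p, ∃ g' ∈ fanPlacements m r p, g ≠ g' ∧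
      g (H 0) = g' (H 5) ∧ g (H 1) = g' (H 4) := by
    have : ∃ l' : ℕ, fanTile m r p 0 1 0 0 = fanTile m r p (-1) 0 l' 5 ∧
        fanTile m r p 0 1 0 1 = fanTile m r p (-1) 0 l' 4 := by
      rcases hadj with h | h
      · refine ⟨1, ?_, ?_⟩ <;> simp [fanTile, tile, zonogon, corner, h, i1, i2] <;> ring
      · refine ⟨0, ?_, ?_⟩ <;> simp [fanTile, tile, zonogon, corner, h, i1, i2] <;> ring
    obtain ⟨l', h0, h1⟩ := this
    rw [← hplace, ← hplace] at h0 h1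
    refine ⟨_, ⟨0, 1, 0, rfl⟩, _, ⟨-1, 0, l', rfl⟩, fun e => ?_, h0, h1⟩
    rw [e] at h0
    exact hccw.edge_ne_zero (by norm_num) 5 (sub_eq_zero.2 (IsometryEquiv.injective _ h0))
  -- a pair of tiles in which a `1`-edge meets a `5`-edge
  have pair2 : ∃ g ∈ fanPlacements m r p, ∃ g' ∈ fanPlacements m r p, g ≠ g' ∧
      g (H 1) = g' (H 0) ∧ g (H 2) = g' (H 5) := by
    have : ∃ l' : ℕ, fanTile m r p 0 1 0 1 = fanTile m r p (-1) 0 l' 0 ∧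
        fanTile m r p 0 1 0 2 = fanTile m r p (-1) 0 l' 5 := by
      rcases hadj with h | h
      · refine ⟨2, ?_, ?_⟩ <;> simp [fanTile, tile, zonogon, corner, h, i1, i2] <;> ring
      · refine ⟨1, ?_, ?_⟩ <;> simp [fanTile, tile, zonogon, corner, h, i1, i2] <;> ring
    obtain ⟨l', h0, h1⟩ := this
    rw [← hplace, ← hplace] at h0 h1
    refine ⟨_, ⟨0, 1, 0, rfl⟩, _, ⟨-1, 0, l', rfl⟩, fun e => ?_, h0, h1⟩
    rw [e] at h0
    exact hccw.edge_ne_zero (by norm_num) 0 (sub_eq_zero.2 (IsometryEquiv.injective _ h0))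
  obtain ⟨g, hg, g', hg', hne, h0, h1⟩ := pair1
  obtain ⟨f, hf, f', hf', hne', h0', h1'⟩ := pair2
  have conv : ∀ (s t : ℂ ≃ᵢ ℂ) (z a b a' b' : ℂ), s a = t b' → s b = t a' →
      z ∈ openSegment ℝ a b → t.symm (s z) ∈ openSegment ℝ a' b' := by
    intro s t z a b a' b' e1 e2 hz
    rw [← mem_openSegment_image (g := t), t.apply_symm_apply, ← e1, ← e2, openSegment_symm,
      mem_openSegment_image]
    exact hz
  have main : ∀ (s t : ℂ ≃ᵢ ℂ), s ∈ fanPlacements m r p → t ∈ fanPlacements m r p → s ≠ t →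
      ∀ (z a b : ℂ) (e : Fin 6), e ≠ i → e ≠ i + 3 → (z = x ∨ z = y) → s a = t (H (e + 1)) →
      s b = t (H e) → z ∈ openSegment ℝ a b →
      ¬ EdgeToEdge (bisectedPattern (fanPlacements m r p) H i x y) := by
    intro s t hs ht hst z a b e he he' hz e1 e2 hzz
    exact hp.not_edgeToEdge_of_pair hm hr hb hs ht hst he he' hz (conv s t z a b _ _ e1 e2 hzz)
      (t.apply_symm_apply _).symm
  have hx := hb.1
  have hy := hb.2.1
  fin_cases i
  · exact main g g' hg hg' hne x _ _ 4 (by decide) (by decide) (Or.inl rfl) h0 h1 hx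
  · exact main g' g hg' hg hne.symm y _ _ 0 (by decide) (by decide) (Or.inr rfl) h1.symm h0.symm hy
  · exact main f' f hf' hf hne'.symm y _ _ 1 (by decide) (by decide) (Or.inr rfl) h1'.symm
      h0'.symm hy
  · exact main g g' hg hg' hne y _ _ 4 (by decide) (by decide) (Or.inr rfl) h0 h1 hy
  · exact main g' g hg' hg hne.symm x _ _ 0 (by decide) (by decide) (Or.inl rfl) h1.symm h0.symm hx
  · exact main f' f hf' hf hne'.symm x _ _ 1 (by decide) (by decide) (Or.inl rfl) h1'.symm
      h0'.symm hx

end Bisected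

/-! ### Rotations and reflections of a fan -/

lemma exists_nat_rot {m : ℕ} (hm : m ≠ 0) (k : ℤ) : ∃ q : ℕ, rot m k = rot m q := by
  have h1 := Int.emod_nonneg k (by omega : (m : ℤ) ≠ 0)
  obtain ⟨q, hq⟩ := Int.eq_ofNat_of_zero_le h1
  refine ⟨q, ?_⟩
  have hk : k = q + m * (k / m) := by rw [← hq, Int.emod_add_mul_ediv]
  rw [hk, rot_add_mul hm]

lemma mem_cyclicSymmetries {m : ℕ} (hm : m ≠ 0) {g : ℂ ≃ᵢ ℂ} :
    g ∈ cyclicSymmetries m 0 ↔ ∃ k : ℤ, g = directIso (rot m k) 0 := by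
  constructor
  · rintro ⟨k, hk⟩
    refine ⟨k, ?_⟩
    ext1 z
    rw [hk, directIso_apply, coe_rot]; simp
  · rintro ⟨k, rfl⟩
    obtain ⟨q, hq⟩ := exists_nat_rot hm k
    refine ⟨q, fun z => ?_⟩
    rw [hq, directIso_apply, coe_rot]; simp

lemma mem_dihedralSymmetries {m : ℕ} (hm : m ≠ 0) (u : Circle) {g : ℂ ≃ᵢ ℂ} :
    g ∈ dihedralSymmetries m 0 u ↔
      (∃ k : ℤ, g = directIso (rot m k) 0) ∨ ∃ k : ℤ, g = oppositeIso (u * rot m k) 0 := by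
  rw [dihedralSymmetries, mem_union, mem_cyclicSymmetries hm]
  refine or_congr Iff.rfl ⟨?_, ?_⟩
  · rintro ⟨k, hk⟩
    refine ⟨k, ?_⟩
    ext1 z
    rw [hk, oppositeIso_apply, Circle.coe_mul, coe_rot]; simp
  · rintro ⟨k, rfl⟩
    obtain ⟨q, hq⟩ := exists_nat_rot hm k
    refine ⟨q, fun z => ?_⟩
    rw [hq, oppositeIso_apply, Circle.coe_mul, coe_rot]; simp

section FanSymmetries

variable {m : ℕ} {r : ℝ} {p : ℤ → ℂ} {i : Fin 6} {x y : ℂ}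

lemma directIso_trans (u u' : Circle) (v : ℂ) :
    (directIso u v).trans (directIso u' 0) = directIso (u' * u) (u' * v) := by
  ext1 z; simp; ring

lemma directIso_symm (u : Circle) : (directIso u 0).symm = directIso u⁻¹ 0 := by
  ext1 z
  rw [IsometryEquiv.symm_apply_eq]
  simp

lemma corner_add {d : ℤ} (hd : ∀ k, p (k + d) = rot m d * p k) (k : ℤ) (j l : ℕ) :
    corner m r p (k + d) j l = rot m d * corner m r p k j l := by
  have h : ∀ k, edgeVec m r (k + d) = rot m d * edgeVec m r k := by
    intro k; rw [rot_mul_edgeVec, add_comm]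
  have h1 : k + d + 1 = (k + 1) + d := by ring
  have h2 : k + d + 2 = (k + 2) + d := by ring
  simp only [corner, hd, h, h1, h2, Complex.real_smul]
  ring

/-- A rotation that permutes the corners is a symmetry of every pattern made from the placements. -/
lemma directIso_mem_symmetries {n : ℕ} {d : ℤ} (hd : ∀ k, p (k + d) = rot m d * p k)
    (P : Polygon ℂ n) : directIso (rot m d) 0 ∈ symmetries (copies (fanPlacements m r p) P) := by
  have hd' : ∀ k, p (k + -d) = rot m (-d) * p k := by
    intro k
    have := hd (k + -d)
    rw [neg_add_cancel_right] at this
    rw [this, ← mul_assoc, ← Circle.coe_mul, ← rot_add, neg_add_cancel, rot_zero]; simp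
  have key : ∀ d : ℤ, (∀ k, p (k + d) = rot m d * p k) → ∀ g ∈ fanPlacements m r p,
      g.trans (directIso (rot m d) 0) ∈ fanPlacements m r p := by
    rintro d hd _ ⟨k, j, l, rfl⟩
    exact ⟨k + d, j, l, by rw [directIso_trans, corner_add hd, add_comm, rot_add]⟩
  refine mem_symmetries_of_comp (key d hd) ?_
  rw [directIso_symm, ← rot_neg]
  exact key _ hd'

lemma directIso_mem_symmetries_bisected {H : Polygon ℂ 6} {d : ℤ}
    (hd : ∀ k, p (k + d) = rot m d * p k) :
    directIso (rot m d) 0 ∈ symmetries (bisectedPattern (fanPlacements m r p) H i x y) :=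
  union_mem_symmetries (directIso_mem_symmetries hd _) (directIso_mem_symmetries hd _)

lemma center_mem_interior (hm : 5 ≤ m) (hr : 0 < r) :
    hexagonCenter (stdHexagon m r) ∈ interior (region (stdHexagon m r)) := by
  have hccw := stdHexagon_isCCW (m := m) hm hr
  obtain ⟨h1, h2, h3⟩ := turning_edgeVec (m := m) (r := r) hm hr 0
  rw [stdHexagon, tile, hexagonCenter_zonogon]
  refine (hccw.mem_interior_iff (by norm_num)).2 fun i => ?_
  rw [cross_eq] at h1 h2 h3
  fin_cases i <;> simp [edgeFn, stdHexagon, tile, zonogon, cross_eq] <;> simp at h1 h2 h3 <;>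
    linarith

lemma cross_center_eq_zero (hb : IsBisection (stdHexagon m r) i x y) :
    cross (x - y) (hexagonCenter (stdHexagon m r) - x) = 0 := by
  obtain ⟨s, t, hs, ht, hst, h⟩ := hb.2.2
  obtain rfl : s = 1 - t := by linarith
  rw [← h]
  simp [cross_eq]; ring

/-- An opposite symmetry of a bisected fan that carries one tile to another carries the cut of the
one to the cut of the other; this restricts the direction of the cut. -/
lemma IsFan.cross_direction_eq_zero (hp : IsFan m r p) (hm : 5 ≤ m) (hr : 0 < r)
    (hb : IsBisection (stdHexagon m r) i x y) {σ g g' : ℂ ≃ᵢ ℂ}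
    (hσ : σ ∈ symmetries (bisectedPattern (fanPlacements m r p) (stdHexagon m r) i x y))
    (hg : g ∈ fanPlacements m r p) (hg' : g' ∈ fanPlacements m r p) {s : ℂ}
    (h : ∀ z, σ (g (hexagonCenter (stdHexagon m r) + z)) =
      g' (hexagonCenter (stdHexagon m r) + s * conj z)) :
    cross (x - y) (s * conj (x - y)) = 0 := by
  set o := hexagonCenter (stdHexagon m r)
  have ho := center_mem_interior hm hr
  have hev : ∀ d : ℂ, ∀ᶠ t : ℝ in 𝓝[>] 0, o + t • d ∈ interior (region (stdHexagon m r)) := by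
    intro d
    have hc : ContinuousAt (fun t : ℝ => o + t • d) 0 := by fun_prop
    refine (hc.eventually ?_).filter_mono nhdsWithin_le_nhds
    simpa using isOpen_interior.mem_nhds ho
  obtain ⟨t, ⟨h1, h2⟩, ht⟩ :=
    (((hev (x - y)).and (hev (s * conj (x - y)))).and self_mem_nhdsWithin).exists
  have ht' : (0 : ℝ) < t := ht
  have h0 := cross_center_eq_zero hb
  have e1 : g (o + t • (x - y)) ∉
      openPart (bisectedPattern (fanPlacements m r p) (stdHexagon m r) i x y) := by
    rw [hp.mem_openPart_bisected_iff hm hr hb hg h1, not_not,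
      show o + t • (x - y) - x = (o - x) + t • (x - y) by ring, cross_add_right,
      cross_smul_right, cross_self, h0]
    ring
  rw [← apply_mem_openPart_iff hσ, h,
    show s * conj (t • (x - y)) = t • (s * conj (x - y)) by simp; ring,
    hp.mem_openPart_bisected_iff hm hr hb hg' h2, not_not,
    show o + t • (s * conj (x - y)) - x = (o - x) + t • (s * conj (x - y)) by ring,
    cross_add_right, cross_smul_right, h0, zero_add] at e1
  exact (mul_eq_zero.1 e1).resolve_left ht'.ne'

lemma image_of_tiles {n : ℕ} {T : Set (Polygon ℂ n)} {S : Set ℂ} {g : ℂ ≃ᵢ ℂ} (hT : Tiles T S)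
    (hg : g ∈ symmetries T) : g '' S = S := by
  have key : ∀ g ∈ symmetries T, g '' S ⊆ S := by
    rintro g hg _ ⟨z, hz, rfl⟩
    rw [← hT.1] at hz ⊢
    simp only [mem_iUnion, exists_prop] at hz ⊢
    obtain ⟨P, hP, hz⟩ := hz
    obtain ⟨Q, hQ, e⟩ := (mem_symmetries_iff.1 hg).1 P hP
    exact ⟨Q, hQ, e ▸ ⟨z, hz, rfl⟩⟩
  refine Subset.antisymm (key g hg) fun z hz => ?_
  have := key _ (symm_mem_symmetries hg) ⟨z, hz, rfl⟩
  exact ⟨_, this, g.apply_symm_apply z⟩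

end FanSymmetries

/-! ### The fan around a regular polygon -/

section Hole

variable {m : ℕ} {r : ℝ} {i : Fin 6} {x y : ℂ}

/-- The first vertex of the regular `m`-gon with centre `0` and edge vectors `edgeVec m r k`. -/
def holeVertex (m : ℕ) (r : ℝ) : ℂ := edgeVec m r 2 / (rot m 1 - 1)

/-- The vertices of the hole, which are the corners of the sectors around it. -/
def holeCorner (m : ℕ) (r : ℝ) (k : ℤ) : ℂ := holeVertex m r * rot m k

lemma rot_one_sub_one_ne_zero (hm : 5 ≤ m) : (rot m 1 : ℂ) - 1 ≠ 0 := by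
  intro h
  have h1 := congrArg Complex.im h
  rw [Complex.sub_im, rot_im] at h1
  have h2 := sin_mul_pos (m := m) (d := 1) (by norm_num) (by omega)
  simp at h1 h2
  linarith

lemma holeVertex_ne_zero (hm : 5 ≤ m) (hr : 0 < r) : holeVertex m r ≠ 0 :=
  div_ne_zero (edgeVec_ne_zero hr 2) (rot_one_sub_one_ne_zero hm)

lemma holeCorner_succ (hm : 5 ≤ m) (k : ℤ) :
    holeCorner m r (k + 1) = holeCorner m r k + edgeVec m r (k + 2) := by
  have h := rot_one_sub_one_ne_zero hm
  rw [holeCorner, holeCorner, rot_add, Circle.coe_mul, ← rot_mul_edgeVec, holeVertex]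
  field_simp
  ring

lemma holeCorner_add (d k : ℤ) : holeCorner m r (k + d) = rot m d * holeCorner m r k := by
  rw [holeCorner, holeCorner, rot_add, Circle.coe_mul]; ring

lemma holeCorner_cross_pos (hm : 5 ≤ m) (hr : 0 < r) (k : ℤ) {d : ℤ} (hd : 2 ≤ d) (hdm : d < m) :
    0 < cross (edgeVec m r (k + 2)) (holeCorner m r (k + d) - holeCorner m r k) := by
  have e : edgeVec m r (k + 2) = holeCorner m r k * (rot m 1 - 1) := by
    have := holeCorner_succ (r := r) hm k
    rw [holeCorner_add] at this
    linear_combination -this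
  have e' : holeCorner m r (k + d) - holeCorner m r k = holeCorner m r k * (rot m d - 1) := by
    rw [holeCorner_add]; ring
  rw [e, e', cross_mul_mul]
  have hw : holeCorner m r k ≠ 0 := mul_ne_zero (holeVertex_ne_zero hm hr) (Circle.coe_ne_zero _)
  refine mul_pos (by positivity) ?_
  -- twice the area of a triangle inscribed in the unit circle
  have hx : ∀ q : ℤ, 0 < q → q < m → 0 < Real.sin (q * (Real.pi / m)) := by
    intro q h1 h2
    have := sin_mul_pos (m := 2 * m) (d := q) h1 (by push_cast; omega)
    rw [show (q : ℝ) * (2 * Real.pi / (2 * m : ℕ)) = q * (Real.pi / m) by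
      push_cast; rw [mul_div_mul_left _ _ (two_ne_zero)]] at this
    exact this
  have s1 := hx 1 (by norm_num) (by omega)
  have s2 := hx (d - 1) (by omega) (by omega)
  have s3 := hx d (by omega) hdm
  have : cross ((rot m 1 : ℂ) - 1) (rot m d - 1) =
      4 * (Real.sin ((1 : ℤ) * (Real.pi / m)) * Real.sin ((d - 1 : ℤ) * (Real.pi / m)) *
        Real.sin (d * (Real.pi / m))) := by
    rw [cross_eq]
    simp only [Complex.sub_re, Complex.sub_im, Complex.one_re, Complex.one_im, rot_re, rot_im]
    set a : ℝ := Real.pi / m with ha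
    have e1 : ((1 : ℤ) : ℝ) * (2 * Real.pi / m) = 2 * a := by rw [ha]; push_cast; ring
    have e2 : (d : ℝ) * (2 * Real.pi / m) = 2 * (((d - 1 : ℤ) : ℝ) * a + a) := by
      rw [ha]; push_cast; ring
    have e3 : (d : ℝ) * a = ((d - 1 : ℤ) : ℝ) * a + a := by push_cast; ring
    have e4 : ((1 : ℤ) : ℝ) * a = a := by push_cast; ring
    rw [e1, e2, e3, e4, Real.sin_two_mul, Real.cos_two_mul, Real.sin_two_mul, Real.cos_two_mul]
    set b : ℝ := ((d - 1 : ℤ) : ℝ) * a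
    rw [Real.sin_add, Real.cos_add]
    have ca := Real.sin_sq_add_cos_sq a
    have cb := Real.sin_sq_add_cos_sq b
    have ca' : Real.cos a ^ 2 = 1 - Real.sin a ^ 2 := by linarith
    have cb' : Real.cos b ^ 2 = 1 - Real.sin b ^ 2 := by linarith
    ring_nf
    simp only [ca', cb', show Real.cos a ^ 3 = Real.cos a * (1 - Real.sin a ^ 2) by rw [← ca']; ring,
      show Real.cos a ^ 4 = (1 - Real.sin a ^ 2) ^ 2 by rw [← ca']; ring]
    ring_nf
  rw [this]
  positivity

lemma isFan_holeCorner (hm : 5 ≤ m) (hr : 0 < r) : IsFan m r (holeCorner m r) where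
  period k := by rw [holeCorner, holeCorner, rot_add, rot_self (by omega), mul_one]
  adj k := Or.inl (holeCorner_succ hm k)
  far k d hd hdm := Or.inl (holeCorner_cross_pos hm hr k hd (by omega))

/-- The hole of the pattern. -/
def holePolygon (m : ℕ) (r : ℝ) : Polygon ℂ m := regularPolygon m 0 (holeVertex m r)

lemma holePolygon_apply (k : Fin m) : holePolygon m r k = holeCorner m r (k : ℕ) := by
  rw [holeCorner, coe_rot]
  simp [holePolygon, regularPolygon]

lemma holePolygon_finRotate (hm : 5 ≤ m) (k : Fin m) :
    holePolygon m r (finRotate m k) = holeCorner m r (k : ℕ) + edgeVec m r ((k : ℕ) + 2) := by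
  have hm0 : m ≠ 0 := by omega
  rw [holePolygon_apply, ← holeCorner_succ hm]
  obtain ⟨n, rfl⟩ := Nat.exists_eq_succ_of_ne_zero hm0
  rw [finRotate_apply, Fin.val_add_eq_ite, holeCorner, holeCorner]
  have : ((1 : Fin (n + 1)) : ℕ) = 1 := by
    rw [Fin.val_one']; exact Nat.mod_eq_of_lt (by omega)
  rw [this]
  split_ifs with h
  · congr 2
    rw [← rot_add_mul hm0 _ 1]; congr 1
    have hk := k.2
    omega
  · push_cast; rfl

lemma holePolygon_isCCW (hm : 5 ≤ m) (hr : 0 < r) : IsCCW (holePolygon m r) := by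
  intro a b hab hab'
  have hfan := isFan_holeCorner (m := m) (r := r) hm hr
  have key : ∀ d : ℤ, 2 ≤ d → d < m →
      holeCorner m r (b : ℕ) = holeCorner m r ((a : ℕ) + d) →
      0 < cross (holePolygon m r (finRotate m a) - holePolygon m r a)
        (holePolygon m r b - holePolygon m r a) := by
    intro d hd hdm e
    rw [holePolygon_finRotate hm, holePolygon_apply, holePolygon_apply, add_sub_cancel_left, e]
    exact holeCorner_cross_pos hm hr _ hd hdm
  have ha := a.2
  have hb := b.2
  have hne : (b : ℕ) ≠ a := fun h => hab (Fin.ext h)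
  have hne' : (b : ℕ) ≠ (finRotate m a : Fin m) := fun h => hab' (Fin.ext h)
  obtain ⟨n, rfl⟩ := Nat.exists_eq_succ_of_ne_zero (show m ≠ 0 by omega)
  rw [finRotate_apply, Fin.val_add_eq_ite, Fin.val_one', Nat.mod_eq_of_lt (by omega : 1 < n + 1)]
    at hne'
  rcases lt_or_gt_of_ne hne with hlt | hlt
  · refine key ((b : ℕ) - (a : ℕ) + (n + 1 : ℕ)) (by split_ifs at hne' <;> omega) (by omega) ?_
    rw [← hfan.period]; congr 1; push_cast; ring
  · refine key ((b : ℕ) - (a : ℕ)) (by split_ifs at hne' <;> omega) (by omega) ?_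
    congr 1; ring

lemma hasEdge_holePolygon (hm : 5 ≤ m) (hr : 0 < r) (k : ℤ) :
    HasEdge (holePolygon m r) (holeCorner m r k) (edgeVec m r (k + 2)) := by
  have hm0 : m ≠ 0 := by omega
  have h1 := Int.emod_nonneg k (by omega : (m : ℤ) ≠ 0)
  have h2 := Int.emod_lt_of_pos k (by omega : (0 : ℤ) < m)
  obtain ⟨q, hq⟩ := Int.eq_ofNat_of_zero_le h1
  have hk : k = q + m * (k / m) := by rw [← hq, Int.emod_add_mul_ediv]
  have hqm : q < m := by omega
  have e1 : holeCorner m r k = holeCorner m r q := by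
    rw [hk, (isFan_holeCorner hm hr).period_mul]
  have e2 : edgeVec m r (k + 2) = edgeVec m r (q + 2) := by
    rw [hk, show (q : ℤ) + m * (k / m) + 2 = q + 2 + m * (k / m) by ring, edgeVec_add_mul hm0]
  rw [e1, e2]
  exact ⟨⟨q, hqm⟩, by rw [holePolygon_apply], by rw [holePolygon_finRotate hm]⟩

lemma fanUnion_union_hole (hm : 5 ≤ m) (hr : 0 < r) :
    fanUnion m r (holeCorner m r) ∪ region (holePolygon m r) = univ := by
  have hfan := isFan_holeCorner (m := m) (r := r) hm hr
  have hccw := holePolygon_isCCW (m := m) (r := r) hm hr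
  have hedge : ∀ k, ∀ z ∈ openSegment ℝ (holeCorner m r k)
      (holeCorner m r k + edgeVec m r (k + 2)),
      fanUnion m r (holeCorner m r) ∪ region (holePolygon m r) ∈ 𝓝 z := by
    intro k z hz
    have hE : HasEdge (fanTile m r (holeCorner m r) k 0 0)
        (holeCorner m r k + edgeVec m r (k + 2)) (-edgeVec m r (k + 2)) :=
      hasEdge_five (by simp [corner]) rfl
    refine mem_of_superset (union_mem_nhds_of_hasEdge hccw
      (tile_isCCW hm hr k (corner m r _ k 0 0)) (by omega) (by norm_num)
      (hasEdge_holePolygon hm hr k) hE hz) ?_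
    exact union_subset subset_union_right ((region_subset_fanUnion _ _ _).trans subset_union_left)
  refine hfan.fanUnion_union_eq_univ hm hr (isClosed_region _) ?_ ?_ (fun k _ => hedge k)
  · intro z hz hne
    rcases hccw.trichotomy (by omega) hz with h | ⟨q, h⟩ | ⟨q, h⟩
    · exact mem_of_superset h subset_union_right
    · exact (hne _ (h.trans (holePolygon_apply q))).elim
    · rw [holePolygon_finRotate hm, holePolygon_apply] at h
      exact hedge _ z h
  · intro k hk
    exfalso
    have h1 := holeCorner_succ (r := r) hm (k - 1)
    rw [sub_add_cancel, show k - 1 + 2 = k + 1 by ring, hk] at h1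
    have h2 : edgeVec m r k + edgeVec m r (k + 1) = 0 := by linear_combination -h1
    have h3 := cross_edgeVec_pos (m := m) hr (i := k) (j := k + 1) (by omega) (by omega)
    have h4 := congrArg (cross (edgeVec m r k)) h2
    rw [cross_add_right, cross_self, cross_zero_right] at h4
    linarith

/-- The tiles around the hole cover exactly the complement of its interior. -/
theorem fanUnion_holeCorner (hm : 5 ≤ m) (hr : 0 < r) :
    fanUnion m r (holeCorner m r) = (interior (region (holePolygon m r)))ᶜ := by
  refine Subset.antisymm ?_ ?_
  · intro z hz hzi
    obtain ⟨k, hz⟩ := mem_iUnion.1 hz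
    obtain ⟨⟨j, l⟩, hz⟩ := mem_iUnion.1 hz
    obtain ⟨q, hq, hq'⟩ := hasEdge_holePolygon (m := m) hm hr k
    have h1 := ((holePolygon_isCCW hm hr).mem_interior_iff (by omega)).1 hzi q
    rw [edgeFn, hq, hq', add_sub_cancel_left] at h1
    obtain ⟨t1, t2, t3⟩ := turning_edgeVec (m := m) hm hr k
    obtain ⟨α, β, γ, k1, k2, k3, k4, k5, k6, rfl⟩ := exists_coeffs hz
    have hca := cross_swap (edgeVec m r (k + 2)) (edgeVec m r k)
    have hcb := cross_swap (edgeVec m r (k + 2)) (edgeVec m r (k + 1))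
    simp only [corner, cross_sub_right, cross_add_right, cross_smul_right, cross_self, hca, hcb]
      at h1
    have hj : (0 : ℝ) ≤ j := Nat.cast_nonneg j
    have hl : (0 : ℝ) ≤ l := Nat.cast_nonneg l
    nlinarith [mul_nonneg hj t3.le, mul_nonneg hj t2.le, mul_nonneg hl t2.le,
      mul_nonneg k1 t3.le, mul_nonneg k3 t2.le]
  · intro z hz
    by_contra hnot
    apply hz
    refine mem_interior.2 ⟨(fanUnion m r (holeCorner m r))ᶜ, ?_,
      ((isFan_holeCorner hm hr).isClosed_fanUnion hm hr).isOpen_compl, hnot⟩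
    intro w hw
    have : w ∈ fanUnion m r (holeCorner m r) ∪ region (holePolygon m r) := by
      rw [fanUnion_union_hole hm hr]; trivial
    exact this.resolve_left hw

/-- An isometry that preserves the hole fixes its centre and permutes its vertices. -/
lemma exists_holeCorner_of_image (hm : 5 ≤ m) (hr : 0 < r) {g : ℂ ≃ᵢ ℂ}
    (hg : g '' region (holePolygon m r) = region (holePolygon m r)) :
    g 0 = 0 ∧ ∃ k : ℤ, g (holeVertex m r) = holeCorner m r k := by
  have hccw := holePolygon_isCCW (m := m) (r := r) hm hr
  set w := holeVertex m r
  have hnorm : ∀ k, ‖holeCorner m r k‖ = ‖w‖ := by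
    intro k; rw [holeCorner, norm_mul, Circle.norm_coe, mul_one]
  constructor
  · by_contra hq
    set q := g 0
    have hball : region (holePolygon m r) ⊆ Metric.closedBall 0 ‖w‖ := by
      refine convexHull_min ?_ (convex_closedBall _ _)
      rintro _ ⟨k, rfl⟩
      rw [mem_closedBall_zero_iff, holePolygon_apply, hnorm]
    -- the centroid of the vertices is `0`, so some vertex is not on the side of `q`
    have hsum : ∑ k : Fin m, holePolygon m r k = 0 := by
      have h1 : ∑ k : Fin m, holePolygon m r (finRotate m k) = ∑ k : Fin m, holePolygon m r k :=
        Equiv.sum_comp (finRotate m) fun k => holePolygon m r k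
      have h2 : ∀ k : Fin m, holePolygon m r (finRotate m k) = rot m 1 * holePolygon m r k := by
        intro k
        rw [holePolygon_finRotate hm, ← holeCorner_succ hm, holeCorner_add, holePolygon_apply]
      simp only [h2] at h1
      rw [← Finset.mul_sum] at h1
      have h3 : ((rot m 1 : ℂ) - 1) * ∑ k : Fin m, holePolygon m r k = 0 := by
        linear_combination h1
      exact (mul_eq_zero.1 h3).resolve_left (rot_one_sub_one_ne_zero hm)
    have hsum' : ∑ k : Fin m, (conj q * holePolygon m r k).re = 0 := by
      rw [← Complex.re_sum, ← Finset.mul_sum, hsum]; simp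
    have : Nonempty (Fin m) := ⟨⟨0, by omega⟩⟩
    obtain ⟨k, -, hk⟩ := Finset.exists_le_of_sum_le (s := (Finset.univ : Finset (Fin m)))
      (f := fun k => (conj q * holePolygon m r k).re) (g := fun _ => (0 : ℝ))
      Finset.univ_nonempty (by rw [hsum']; simp)
    have hk' : holePolygon m r k ∈ g '' region (holePolygon m r) := by
      rw [hg]; exact vertex_mem_region _ k
    obtain ⟨z, hz, hzk⟩ := hk'
    have h1 : ‖holePolygon m r k - q‖ ≤ ‖w‖ := by
      rw [← hzk, ← dist_eq_norm, g.isometry.dist_eq, dist_zero_right]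
      simpa using hball hz
    have h2 : ‖holePolygon m r k - q‖ ^ 2 =
        ‖holePolygon m r k‖ ^ 2 + ‖q‖ ^ 2 - 2 * (conj q * holePolygon m r k).re := by
      simp only [← Complex.normSq_eq_norm_sq, Complex.normSq_apply]
      simp; ring
    rw [holePolygon_apply k, hnorm, ← holePolygon_apply] at h2
    have h3 : 0 < ‖q‖ := norm_pos_iff.2 hq
    have h4 : (conj q * holePolygon m r k).re ≤ 0 := hk
    have h5 : ‖holePolygon m r k - q‖ ^ 2 ≤ ‖w‖ ^ 2 := by gcongr
    nlinarith
  · have e0 : w = holePolygon m r ⟨0, by omega⟩ := by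
      rw [holePolygon_apply, holeCorner]; simp [rot_zero, w]
    have hext : g w ∈ (region (holePolygon m r)).extremePoints ℝ := by
      rw [mem_extremePoints_iff_left]
      refine ⟨by rw [← hg, e0]; exact ⟨_, vertex_mem_region _ _, rfl⟩, ?_⟩
      intro z hz z' hz' h
      rw [← hg] at hz hz'
      obtain ⟨a, ha, rfl⟩ := hz
      obtain ⟨b, hb, rfl⟩ := hz'
      rw [mem_openSegment_image, e0] at h
      have := hccw.vertex_not_mem_openSegment (by omega) _ ha hb h
      rw [← this, openSegment_same] at h
      rw [e0, h]
    obtain ⟨k, hk⟩ := extremePoints_convexHull_subset hext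
    exact ⟨_, hk.symm.trans (holePolygon_apply k)⟩

end Hole

/-! ### Symmetries of the fan around a regular polygon -/

section HoleSymmetries

variable {m : ℕ} {r : ℝ} {i : Fin 6} {x y : ℂ}

/-- The symmetries of a tiling of the complement of the hole are rotations of the hole, or such a
rotation after the reflection that fixes the centre and the first vertex of the hole. -/
lemma eq_rotation_or_reflection (hm : 5 ≤ m) (hr : 0 < r) {n : ℕ} {T : Set (Polygon ℂ n)}
    (hT : Tiles T (interior (region (holePolygon m r)))ᶜ)
    (hrot : ∀ k, directIso (rot m k) 0 ∈ symmetries T) {g : ℂ ≃ᵢ ℂ} (hg : g ∈ symmetries T) :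
    (∃ k, g = directIso (rot m k) 0) ∨ ∃ (s : Circle) (k : ℤ), s * conj (holeVertex m r) =
      holeVertex m r ∧ oppositeIso s 0 ∈ symmetries T ∧ g = oppositeIso (s * rot m k) 0 := by
  have hm0 : m ≠ 0 := by omega
  have hw := holeVertex_ne_zero (m := m) hm hr
  have h1 := image_of_tiles hT hg
  have h2 : g '' interior (region (holePolygon m r)) = interior (region (holePolygon m r)) := by
    rw [image_compl_eq g.bijective] at h1
    exact compl_injective h1
  have h3 : g '' region (holePolygon m r) = region (holePolygon m r) := by
    have := congrArg closure h2
    rwa [show closure (g '' interior (region (holePolygon m r))) = _ from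
        (g.toHomeomorph.image_closure (interior (region (holePolygon m r)))).symm,
      (holePolygon_isCCW hm hr).closure_interior (by omega)] at this
  obtain ⟨h0, k, hk⟩ := exists_holeCorner_of_image hm hr h3
  obtain ⟨u, hu⟩ := eq_directIso_or_oppositeIso g
  rw [h0] at hu
  rcases hu with rfl | rfl
  · refine Or.inl ⟨k, ?_⟩
    rw [directIso_apply, holeCorner, zero_add, mul_comm] at hk
    rw [Circle.ext (mul_left_cancel₀ hw hk)]
  · rw [oppositeIso_apply, holeCorner, zero_add] at hk
    have hs : ((u * rot m (-k) : Circle) : ℂ) * conj (holeVertex m r) = holeVertex m r := by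
      rw [Circle.coe_mul, mul_right_comm, hk, mul_assoc, ← Circle.coe_mul, ← rot_add,
        add_neg_cancel, rot_zero, Circle.coe_one, mul_one]
    refine Or.inr ⟨u * rot m (-k), k, hs, ?_, ?_⟩
    · have := trans_mem_symmetries hg (hrot (-k))
      convert this using 1
      ext1 z; simp; ring
    · rw [mul_assoc, ← rot_add, neg_add_cancel, rot_zero, mul_one]

/-- The reflection that fixes the first vertex of the hole, as a map of the edge vectors. -/
lemma mul_conj_edgeVec_of_mirror (hm : 5 ≤ m) {s : ℂ}
    (hs : s * conj (holeVertex m r) = holeVertex m r) (j : ℤ) :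
    s * conj (edgeVec m r j) = -edgeVec m r (3 - j) := by
  have h1 : ∀ j, edgeVec m r j = holeVertex m r * (rot m (j - 1) - rot m (j - 2)) := by
    intro j
    have h := rot_one_sub_one_ne_zero hm
    rw [show j - 1 = j - 2 + 1 by ring, rot_add, Circle.coe_mul, holeVertex,
      show edgeVec m r j = rot m (j - 2) * edgeVec m r 2 by rw [rot_mul_edgeVec]; congr 1; ring]
    field_simp
  rw [h1 j, h1 (3 - j), map_mul, map_sub, conj_rot, conj_rot, ← mul_assoc, hs,
    show -(j - 1) = 3 - j - 2 by ring, show -(j - 2) = 3 - j - 1 by ring]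
  ring

/-- Unless `m = 6`, the reflection in the axis through a vertex of the hole carries the edge there
that leads away from the hole into the interior of a tile. -/
lemma reflection_not_mem_symmetries (hm : 5 ≤ m) (hr : 0 < r) (hm6 : m ≠ 6) {n : ℕ}
    {T : Set (Polygon ℂ n)}
    (h1 : ∀ z ∈ segment ℝ (holeVertex m r) (holeVertex m r + edgeVec m r 0), z ∉ openPart T)
    (h2 : ∀ k j l q, ∀ᶠ z in 𝓝 (fanTile m r (holeCorner m r) k j l q),
      z ∈ interior (region (fanTile m r (holeCorner m r) k j l)) → z ∈ openPart T)
    {s : Circle} (hs : s * conj (holeVertex m r) = holeVertex m r) :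
    oppositeIso s 0 ∉ symmetries T := by
  intro hσ
  set w := holeVertex m r with hwdef
  have hcorner : holeCorner m r 0 = w := by simp [holeCorner, rot_zero, hwdef]
  -- the tile that the reflected edge enters
  obtain ⟨k, q, hq, hint⟩ : ∃ (k : ℤ) (q : Fin 6), fanTile m r (holeCorner m r) k 0 0 q = w ∧
      ∀ᶠ t : ℝ in 𝓝[>] 0, fanTile m r (holeCorner m r) k 0 0 q + t • (-edgeVec m r 3) ∈
        interior (region (fanTile m r (holeCorner m r) k 0 0)) := by
    rcases (by omega : m = 5 ∨ 7 ≤ m) with h5 | h7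
    · have e0 : edgeVec m r 5 = edgeVec m r 0 := by
        have := edgeVec_add_mul (m := m) (r := r) (by omega) 0 1
        rw [← this, h5]; norm_num
      refine ⟨0, 0, by simp [fanTile, tile, zonogon, corner, hcorner], ?_⟩
      refine (tile_isCCW hm hr 0 _).eventually_mem_interior (by norm_num) 0 ?_ ?_
      · have := cross_edgeVec_pos (m := m) hr (i := 3) (j := 5) (by norm_num) (by omega)
        rw [e0, cross_swap] at this
        have e : cross (edgeVec m r 0) (-edgeVec m r 3) = -cross (edgeVec m r 0) (edgeVec m r 3) :=
          cross_neg_right _ _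
        simpa [tile, zonogon, e] using this
      · have := cross_edgeVec_pos (m := m) hr (i := 2) (j := 3) (by norm_num) (by omega)
        rw [cross_swap, ← cross_neg_left] at this
        convert this using 2
        rw [show (finRotate 6).symm 0 = 5 from rfl]
        simp [tile, zonogon]
    · refine ⟨-1, 5, ?_, ?_⟩
      · have := holeCorner_succ (r := r) hm (-1)
        norm_num at this
        simp [fanTile, tile, zonogon, corner]
        rw [← hcorner, this]
      · refine (tile_isCCW hm hr (-1) _).eventually_mem_interior (by norm_num) 5 ?_ ?_
        · have := cross_edgeVec_pos (m := m) hr (i := 1) (j := 3) (by norm_num) (by omega)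
          rw [show finRotate 6 5 = 0 from rfl]
          have e : tile m r (-1) (corner m r (holeCorner m r) (-1) 0 0) 0 -
              tile m r (-1) (corner m r (holeCorner m r) (-1) 0 0) 5 = -edgeVec m r 1 := by
            simp [tile, zonogon]
          rw [e, cross_neg_left, cross_neg_right, neg_neg]
          exact this
        · have := cross_edgeVec_pos (m := m) hr (i := 0) (j := 3) (by norm_num) (by omega)
          rw [show (finRotate 6).symm 5 = 4 from rfl]
          have e : tile m r (-1) (corner m r (holeCorner m r) (-1) 0 0) 4 -
              tile m r (-1) (corner m r (holeCorner m r) (-1) 0 0) 5 = edgeVec m r 0 := by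
            simp [tile, zonogon]
          rw [e, cross_neg_left, ← cross_swap]
          exact this
  have hlim : Tendsto (fun t : ℝ => w + t • (-edgeVec m r 3)) (𝓝[>] 0) (𝓝 w) := by
    have hc : Continuous fun t : ℝ => w + t • (-edgeVec m r 3) := by fun_prop
    have := hc.tendsto 0
    simp only [zero_smul, add_zero] at this
    exact this.mono_left nhdsWithin_le_nhds
  have h3 := h2 k 0 0 q
  rw [hq] at h3 hint
  obtain ⟨t, ⟨ht1, ht2⟩, ht3, ht4⟩ := ((hint.and (hlim.eventually h3)).and
    (Ioo_mem_nhdsGT (zero_lt_one' ℝ))).exists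
  refine h1 (w + t • edgeVec m r 0) ?_ ((apply_mem_openPart_iff hσ).1 ?_)
  · refine ⟨1 - t, t, by linarith, ht3.le, by ring, ?_⟩
    simp; ring
  · convert ht2 ht1 using 1
    have := mul_conj_edgeVec_of_mirror hm hs 0
    simp only [oppositeIso_apply, map_add, Complex.real_smul, map_mul, Complex.conj_ofReal]
    rw [sub_zero] at this
    linear_combination hs + (t : ℂ) * this

/-- The hexagons cover the plane minus the interior of the hole. -/
lemma tiles_hole (hm : 5 ≤ m) (hr : 0 < r) :
    Tiles (copies (fanPlacements m r (holeCorner m r)) (stdHexagon m r))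
      (interior (region (holePolygon m r)))ᶜ := by
  rw [← fanUnion_holeCorner hm hr]
  exact (isFan_holeCorner hm hr).tiles hm hr

lemma tiles_hole_bisected (hm : 5 ≤ m) (hr : 0 < r) (hb : IsBisection (stdHexagon m r) i x y) :
    Tiles (bisectedPattern (fanPlacements m r (holeCorner m r)) (stdHexagon m r) i x y)
      (interior (region (holePolygon m r)))ᶜ := by
  rw [← fanUnion_holeCorner hm hr]
  exact (isFan_holeCorner hm hr).tiles_bisected hm hr hb

lemma holeVertex_edge_not_mem_openPart (hm : 5 ≤ m) (hr : 0 < r) :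
    ∀ z ∈ segment ℝ (holeVertex m r) (holeVertex m r + edgeVec m r 0),
      z ∉ openPart (copies (fanPlacements m r (holeCorner m r)) (stdHexagon m r)) := by
  intro z hz
  have hccw := tile_isCCW (r := r) hm hr 0 (corner m r (holeCorner m r) 0 0 0)
  have hz' : z ∈ segment ℝ (fanTile m r (holeCorner m r) 0 0 0 0)
      (fanTile m r (holeCorner m r) 0 0 0 (finRotate 6 0)) := by
    convert hz using 2 <;> simp [fanTile, tile, zonogon, corner, holeCorner, rot_zero]
  exact not_mem_openPart (tiles_hole hm hr) (mem_copies_fanPlacements.2 ⟨0, 0, 0, rfl⟩)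
    (hccw.closure_interior (by norm_num)) (segment_subset_region _ _ _ hz')
    (hccw.not_mem_interior_of_mem_segment (by norm_num) hz')

lemma symmetries_eq_of_no_reflection (hm : 5 ≤ m) (hr : 0 < r) {n : ℕ} {T : Set (Polygon ℂ n)}
    (hT : Tiles T (interior (region (holePolygon m r)))ᶜ)
    (hrot : ∀ k, directIso (rot m k) 0 ∈ symmetries T)
    (hno : ∀ s : Circle, s * conj (holeVertex m r) = holeVertex m r →
      oppositeIso s 0 ∉ symmetries T) : symmetries T = cyclicSymmetries m 0 := by
  ext g
  rw [mem_cyclicSymmetries (by omega)]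
  constructor
  · intro hg
    rcases eq_rotation_or_reflection hm hr hT hrot hg with h | ⟨s, k, h1, h2, -⟩
    · exact h
    · exact (hno s h1 h2).elim
  · rintro ⟨k, rfl⟩
    exact hrot k

theorem symmetries_hole (hm : 5 ≤ m) (hr : 0 < r) (hm6 : m ≠ 6) :
    symmetries (copies (fanPlacements m r (holeCorner m r)) (stdHexagon m r)) =
      cyclicSymmetries m 0 := by
  refine symmetries_eq_of_no_reflection hm hr (tiles_hole hm hr)
    (fun k => directIso_mem_symmetries (holeCorner_add k) _) fun s hs => ?_
  refine reflection_not_mem_symmetries hm hr hm6 (holeVertex_edge_not_mem_openPart hm hr) ?_ hs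
  intro k j l q
  exact Eventually.of_forall fun z hz =>
    mem_openPart.2 ⟨_, mem_copies_fanPlacements.2 ⟨k, j, l, rfl⟩, hz⟩

/-! ### The hole with six sides -/

lemma holeVertex_six : holeVertex 6 r = r := by
  have h0 := rot_one_sub_one_ne_zero (m := 6) (by norm_num)
  have h1 : (rot 6 1 : ℂ) = 1 / 2 + (Real.sqrt 3 / 2 : ℝ) * Complex.I := by
    have e : ((1 : ℤ) : ℝ) * (2 * Real.pi / (6 : ℕ)) = Real.pi / 3 := by push_cast; ring
    apply Complex.ext
    · rw [rot_re, e, Real.cos_pi_div_three]; simp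
    · rw [rot_im, e, Real.sin_pi_div_three]; simp
  have h2 : (rot 6 2 : ℂ) = rot 6 1 * rot 6 1 := by
    rw [← Circle.coe_mul, ← rot_add]; norm_num
  have h3 : ((Real.sqrt 3 : ℝ) : ℂ) ^ 2 = 3 := by
    rw [← Complex.ofReal_pow, Real.sq_sqrt (by norm_num)]; norm_num
  have h4 : (rot 6 1 : ℂ) * rot 6 1 = rot 6 1 - 1 := by
    rw [h1]; push_cast
    linear_combination (Complex.I ^ 2 / 4) * h3 + (3 / 4 : ℂ) * Complex.I_sq
  rw [holeVertex, edgeVec, h2, h4]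
  field_simp

lemma mirror_six (hr : 0 < r) {s : Circle}
    (hs : s * conj (holeVertex 6 r) = holeVertex 6 r) : s = 1 := by
  rw [holeVertex_six, Complex.conj_ofReal] at hs
  have hr' : (r : ℂ) ≠ 0 := by exact_mod_cast hr.ne'
  exact Circle.ext (by rw [Circle.coe_one]; exact (mul_eq_right₀ hr').1 hs)

lemma edgeVec_six_add_three (k : ℤ) : edgeVec 6 r (k + 3) = -edgeVec 6 r k :=
  edgeVec_antipode (by norm_num) (by norm_num)

lemma edgeVec_six_add_two (k : ℤ) : edgeVec 6 r (k + 2) = edgeVec 6 r (k + 1) - edgeVec 6 r k := by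
  have h := edgeVec_add_edgeVec (m := 6) (r := r) k
  rw [show 2 * Real.pi / (6 : ℕ) = Real.pi / 3 by push_cast; ring, Real.cos_pi_div_three] at h
  simp at h
  linear_combination h

lemma holeCorner_six (k : ℤ) : holeCorner 6 r k = edgeVec 6 r k := by
  rw [holeCorner, holeVertex_six, edgeVec]

/-- The vertices of a tile around a hexagonal hole, in terms of the centre of the tile. -/
lemma range_fanTile_six (k : ℤ) (j l : ℕ) :
    range (fanTile 6 r (holeCorner 6 r) k j l).vertices =
      range fun q : ℤ => ((1 + j : ℝ) • (edgeVec 6 r k + edgeVec 6 r (k + 1)) +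
        (l : ℝ) • (edgeVec 6 r (k + 1) + edgeVec 6 r (k + 2))) + edgeVec 6 r q := by
  have h2 := edgeVec_six_add_two (r := r)
  have h3 := edgeVec_six_add_three (r := r)
  have e2 : edgeVec 6 r (k + 2) = edgeVec 6 r (k + 1) - edgeVec 6 r k := h2 k
  set C := (1 + j : ℝ) • (edgeVec 6 r k + edgeVec 6 r (k + 1)) +
        (l : ℝ) • (edgeVec 6 r (k + 1) + edgeVec 6 r (k + 2)) with hC
  have hv : (fanTile 6 r (holeCorner 6 r) k j l).vertices = ![C + edgeVec 6 r (k + 4),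
      C + edgeVec 6 r (k + 5), C + edgeVec 6 r (k + 6), C + edgeVec 6 r (k + 1),
      C + edgeVec 6 r (k + 2), C + edgeVec 6 r (k + 3)] := by
    have e4 : edgeVec 6 r (k + 4) = -edgeVec 6 r (k + 1) := by
      rw [← h3]; congr 1; ring
    have e5 : edgeVec 6 r (k + 5) = -edgeVec 6 r (k + 2) := by
      rw [← h3]; congr 1; ring
    have e6 : edgeVec 6 r (k + 6) = edgeVec 6 r k := by
      have := edgeVec_add_mul (m := 6) (r := r) (by norm_num) k 1
      simpa using this
    rw [e4, e5, e6, h3 k]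
    funext q
    fin_cases q <;> simp [fanTile, tile, zonogon, corner, holeCorner_six, hC, e2] <;> ring
  rw [hv]
  ext z
  constructor
  · rintro ⟨q, rfl⟩
    fin_cases q
    exacts [⟨k + 4, rfl⟩, ⟨k + 5, rfl⟩, ⟨k + 6, rfl⟩, ⟨k + 1, rfl⟩, ⟨k + 2, rfl⟩, ⟨k + 3, rfl⟩]
  · rintro ⟨q, rfl⟩
    have hd : (q - k - 1) % 6 + 6 * ((q - k - 1) / 6) = q - k - 1 := Int.emod_add_mul_ediv _ _
    have h1 := Int.emod_nonneg (q - k - 1) (by norm_num : (6 : ℤ) ≠ 0)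
    have h2 := Int.emod_lt_of_pos (q - k - 1) (by norm_num : (0 : ℤ) < 6)
    have e : edgeVec 6 r q = edgeVec 6 r (k + ((q - k - 1) % 6 + 1)) := by
      rw [← edgeVec_add_mul (m := 6) (r := r) (by norm_num) (k + ((q - k - 1) % 6 + 1))
        ((q - k - 1) / 6)]
      congr 1; push_cast; linarith
    simp only [e]
    generalize (q - k - 1) % 6 = d at h1 h2
    interval_cases d
    exacts [⟨3, rfl⟩, ⟨4, rfl⟩, ⟨5, rfl⟩, ⟨0, rfl⟩, ⟨1, rfl⟩, ⟨2, rfl⟩]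

/-- Around a hexagonal hole the reflection in the axis through the midpoint of the first edge is a
symmetry. -/
lemma reflection_mem_symmetries_six :
    oppositeIso (rot 6 1) 0 ∈
      symmetries (copies (fanPlacements 6 r (holeCorner 6 r)) (stdHexagon 6 r)) := by
  have hσ : ∀ q, rot 6 1 * conj (edgeVec 6 r q) = edgeVec 6 r (1 - q) := by
    intro q; rw [conj_edgeVec, rot_mul_edgeVec]; rfl
  have key : ∀ (k k' : ℤ) (j l j' l' : ℕ),
      (rot 6 1 : ℂ) * conj ((1 + j : ℝ) • (edgeVec 6 r k + edgeVec 6 r (k + 1)) +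
        (l : ℝ) • (edgeVec 6 r (k + 1) + edgeVec 6 r (k + 2))) =
      (1 + j' : ℝ) • (edgeVec 6 r k' + edgeVec 6 r (k' + 1)) +
        (l' : ℝ) • (edgeVec 6 r (k' + 1) + edgeVec 6 r (k' + 2)) →
      oppositeIso (rot 6 1) 0 '' region (fanTile 6 r (holeCorner 6 r) k j l) =
        region (fanTile 6 r (holeCorner 6 r) k' j' l') := by
    intro k k' j l j' l' h
    have e : region (fanTile 6 r (holeCorner 6 r) k' j' l') =
        region (movePolygon (oppositeIso (rot 6 1) 0) (fanTile 6 r (holeCorner 6 r) k j l)) := by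
      have hr1 : range (movePolygon (oppositeIso (rot 6 1) 0)
          (fanTile 6 r (holeCorner 6 r) k j l)).vertices =
          oppositeIso (rot 6 1) 0 '' range (fanTile 6 r (holeCorner 6 r) k j l).vertices := by
        rw [← range_comp]; rfl
      rw [region, region, hr1, range_fanTile_six, range_fanTile_six, ← h]
      congr 1
      ext z
      constructor
      · rintro ⟨q, rfl⟩
        refine ⟨_, ⟨1 - q, rfl⟩, ?_⟩
        rw [oppositeIso_apply, map_add, mul_add, hσ, zero_add, sub_sub_cancel]
      · rintro ⟨_, ⟨q, rfl⟩, rfl⟩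
        refine ⟨1 - q, ?_⟩
        rw [oppositeIso_apply, map_add _ _ (edgeVec 6 r q), mul_add, hσ, zero_add]
    rw [e, region_movePolygon]
  have hmap : ∀ P ∈ copies (fanPlacements 6 r (holeCorner 6 r)) (stdHexagon 6 r),
      ∃ Q ∈ copies (fanPlacements 6 r (holeCorner 6 r)) (stdHexagon 6 r),
        oppositeIso (rot 6 1) 0 '' region P = region Q := by
    intro P hP
    obtain ⟨k, j, l, rfl⟩ := mem_copies_fanPlacements.1 hP
    have e1 : (1 : ℤ) - (k + 1) = -k := by ring
    have e2 : (1 : ℤ) - (k + 2) = -k - 1 := by ring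
    have e3 : (1 : ℤ) - k = -k + 1 := by ring
    rcases l with _ | l
    · refine ⟨_, mem_copies_fanPlacements.2 ⟨-k, j, 0, rfl⟩, key _ _ _ _ _ _ ?_⟩
      simp only [map_add, Complex.real_smul, map_mul, Complex.conj_ofReal, Nat.cast_zero,
        Complex.ofReal_zero, zero_mul, add_zero]
      linear_combination ((1 + j : ℝ) : ℂ) * (hσ k + hσ (k + 1) +
        congrArg (edgeVec 6 r) e1 + congrArg (edgeVec 6 r) e3)
    · refine ⟨_, mem_copies_fanPlacements.2 ⟨-k - 1, l, j + 1, rfl⟩, key _ _ _ _ _ _ ?_⟩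
      have e4 : -k - 1 + 1 = -k := by ring
      have e5 : -k - 1 + 2 = -k + 1 := by ring
      simp only [map_add, Complex.real_smul, map_mul, Complex.conj_ofReal, e4, e5]
      push_cast
      linear_combination (1 + j : ℂ) * (hσ k + hσ (k + 1) +
        congrArg (edgeVec 6 r) e1 + congrArg (edgeVec 6 r) e3) + (1 + l : ℂ) * (hσ (k + 1) +
        hσ (k + 2) + congrArg (edgeVec 6 r) e1 + congrArg (edgeVec 6 r) e2)
  have hinv : (oppositeIso (rot 6 1) 0).symm = oppositeIso (rot 6 1) 0 := by
    ext1 z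
    rw [IsometryEquiv.symm_apply_eq]
    simp only [oppositeIso_apply, zero_add, map_mul, Complex.conj_conj, conj_rot]
    rw [← mul_assoc, ← Circle.coe_mul, ← rot_add]; simp [rot_zero]
  exact mem_symmetries_of_maps hmap (by rw [hinv]; exact hmap)

theorem symmetries_hole_six (hr : 0 < r) :
    symmetries (copies (fanPlacements 6 r (holeCorner 6 r)) (stdHexagon 6 r)) =
      dihedralSymmetries 6 0 1 := by
  have hrot := fun k => directIso_mem_symmetries (r := r) (holeCorner_add (m := 6) (r := r) k)
    (stdHexagon 6 r)
  ext g
  have hD := mem_dihedralSymmetries (m := 6) (by norm_num) 1 (g := g)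
  rw [Circle.coe_one] at hD
  rw [hD]
  constructor
  · intro hg
    rcases eq_rotation_or_reflection (by norm_num) hr (tiles_hole (by norm_num) hr) hrot hg with
      h | ⟨s, k, h1, -, h3⟩
    · exact Or.inl h
    · rw [mirror_six hr h1] at h3
      exact Or.inr ⟨k, h3⟩
  · rintro (⟨k, rfl⟩ | ⟨k, rfl⟩)
    · exact hrot k
    · have := trans_mem_symmetries (reflection_mem_symmetries_six (r := r)) (hrot (k - 1))
      convert this using 1
      ext1 z
      have e : (rot 6 k : ℂ) = rot 6 (k - 1) * rot 6 1 := by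
        rw [← Circle.coe_mul, ← rot_add, sub_add_cancel]
      simp [e]; ring

/-- For a hexagonal hole, the reflections are not symmetries of the bisected pattern: they would
have to preserve the cut of one tile and to carry the cut of another one to that of its mirror
image, which are incompatible conditions on the direction of the cut. -/
lemma reflection_not_mem_symmetries_six (hr : 0 < r) (hb : IsBisection (stdHexagon 6 r) i x y) :
    oppositeIso (rot 6 1) 0 ∉
      symmetries (bisectedPattern (fanPlacements 6 r (holeCorner 6 r)) (stdHexagon 6 r) i x y) := by
  intro hσ
  have hp := isFan_holeCorner (m := 6) (r := r) (by norm_num) hr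
  have hne := sub_ne_zero_of_isBisection (by norm_num) hr hb
  have hσe : ∀ q, rot 6 1 * conj (edgeVec 6 r q) = edgeVec 6 r (1 - q) := by
    intro q; rw [conj_edgeVec, rot_mul_edgeVec]; rfl
  have ho : hexagonCenter (stdHexagon 6 r) = edgeVec 6 r 1 := by
    rw [stdHexagon, tile, hexagonCenter_zonogon]
    have := edgeVec_six_add_two (r := r) 0
    norm_num at this
    simp [this]; ring
  have c1 := hp.cross_direction_eq_zero (by norm_num) hr hb hσ ⟨0, 0, 0, rfl⟩ ⟨0, 0, 0, rfl⟩
    (s := rot 6 1) (by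
      intro z
      have h0 := hσe 0
      have h1 := hσe 1
      norm_num at h0 h1
      simp [ho, corner, holeCorner_six, rot_zero]
      linear_combination h0 + h1)
  have c2 := hp.cross_direction_eq_zero (by norm_num) hr hb hσ ⟨0, 0, 1, rfl⟩ ⟨-1, 0, 1, rfl⟩
    (s := rot 6 2) (by
      intro z
      have h0 := hσe 0
      have h1 := hσe 1
      have h2 := hσe 2
      norm_num at h0 h1 h2
      have h3 : (rot 6 (-1) : ℂ) * edgeVec 6 r 1 = edgeVec 6 r 0 := rot_mul_edgeVec _ _
      have h4 : (rot 6 (-1) : ℂ) * rot 6 2 = rot 6 1 := by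
        rw [← Circle.coe_mul, ← rot_add]; norm_num
      simp [ho, corner, holeCorner_six, rot_zero, mul_add, h3]
      linear_combination h0 + h1 + h1 + h2 - conj z * h4)
  -- the direction is excluded by the independence of the two rotations
  have q1 : ∀ q : ℤ, cross (x - y) (rot 6 q * conj (x - y)) =
      ((rot 6 q : ℂ) * conj (x - y) ^ 2).im := by
    intro q; rw [cross]; congr 1; ring
  rw [q1] at c1 c2
  have hd : conj (x - y) ^ 2 ≠ 0 := pow_ne_zero _ ((map_ne_zero _).2 hne)
  apply hd
  have s3 : (0 : ℝ) < Real.sqrt 3 := Real.sqrt_pos.2 (by norm_num)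
  have a1 : ((1 : ℤ) : ℝ) * (2 * Real.pi / (6 : ℕ)) = Real.pi / 3 := by push_cast; ring
  have a2 : ((2 : ℤ) : ℝ) * (2 * Real.pi / (6 : ℕ)) = Real.pi - Real.pi / 3 := by push_cast; ring
  rw [Complex.mul_im, rot_re, rot_im, a1, Real.cos_pi_div_three, Real.sin_pi_div_three] at c1
  rw [Complex.mul_im, rot_re, rot_im, a2, Real.cos_pi_sub, Real.sin_pi_sub,
    Real.cos_pi_div_three, Real.sin_pi_div_three] at c2
  have him : (conj (x - y) ^ 2).im = 0 := by linarith
  have hre : Real.sqrt 3 * (conj (x - y) ^ 2).re = 0 := by linarith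
  exact Complex.ext ((mul_eq_zero.1 hre).resolve_left s3.ne') him

theorem symmetries_hole_bisected (hm : 5 ≤ m) (hr : 0 < r)
    (hb : IsBisection (stdHexagon m r) i x y) :
    symmetries (bisectedPattern (fanPlacements m r (holeCorner m r)) (stdHexagon m r) i x y) =
      cyclicSymmetries m 0 := by
  have hp := isFan_holeCorner (m := m) (r := r) hm hr
  have hrot := fun k => directIso_mem_symmetries_bisected (r := r) (i := i) (x := x) (y := y)
    (H := stdHexagon m r) (holeCorner_add (m := m) (r := r) k)
  refine symmetries_eq_of_no_reflection hm hr (tiles_hole_bisected hm hr hb) hrot fun s hs => ?_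
  by_cases hm6 : m = 6
  · subst hm6
    rw [mirror_six hr hs]
    intro h
    refine reflection_not_mem_symmetries_six hr hb ?_
    convert trans_mem_symmetries h (hrot 1) using 1
    ext1 z; simp
  · exact reflection_not_mem_symmetries hm hr hm6 (fun z hz h =>
      holeVertex_edge_not_mem_openPart hm hr z hz (openPart_bisected_subset hm hr hb h))
      (hp.eventually_mem_openPart hm hr hb) hs

lemma dist_holePolygon (hm : 5 ≤ m) (hr : 0 < r) (k : Fin m) :
    dist (holePolygon m r k) (holePolygon m r (finRotate m k)) = r := by
  rw [holePolygon_finRotate hm, holePolygon_apply, dist_self_add_right, norm_edgeVec hr]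

end HoleSymmetries

/-! ### The fan around a point -/

section Star

variable {m : ℕ} {r : ℝ} {i : Fin 6} {x y : ℂ}

/-- The corners of the sectors of the tiling of the whole plane: every other sector starts at `0`,
the others start at the ends of the edges at `0`. -/
def starCorner (m : ℕ) (r : ℝ) (k : ℤ) : ℂ := if Even k then 0 else edgeVec m r (k + 1)

lemma starCorner_of_even {k : ℤ} (hk : Even k) : starCorner m r k = 0 := if_pos hk

lemma starCorner_of_odd {k : ℤ} (hk : Odd k) : starCorner m r k = edgeVec m r (k + 1) :=
  if_neg (Int.not_even_iff_odd.2 hk)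

lemma starCorner_add {d : ℤ} (hd : Even d) (k : ℤ) :
    starCorner m r (k + d) = rot m d * starCorner m r k := by
  rcases Int.even_or_odd k with hk | hk
  · rw [starCorner_of_even hk, starCorner_of_even (hk.add hd), mul_zero]
  · rw [starCorner_of_odd hk, starCorner_of_odd (hk.add_even hd), rot_mul_edgeVec]
    congr 1; ring

lemma isFan_starCorner (hm : 5 ≤ m) (hme : Even m) (hr : 0 < r) : IsFan m r (starCorner m r) where
  period k := by
    rw [starCorner_add (by exact_mod_cast hme), rot_self (by omega)]; simp
  adj k := by
    rcases Int.even_or_odd k with hk | hk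
    · left
      rw [starCorner_of_even hk, starCorner_of_odd hk.add_one, zero_add]
      congr 1; ring
    · right
      rw [starCorner_of_odd hk, starCorner_of_even hk.add_one, zero_add]
  far k d hd hdm := by
    have h12 := cross_edgeVec_pos (m := m) hr (i := k + 1) (j := k + 2) (by omega) (by omega)
    have hkd := cross_edgeVec_pos (m := m) hr (i := k + 2) (j := k + d + 1) (by omega) (by omega)
    rcases Int.even_or_odd k with hk | hk
    · rcases Int.even_or_odd (k + d) with h | h
      · right
        rw [starCorner_of_even hk, starCorner_of_even h]
      · left
        rw [starCorner_of_even hk, starCorner_of_odd h, sub_zero]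
        exact hkd
    · left
      rcases Int.even_or_odd (k + d) with h | h
      · rw [starCorner_of_odd hk, starCorner_of_even h, zero_sub, cross_neg_right, ← cross_swap]
        exact h12
      · rw [starCorner_of_odd hk, starCorner_of_odd h, cross_sub_right,
          cross_swap _ (edgeVec m r (k + 1))]
        linarith

theorem fanUnion_starCorner (hm : 5 ≤ m) (hme : Even m) (hr : 0 < r) :
    fanUnion m r (starCorner m r) = univ := by
  have hfan := isFan_starCorner hm hme hr
  -- the two tiles at an edge that ends at `0`
  have hedge : ∀ k : ℤ, Even k → ∀ z ∈ openSegment ℝ (0 : ℂ) (0 + edgeVec m r k),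
      fanUnion m r (starCorner m r) ∪ ∅ ∈ 𝓝 z := by
    intro k hk z hz
    have hk2 : Even (k - 2) := hk.sub even_two
    refine mem_of_superset (union_mem_nhds_of_hasEdge
      (P := fanTile m r (starCorner m r) k 0 0) (Q := fanTile m r (starCorner m r) (k - 2) 0 0)
      (tile_isCCW hm hr k _) (tile_isCCW hm hr (k - 2) _) (by norm_num) (by norm_num)
      (hasEdge_zero (by simp [corner, starCorner_of_even hk]) rfl)
      (hasEdge_five (by simp [corner, starCorner_of_even hk2]) (by simp)) hz) ?_
    rw [union_empty]
    exact union_subset (region_subset_fanUnion _ _ _) (region_subset_fanUnion _ _ _)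
  have hne : ∀ k, edgeVec m r k + edgeVec m r (k + 1) ≠ 0 := by
    intro k hk
    have h3 := cross_edgeVec_pos (m := m) hr (i := k) (j := k + 1) (by omega) (by omega)
    have h4 := congrArg (cross (edgeVec m r k)) hk
    rw [cross_add_right, cross_self, cross_zero_right] at h4
    linarith
  rw [← union_empty (fanUnion m r (starCorner m r))]
  refine hfan.fanUnion_union_eq_univ hm hr isClosed_empty (fun z hz => hz.elim) ?_ ?_
  · intro k h
    rcases Int.even_or_odd k with hk | hk
    · rw [starCorner_of_even hk]
      exact hedge k hk
    · rw [starCorner_of_odd hk, starCorner_of_even (hk.sub_odd odd_one)] at h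
      exact (hne k (by rw [add_comm]; exact h.symm)).elim
  · intro k h
    rcases Int.even_or_odd k with hk | hk
    · rw [starCorner_of_even hk]
      exact hedge (k + 2) (hk.add even_two)
    · rw [starCorner_of_odd hk, starCorner_of_even hk.add_one] at h
      refine (hne (k + 1) ?_).elim
      rw [h]; congr 2; ring

lemma rot_half {n : ℕ} (hmn : m = 2 * n) (k : ℤ) : rot n k = rot m (2 * k) := by
  rw [rot, rot, hmn]
  congr 1
  push_cast
  rw [show 2 * Real.pi * (2 * (k : ℝ)) = 2 * (2 * Real.pi * k) by ring,
    mul_div_mul_left _ _ two_ne_zero]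

/-! ### Reflections of the fan around a point -/

lemma oppositeIso_oppositeIso (u : Circle) (z : ℂ) : oppositeIso u 0 (oppositeIso u 0 z) = z := by
  simp only [oppositeIso_apply, zero_add, map_mul, Complex.conj_conj]
  rw [← mul_assoc, Complex.mul_conj, Circle.normSq_coe]; simp

lemma rot_two_mul_conj_edgeVec (q : ℤ) :
    rot m 2 * conj (edgeVec m r q) = edgeVec m r (2 - q) := by
  rw [conj_edgeVec, rot_mul_edgeVec]; rfl

lemma rot_two_mul_conj_starCorner (k : ℤ) :
    rot m 2 * conj (starCorner m r k) = starCorner m r (-k) := by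
  rcases Int.even_or_odd k with hk | hk
  · rw [starCorner_of_even hk, starCorner_of_even hk.neg]; simp
  · rw [starCorner_of_odd hk, starCorner_of_odd hk.neg, rot_two_mul_conj_edgeVec]
    congr 1; ring

/-- The reflection in the axis of a tile at `0` permutes the tiles: it interchanges sector `k` with
sector `-k` and the two directions of the lattice. -/
lemma conj_mem_fanPlacements_star {g : ℂ ≃ᵢ ℂ} (hg : g ∈ fanPlacements m r (starCorner m r)) :
    ((oppositeIso (rot m 2) 0).trans g).trans (oppositeIso (rot m 2) 0) ∈
      fanPlacements m r (starCorner m r) := by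
  obtain ⟨k, j, l, rfl⟩ := hg
  refine ⟨-k, l, j, ?_⟩
  ext1 z
  have h0 := rot_two_mul_conj_edgeVec (m := m) (r := r) k
  have h1 := rot_two_mul_conj_edgeVec (m := m) (r := r) (k + 1)
  have h2 := rot_two_mul_conj_edgeVec (m := m) (r := r) (k + 2)
  have hp := rot_two_mul_conj_starCorner (m := m) (r := r) k
  rw [show 2 - k = -k + 2 by ring] at h0
  rw [show 2 - (k + 1) = -k + 1 by ring] at h1
  rw [show 2 - (k + 2) = -k by ring] at h2
  have h3 : (rot m 2 : ℂ) * rot m (-2) = 1 := by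
    rw [← Circle.coe_mul, ← rot_add]; simp [rot_zero]
  simp only [IsometryEquiv.trans_apply, oppositeIso_apply, directIso_apply, corner, map_add,
    map_mul, Complex.real_smul, Complex.conj_ofReal, Complex.conj_conj, conj_rot, zero_add]
  linear_combination hp + (j : ℂ) * (h0 + h1) + (l : ℂ) * (h1 + h2) + rot m (-k) * z * h3

lemma reflection_image_stdHexagon :
    oppositeIso (rot m 2) 0 '' region (stdHexagon m r) = region (stdHexagon m r) := by
  rw [← region_movePolygon, region, region]
  congr 1
  have h : (movePolygon (oppositeIso (rot m 2) 0) (stdHexagon m r)).vertices =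
      (stdHexagon m r).vertices ∘ fun q : Fin 6 => -q := by
    have h0 := rot_two_mul_conj_edgeVec (m := m) (r := r) 0
    have h1 := rot_two_mul_conj_edgeVec (m := m) (r := r) 1
    have h2 := rot_two_mul_conj_edgeVec (m := m) (r := r) 2
    norm_num at h0 h1 h2
    have n1 : -(1 : Fin 6) = 5 := rfl
    have n2 : -(2 : Fin 6) = 4 := rfl
    have n3 : -(3 : Fin 6) = 3 := rfl
    have n4 : -(4 : Fin 6) = 2 := rfl
    have n5 : -(5 : Fin 6) = 1 := rfl
    funext q
    fin_cases q <;> simp [movePolygon, stdHexagon, tile, zonogon, mul_add, h0, h1, h2,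
      n1, n2, n3, n4, n5] <;> ring
  rw [h]
  exact (Equiv.neg (Fin 6)).surjective.range_comp _

lemma reflection_mem_symmetries_star : oppositeIso (rot m 2) 0 ∈
    symmetries (copies (fanPlacements m r (starCorner m r)) (stdHexagon m r)) :=
  mem_symmetries_of_conj (oppositeIso_oppositeIso _) (fun _ => conj_mem_fanPlacements_star)
    reflection_image_stdHexagon

lemma add_of_isBisection (hm : 5 ≤ m) (hr : 0 < r) (hb : IsBisection (stdHexagon m r) i x y) :
    x + y = edgeVec m r 0 + edgeVec m r 1 + edgeVec m r 2 := by
  obtain ⟨v', a', b', c', t, -, -, -, -, h1, -, h2, h3, -, -⟩ :=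
    IsBisection.exists_pentagon (turning_edgeVec (m := m) hm hr 0) hb
  rw [h2, h3]
  norm_num at h1
  linear_combination h1

/-- The reflection interchanges the ends of a cut through the midpoints of the edges between the
vertices `1`, `2` and `4`, `5`. -/
lemma reflection_apply_midpoint (hm : 5 ≤ m) (hr : 0 < r)
    (hb : IsBisection (stdHexagon m r) i x y)
    (hx : x = midpoint ℝ (stdHexagon m r 1) (stdHexagon m r 2) ∨
      x = midpoint ℝ (stdHexagon m r 4) (stdHexagon m r 5)) :
    rot m 2 * conj x = y := by
  have hxy := add_of_isBisection hm hr hb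
  have h0 := rot_two_mul_conj_edgeVec (m := m) (r := r) 0
  have h1 := rot_two_mul_conj_edgeVec (m := m) (r := r) 1
  have h2 := rot_two_mul_conj_edgeVec (m := m) (r := r) 2
  norm_num at h0 h1 h2
  rw [← eq_sub_iff_add_eq'] at hxy
  rw [hxy]
  rcases hx with rfl | rfl <;>
  · simp [midpoint_eq_smul_add, stdHexagon, tile, zonogon, mul_add, mul_left_comm (rot m 2 : ℂ),
      h0, h1, h2, map_ofNat (starRingEnd ℂ) 2]
    ring

/-- A reflection that interchanges the ends of the cut preserves the sides of the cut. -/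
lemma reflection_image_half {z : ℂ} (h1 : rot m 2 * conj x = y) :
    cross (x - y) (rot m 2 * conj z - x) = cross (x - y) (z - x) := by
  have h2 : rot m 2 * conj y = x := by
    have := oppositeIso_oppositeIso (rot m 2) x
    simpa [oppositeIso_apply, h1] using this
  have h3 : x - y = -(rot m 2 * conj (x - y)) := by rw [map_sub, mul_sub, h1, h2]; ring
  have h4 : rot m 2 * conj z - x = rot m 2 * conj (z - x) - (x - y) := by
    rw [map_sub, mul_sub, h1]; ring
  rw [h4, cross_sub_right, cross_self, sub_zero]
  conv_lhs => rw [h3]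
  rw [cross_neg_left, cross_mul_mul, cross_conj_conj, Circle.norm_coe]
  ring

lemma reflection_mem_symmetries_bisected (hm : 5 ≤ m) (hr : 0 < r)
    (hb : IsBisection (stdHexagon m r) i x y)
    (hx : x = midpoint ℝ (stdHexagon m r 1) (stdHexagon m r 2) ∨
      x = midpoint ℝ (stdHexagon m r 4) (stdHexagon m r 5)) :
    oppositeIso (rot m 2) 0 ∈
      symmetries (bisectedPattern (fanPlacements m r (starCorner m r)) (stdHexagon m r) i x y) := by
  have h1 := reflection_apply_midpoint hm hr hb hx
  obtain ⟨-, -, e1, e2⟩ := stdHexagon_halves hm hr hb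
  have key : ∀ S : Set ℝ, oppositeIso (rot m 2) 0 '' (region (stdHexagon m r) ∩
      {z | cross (x - y) (z - x) ∈ S}) =
      region (stdHexagon m r) ∩ {z | cross (x - y) (z - x) ∈ S} := by
    intro S
    have hsub : oppositeIso (rot m 2) 0 '' (region (stdHexagon m r) ∩
        {z | cross (x - y) (z - x) ∈ S}) ⊆
        region (stdHexagon m r) ∩ {z | cross (x - y) (z - x) ∈ S} := by
      rintro _ ⟨z, ⟨hz, hz'⟩, rfl⟩
      refine ⟨?_, ?_⟩
      · rw [← reflection_image_stdHexagon]; exact ⟨z, hz, rfl⟩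
      · rw [mem_ofPred_eq, oppositeIso_apply, zero_add, reflection_image_half h1]
        exact hz'
    exact hsub.antisymm fun z hz =>
      ⟨_, hsub ⟨z, hz, rfl⟩, oppositeIso_oppositeIso _ z⟩
  refine union_mem_symmetries
    (mem_symmetries_of_conj (oppositeIso_oppositeIso _) (fun _ => conj_mem_fanPlacements_star) ?_)
    (mem_symmetries_of_conj (oppositeIso_oppositeIso _) (fun _ => conj_mem_fanPlacements_star) ?_)
  · rw [e1]; exact key (Ici 0)
  · rw [e2]; exact key (Iic 0)

/-- If the reflection is a symmetry of the bisected tiling, the cut joins midpoints: it has to be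
parallel or perpendicular to the axis of the reflection, and only the cuts that are perpendicular
to it can meet opposite edges at interior points. -/
lemma midpoint_of_reflection_mem (hm : 5 ≤ m) (hme : Even m) (hr : 0 < r)
    (hb : IsBisection (stdHexagon m r) i x y) (hσ : oppositeIso (rot m 2) 0 ∈
      symmetries (bisectedPattern (fanPlacements m r (starCorner m r)) (stdHexagon m r) i x y)) :
    x = midpoint ℝ (stdHexagon m r 1) (stdHexagon m r 2) ∨
      x = midpoint ℝ (stdHexagon m r 4) (stdHexagon m r 5) := by
  have h0 := rot_two_mul_conj_edgeVec (m := m) (r := r) 0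
  have h1 := rot_two_mul_conj_edgeVec (m := m) (r := r) 1
  have h2 := rot_two_mul_conj_edgeVec (m := m) (r := r) 2
  norm_num at h0 h1 h2
  have ho : hexagonCenter (stdHexagon m r) =
      (1 / 2 : ℝ) • (edgeVec m r 0 + edgeVec m r 1 + edgeVec m r 2) := by
    rw [stdHexagon, tile, hexagonCenter_zonogon]; norm_num
  have hc := (isFan_starCorner hm hme hr).cross_direction_eq_zero hm hr hb hσ ⟨0, 0, 0, rfl⟩
    ⟨0, 0, 0, rfl⟩ (s := rot m 2) (by
      intro z
      simp [ho, corner, starCorner, rot_zero, map_ofNat (starRingEnd ℂ) 2]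
      linear_combination (1 / 2 : ℂ) * (h0 + h1 + h2))
  have hxy := add_of_isBisection hm hr hb
  obtain ⟨t1, t2, t3⟩ := turning_edgeVec (m := m) (r := r) hm hr 0
  norm_num at t1 t2 t3
  have hs : cross (edgeVec m r 1) (edgeVec m r 2) = cross (edgeVec m r 0) (edgeVec m r 1) := by
    rw [cross_edgeVec, cross_edgeVec]; norm_num
  -- the condition in terms of the coefficients of the direction of the cut
  have key : ∀ α β γ : ℝ, x - y = α • edgeVec m r 0 + β • edgeVec m r 1 + γ • edgeVec m r 2 →
      (α - γ) * ((α + γ) * cross (edgeVec m r 0) (edgeVec m r 2) +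
        2 * β * cross (edgeVec m r 0) (edgeVec m r 1)) = 0 := by
    intro α β γ h
    have h' : rot m 2 * conj (x - y) =
        γ • edgeVec m r 0 + β • edgeVec m r 1 + α • edgeVec m r 2 := by
      rw [h]
      simp only [map_add, Complex.real_smul, map_mul, Complex.conj_ofReal]
      linear_combination (α : ℂ) * h0 + (β : ℂ) * h1 + (γ : ℂ) * h2
    rw [h', h] at hc
    simp only [cross_add_left, cross_add_right, cross_smul_left, cross_smul_right, cross_self,
      hs, cross_swap (edgeVec m r 1) (edgeVec m r 0), cross_swap (edgeVec m r 2) (edgeVec m r 0),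
      cross_swap (edgeVec m r 2) (edgeVec m r 1)] at hc
    linarith
  have hd : x - y = (2 : ℝ) • x - (edgeVec m r 0 + edgeVec m r 1 + edgeVec m r 2) := by
    rw [← hxy, two_smul]; ring
  set s1 := cross (edgeVec m r 0) (edgeVec m r 1)
  set s2 := cross (edgeVec m r 0) (edgeVec m r 2)
  obtain ⟨s, t, hs0, ht0, hst, hx⟩ := hb.1
  obtain rfl : s = 1 - t := by linarith
  have hcase : ∀ α β γ : ℝ, 0 < α - γ → (0 < (α + γ) * s2 + 2 * β * s1 ∨
      (α + γ) * s2 + 2 * β * s1 < 0) →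
      x - y ≠ α • edgeVec m r 0 + β • edgeVec m r 1 + γ • edgeVec m r 2 := by
    intro α β γ h1 h2 h
    rcases mul_eq_zero.1 (key α β γ h) with h | h
    · linarith
    · rcases h2 with h2 | h2 <;> linarith
  have hcase' : ∀ α β γ : ℝ, α - γ < 0 → (0 < (α + γ) * s2 + 2 * β * s1 ∨
      (α + γ) * s2 + 2 * β * s1 < 0) →
      x - y ≠ α • edgeVec m r 0 + β • edgeVec m r 1 + γ • edgeVec m r 2 := by
    intro α β γ h1 h2 h
    rcases mul_eq_zero.1 (key α β γ h) with h | h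
    · linarith
    · rcases h2 with h2 | h2 <;> linarith
  have hmid : ∀ z w : ℂ, (1 - 1 / 2 : ℝ) • z + (1 / 2 : ℝ) • w = midpoint ℝ z w := by
    intro z w
    rw [midpoint_eq_smul_add]
    norm_num
  have ht1 : 0 < (1 - t) * s2 := mul_pos hs0 t3
  have ht2 : 0 < t * s2 := mul_pos ht0 t3
  fin_cases i
  · refine (hcase (2 * t - 1) (-1) (-1) (by linarith) (Or.inr (by linarith)) ?_).elim
    rw [hd, ← hx]; simp [stdHexagon, tile, zonogon]; ring
  · have := key 1 (2 * t - 1) (-1) (by rw [hd, ← hx]; simp [stdHexagon, tile, zonogon]; ring)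
    have ht : t = 1 / 2 := by
      have h3 : (2 * t - 1) * s1 = 0 := by linarith
      linarith [(mul_eq_zero.1 h3).resolve_right t1.ne']
    left
    rw [← hx, ht]
    exact hmid _ _
  · refine (hcase 1 1 (2 * t - 1) (by linarith) (Or.inl (by linarith)) ?_).elim
    rw [hd, ← hx]; simp [stdHexagon, tile, zonogon]; ring
  · refine (hcase' (1 - 2 * t) 1 1 (by linarith) (Or.inl (by linarith)) ?_).elim
    rw [hd, ← hx]; simp [stdHexagon, tile, zonogon]; ring
  · have := key (-1) (1 - 2 * t) 1 (by rw [hd, ← hx]; simp [stdHexagon, tile, zonogon]; ring)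
    have ht : t = 1 / 2 := by
      have h3 : (2 * t - 1) * s1 = 0 := by linarith
      linarith [(mul_eq_zero.1 h3).resolve_right t1.ne']
    right
    rw [← hx, ht]
    exact hmid _ _
  · refine (hcase' (-1) (-1) (1 - 2 * t) (by linarith) (Or.inr (by linarith)) ?_).elim
    rw [hd, ← hx]; simp [stdHexagon, tile, zonogon]; ring

end Star

/-! ### Point groups of the fan around a point -/

section PointGroup

variable {m : ℕ} {r : ℝ} {i : Fin 6} {x y : ℂ}

lemma star_edge_not_mem_openPart (hm : 5 ≤ m) (hme : Even m) (hr : 0 < r) :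
    ∀ z ∈ segment ℝ 0 (edgeVec m r 0),
      z ∉ openPart (copies (fanPlacements m r (starCorner m r)) (stdHexagon m r)) := by
  intro z hz
  have hccw := tile_isCCW (r := r) hm hr 0 (corner m r (starCorner m r) 0 0 0)
  have hz' : z ∈ segment ℝ (fanTile m r (starCorner m r) 0 0 0 0)
      (fanTile m r (starCorner m r) 0 0 0 (finRotate 6 0)) := by
    convert hz using 2 <;> simp [fanTile, tile, zonogon, corner, starCorner]
  exact not_mem_openPart ((isFan_starCorner hm hme hr).tiles hm hr)
    (mem_copies_fanPlacements.2 ⟨0, 0, 0, rfl⟩)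
    (hccw.closure_interior (by norm_num)) (segment_subset_region _ _ _ hz')
    (hccw.not_mem_interior_of_mem_segment (by norm_num) hz')

/-- Every unit vector is the direction of an edge at `0`, or strictly inside one of the angles
between two such edges. -/
lemma eq_rot_or_mem_cone (hm : 5 ≤ m) (hr : 0 < r) (u : Circle) :
    ∃ k : ℤ, u = rot m (2 * k) ∨
      (0 < cross (edgeVec m r (2 * k)) u ∧ 0 < cross u (edgeVec m r (2 * k + 2))) := by
  set θ : ℝ := 2 * Real.pi / m with hθ
  have hm' : (5 : ℝ) ≤ m := by exact_mod_cast hm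
  have hπ := Real.pi_pos
  have hθ0 : 0 < θ := by positivity
  have hθπ : 2 * θ < Real.pi := by
    rw [hθ, ← mul_div_assoc, div_lt_iff₀ (by linarith)]; nlinarith
  obtain ⟨φ, rfl⟩ : ∃ φ : ℝ, u = Circle.exp φ := ⟨_, (Circle.exp_arg u).symm⟩
  have hrot : ∀ k : ℤ, rot m k = Circle.exp (k * θ) := by
    intro k; rw [rot]; congr 1; rw [hθ]; ring
  set k := ⌊φ / (2 * θ)⌋
  have h1 : k * (2 * θ) ≤ φ := (le_div_iff₀ (by positivity)).1 (Int.floor_le _)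
  have h2 : φ < (k + 1) * (2 * θ) := (div_lt_iff₀ (by positivity)).1 (Int.lt_floor_add_one _)
  refine ⟨k, ?_⟩
  have hc : ∀ α β : ℝ, cross (Circle.exp α) (Circle.exp β) = Real.sin (β - α) := by
    intro α β
    rw [cross, ← Circle.coe_inv_eq_conj, ← Circle.coe_mul, ← Circle.exp_neg, ← Circle.exp_add,
      Circle.coe_exp, Complex.exp_ofReal_mul_I_im]
    congr 1; ring
  rcases h1.eq_or_lt with h | h
  · left
    rw [hrot, ← h]; congr 1; push_cast; ring
  · right
    have e : ∀ q : ℤ, edgeVec m r q = r • (Circle.exp (q * θ) : ℂ) := by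
      intro q; rw [edgeVec, hrot, Complex.real_smul]
    rw [e, e, cross_smul_left, cross_smul_right, hc, hc]
    push_cast
    exact ⟨mul_pos hr (Real.sin_pos_of_pos_of_lt_pi (by linarith) (by linarith)),
      mul_pos hr (Real.sin_pos_of_pos_of_lt_pi (by linarith) (by linarith))⟩

/-- A symmetry that fixes `0` permutes the edges at `0`. -/
lemma eq_of_mem_symmetries_of_apply_zero (hm : 5 ≤ m) (hr : 0 < r) {n : ℕ} {T : Set (Polygon ℂ n)}
    (h1 : ∀ z ∈ segment ℝ 0 (edgeVec m r 0), z ∉ openPart T)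
    (h2 : ∀ k j l q, ∀ᶠ z in 𝓝 (fanTile m r (starCorner m r) k j l q),
      z ∈ interior (region (fanTile m r (starCorner m r) k j l)) → z ∈ openPart T)
    {g : ℂ ≃ᵢ ℂ} (hg : g ∈ symmetries T) (h0 : g 0 = 0) :
    ∃ k : ℤ, g = directIso (rot m (2 * k)) 0 ∨ g = oppositeIso (rot m (2 * k)) 0 := by
  obtain ⟨u, hu⟩ := eq_directIso_or_oppositeIso g
  rw [h0] at hu
  have hray : ∀ t : ℝ, g (t • edgeVec m r 0) = (t * r) • (u : ℂ) := by
    intro t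
    rcases hu with rfl | rfl <;> simp [edgeVec_zero] <;> ring
  obtain ⟨k, hk | ⟨hk1, hk2⟩⟩ := eq_rot_or_mem_cone (m := m) hm hr u
  · exact ⟨k, by rw [← hk]; exact hu⟩
  exfalso
  have hv0 : fanTile m r (starCorner m r) (2 * k) 0 0 0 = 0 := by
    simp [fanTile, tile, zonogon, corner, starCorner]
  have hint := (tile_isCCW (r := r) hm hr (2 * k)
    (corner m r (starCorner m r) (2 * k) 0 0)).eventually_mem_interior (by norm_num) 0
    (d := r • (u : ℂ)) (by
      have e : tile m r (2 * k) (corner m r (starCorner m r) (2 * k) 0 0) (finRotate 6 0) -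
          tile m r (2 * k) (corner m r (starCorner m r) (2 * k) 0 0) 0 = edgeVec m r (2 * k) := by
        simp [tile, zonogon]
      rw [e, cross_smul_right]; exact mul_pos hr hk1) (by
      have e : tile m r (2 * k) (corner m r (starCorner m r) (2 * k) 0 0) ((finRotate 6).symm 0) -
          tile m r (2 * k) (corner m r (starCorner m r) (2 * k) 0 0) 0 =
            edgeVec m r (2 * k + 2) := by
        rw [show (finRotate 6).symm 0 = 5 from rfl]
        simp [tile, zonogon]
      rw [e, cross_smul_left]; exact mul_pos hr hk2)
  have hlim : Tendsto (fun t : ℝ => (0 : ℂ) + t • (r • (u : ℂ))) (𝓝[>] 0) (𝓝 0) := by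
    have hc : Continuous fun t : ℝ => (0 : ℂ) + t • (r • (u : ℂ)) := by fun_prop
    have := hc.tendsto 0
    simp only [zero_smul, add_zero] at this
    exact this.mono_left nhdsWithin_le_nhds
  have h3 := h2 (2 * k) 0 0 0
  rw [hv0] at h3
  change ∀ᶠ t : ℝ in 𝓝[>] 0, fanTile m r (starCorner m r) (2 * k) 0 0 0 + t • (r • (u : ℂ)) ∈
    interior (region (fanTile m r (starCorner m r) (2 * k) 0 0)) at hint
  rw [hv0] at hint
  obtain ⟨t, ⟨ht1, ht2⟩, ht3, ht4⟩ := ((hint.and (hlim.eventually h3)).and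
    (Ioo_mem_nhdsGT (zero_lt_one' ℝ))).exists
  refine h1 (t • edgeVec m r 0) ⟨1 - t, t, by linarith, ht3.le, by ring, by simp⟩
    ((apply_mem_openPart_iff hg).1 ?_)
  rw [hray, mul_smul, ← zero_add (t • _)]
  exact ht2 ht1

section

variable {n N : ℕ} {T : Set (Polygon ℂ N)}

lemma pointGroup_eq_dihedral (hn : n ≠ 0) (hmn : m = 2 * n)
    (h : ∀ g ∈ symmetries T, g 0 = 0 →
      ∃ k : ℤ, g = directIso (rot m (2 * k)) 0 ∨ g = oppositeIso (rot m (2 * k)) 0)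
    (hrot : ∀ k : ℤ, directIso (rot m (2 * k)) 0 ∈ symmetries T)
    (hσ : oppositeIso (rot m 2) 0 ∈ symmetries T) :
    pointGroup T 0 = dihedralSymmetries n 0 (rot m 2) := by
  ext g
  rw [mem_dihedralSymmetries hn]
  simp only [rot_half hmn, ← rot_add]
  constructor
  · rintro ⟨hg, h0⟩
    obtain ⟨k, rfl | rfl⟩ := h g hg h0
    · exact Or.inl ⟨k, rfl⟩
    · exact Or.inr ⟨k - 1, by congr 2; ring⟩
  · rintro (⟨k, rfl⟩ | ⟨k, rfl⟩)
    · exact ⟨hrot k, by simp⟩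
    · refine ⟨?_, by simp⟩
      have := trans_mem_symmetries hσ (hrot k)
      convert this using 1
      ext1 z
      simp [rot_add]; ring

lemma pointGroup_eq_cyclic (hn : n ≠ 0) (hmn : m = 2 * n)
    (h : ∀ g ∈ symmetries T, g 0 = 0 →
      ∃ k : ℤ, g = directIso (rot m (2 * k)) 0 ∨ g = oppositeIso (rot m (2 * k)) 0)
    (hrot : ∀ k : ℤ, directIso (rot m (2 * k)) 0 ∈ symmetries T)
    (hσ : oppositeIso (rot m 2) 0 ∉ symmetries T) :
    pointGroup T 0 = cyclicSymmetries n 0 := by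
  ext g
  rw [mem_cyclicSymmetries hn]
  simp only [rot_half hmn]
  constructor
  · rintro ⟨hg, h0⟩
    obtain ⟨k, rfl | rfl⟩ := h g hg h0
    · exact ⟨k, rfl⟩
    · refine (hσ ?_).elim
      have := trans_mem_symmetries hg (hrot (1 - k))
      convert this using 1
      ext1 z
      have e : (rot m 2 : ℂ) = rot m (2 * (1 - k)) * rot m (2 * k) := by
        rw [← Circle.coe_mul, ← rot_add]; congr 2; ring
      simp only [IsometryEquiv.trans_apply, oppositeIso_apply, directIso_apply, e]
      ring
  · rintro ⟨k, rfl⟩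
    exact ⟨hrot k, by simp⟩

end

theorem pointGroup_star {n : ℕ} (hm : 5 ≤ m) (hmn : m = 2 * n) (hr : 0 < r) :
    pointGroup (copies (fanPlacements m r (starCorner m r)) (stdHexagon m r)) 0 =
      dihedralSymmetries n 0 (rot m 2) := by
  have hme : Even m := ⟨n, by omega⟩
  refine pointGroup_eq_dihedral (by omega) hmn (fun g hg h0 => ?_)
    (fun k => directIso_mem_symmetries (starCorner_add (even_two_mul k)) _)
    reflection_mem_symmetries_star
  refine eq_of_mem_symmetries_of_apply_zero hm hr (star_edge_not_mem_openPart hm hme hr) ?_ hg h0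
  intro k j l q
  exact Eventually.of_forall fun z hz =>
    mem_openPart.2 ⟨_, mem_copies_fanPlacements.2 ⟨k, j, l, rfl⟩, hz⟩

lemma eq_of_mem_symmetries_bisected (hm : 5 ≤ m) (hme : Even m) (hr : 0 < r)
    (hb : IsBisection (stdHexagon m r) i x y) {g : ℂ ≃ᵢ ℂ} (hg : g ∈
      symmetries (bisectedPattern (fanPlacements m r (starCorner m r)) (stdHexagon m r) i x y))
    (h0 : g 0 = 0) :
    ∃ k : ℤ, g = directIso (rot m (2 * k)) 0 ∨ g = oppositeIso (rot m (2 * k)) 0 :=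
  eq_of_mem_symmetries_of_apply_zero hm hr (fun z hz h =>
      star_edge_not_mem_openPart hm hme hr z hz (openPart_bisected_subset hm hr hb h))
    ((isFan_starCorner hm hme hr).eventually_mem_openPart hm hr hb) hg h0

theorem pointGroup_star_bisected_of_midpoint {n : ℕ} (hm : 5 ≤ m) (hmn : m = 2 * n) (hr : 0 < r)
    (hb : IsBisection (stdHexagon m r) i x y)
    (hx : x = midpoint ℝ (stdHexagon m r 1) (stdHexagon m r 2) ∨
      x = midpoint ℝ (stdHexagon m r 4) (stdHexagon m r 5)) :
    pointGroup (bisectedPattern (fanPlacements m r (starCorner m r)) (stdHexagon m r) i x y) 0 =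
      dihedralSymmetries n 0 (rot m 2) :=
  pointGroup_eq_dihedral (by omega) hmn
    (fun _ hg h0 => eq_of_mem_symmetries_bisected hm ⟨n, by omega⟩ hr hb hg h0)
    (fun k => directIso_mem_symmetries_bisected (starCorner_add (even_two_mul k)))
    (reflection_mem_symmetries_bisected hm hr hb hx)

theorem pointGroup_star_bisected_of_ne_midpoint {n : ℕ} (hm : 5 ≤ m) (hmn : m = 2 * n)
    (hr : 0 < r) (hb : IsBisection (stdHexagon m r) i x y)
    (hx : ¬ (x = midpoint ℝ (stdHexagon m r 1) (stdHexagon m r 2) ∨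
      x = midpoint ℝ (stdHexagon m r 4) (stdHexagon m r 5))) :
    pointGroup (bisectedPattern (fanPlacements m r (starCorner m r)) (stdHexagon m r) i x y) 0 =
      cyclicSymmetries n 0 :=
  pointGroup_eq_cyclic (by omega) hmn
    (fun _ hg h0 => eq_of_mem_symmetries_bisected hm ⟨n, by omega⟩ hr hb hg h0)
    (fun k => directIso_mem_symmetries_bisected (starCorner_add (even_two_mul k)))
    fun hσ => hx (midpoint_of_reflection_mem hm ⟨n, by omega⟩ hr hb hσ)

/-! ### The full symmetry group of the fan around a point -/

lemma IsCCW.injective {n : ℕ} {P : Polygon ℂ n} (h : IsCCW P) (hn : 3 ≤ n) :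
    Function.Injective P.vertices := by
  intro a b hab
  by_contra hne
  by_cases hb : b = finRotate n a
  · subst hb
    exact h.edge_ne_zero hn a (sub_eq_zero.2 hab.symm)
  · have h1 := h a b (Ne.symm hne) hb
    have h2 : P a = P b := hab
    rw [← h2, sub_self, cross_zero_right] at h1
    exact lt_irrefl _ h1

/-- The inequality behind the diameter of the hexagon: for `C` and `S` the cosine and sine of the angle
between consecutive edge directions, the right-hand side is the squared length of a difference of
two points of the hexagon of edge length `1` whose coefficients differ by `α, β, γ`. The condition
on `C` holds from `m = 7` on. -/
lemma coeffs_eq_of_le {α β γ C S : ℝ} (hα : |α| ≤ 1) (hβ : |β| ≤ 1) (hγ : |γ| ≤ 1)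
    (hC : 1 / 2 < C) (hCS : S ^ 2 + C ^ 2 = 1)
    (h : (1 + 2 * C) ^ 2 ≤ (β + (α + γ) * C) ^ 2 + ((γ - α) * S) ^ 2) :
    (α = 1 ∧ β = 1 ∧ γ = 1) ∨ (α = -1 ∧ β = -1 ∧ γ = -1) := by
  have key : ∀ α β γ : ℝ, |α| ≤ 1 → |β| ≤ 1 → |γ| ≤ 1 →
      (1 + 2 * C) ^ 2 ≤ (β + (α + γ) * C) ^ 2 + ((γ - α) * S) ^ 2 → 0 ≤ α + γ →
      α = 1 ∧ β = 1 ∧ γ = 1 := by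
    intro α β γ hα hβ hγ h hP
    obtain ⟨a1, a2⟩ := abs_le.1 hα
    obtain ⟨b1, b2⟩ := abs_le.1 hβ
    obtain ⟨c1, c2⟩ := abs_le.1 hγ
    set P := (α + γ) / 2 with hPdef
    have hP0 : 0 ≤ P := by linarith
    have hP1 : P ≤ 1 := by linarith
    have e1 : (γ - α) ^ 2 ≤ (2 * (1 - P)) ^ 2 := sq_le_sq' (by linarith) (by linarith)
    have hPC : 0 ≤ P * C := mul_nonneg hP0 (by linarith)
    have e2 : (β + (α + γ) * C) ^ 2 ≤ (1 + 2 * (P * C)) ^ 2 := by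
      have : (α + γ) * C = 2 * (P * C) := by rw [hPdef]; ring
      rw [this]
      exact sq_le_sq' (by linarith) (by linarith)
    have e3 : ((γ - α) * S) ^ 2 ≤ (2 * (1 - P)) ^ 2 * (1 - C ^ 2) := by
      rw [mul_pow]
      have : S ^ 2 = 1 - C ^ 2 := by linarith
      rw [this]
      have : 0 ≤ 1 - C ^ 2 := by nlinarith [sq_nonneg S]
      gcongr
    have e4 : (1 - P) * (C + C ^ 2 * (1 + P) - (1 - P) * (1 - C ^ 2)) ≤ 0 := by nlinarith
    have e5 : 0 < C + C ^ 2 * (1 + P) - (1 - P) * (1 - C ^ 2) := by nlinarith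
    have hP' : P = 1 := by
      by_contra hne
      have : 0 < 1 - P := by
        rcases hP1.eq_or_lt with h | h
        · exact (hne h).elim
        · linarith
      have := mul_pos this e5
      linarith
    have hα1 : α = 1 := by linarith
    have hγ1 : γ = 1 := by linarith
    refine ⟨hα1, ?_, hγ1⟩
    rw [hα1, hγ1] at h
    have h' : (1 + 2 * C) ^ 2 ≤ (β + 2 * C) ^ 2 := by linarith
    have := abs_le_of_sq_le_sq' h' (by linarith)
    linarith
  rcases le_total 0 (α + γ) with hP | hP
  · exact Or.inl (key α β γ hα hβ hγ h hP)
  · obtain ⟨h1, h2, h3⟩ := key (-α) (-β) (-γ) (by rwa [abs_neg]) (by rwa [abs_neg])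
      (by rwa [abs_neg]) (by nlinarith) (by linarith)
    exact Or.inr ⟨by linarith, by linarith, by linarith⟩

lemma norm_combination_sq (k : ℤ) (α β γ : ℝ) :
    ‖α • edgeVec m r k + β • edgeVec m r (k + 1) + γ • edgeVec m r (k + 2)‖ ^ 2 =
      r ^ 2 * ((β + (α + γ) * Real.cos (2 * Real.pi / m)) ^ 2 +
        ((γ - α) * Real.sin (2 * Real.pi / m)) ^ 2) := by
  have h : α • edgeVec m r k + β • edgeVec m r (k + 1) + γ • edgeVec m r (k + 2) =
      edgeVec m r (k + 1) * (α * rot m (-1) + β + γ * rot m 1) := by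
    have h1 : edgeVec m r (k + 2) = edgeVec m r (k + 1) * rot m 1 := by
      rw [mul_comm, rot_mul_edgeVec]; congr 1; ring
    have h2 : edgeVec m r k = edgeVec m r (k + 1) * rot m (-1) := by
      rw [mul_comm, rot_mul_edgeVec]; congr 1; ring
    rw [h1, h2]; simp only [Complex.real_smul]; ring
  have hn : ‖edgeVec m r (k + 1)‖ ^ 2 = r ^ 2 := by
    rw [edgeVec, norm_mul, Circle.norm_coe, Complex.norm_real, mul_one, Real.norm_eq_abs, sq_abs]
  rw [h, norm_mul, mul_pow, hn, ← Complex.normSq_eq_norm_sq, Complex.normSq_apply]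
  simp only [Complex.add_re, Complex.add_im, Complex.re_ofReal_mul, Complex.im_ofReal_mul,
    Complex.ofReal_re, Complex.ofReal_im, rot_re, rot_im, Int.cast_neg, Int.cast_one, neg_mul,
    one_mul, Real.cos_neg, Real.sin_neg]
  ring

lemma half_lt_cos (hm : 7 ≤ m) : 1 / 2 < Real.cos (2 * Real.pi / m) := by
  have hm' : (7 : ℝ) ≤ m := by exact_mod_cast hm
  rw [← Real.cos_pi_div_three]
  refine Real.cos_lt_cos_of_nonneg_of_le_pi_div_two (by positivity)
    (by linarith [Real.pi_pos]) ?_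
  rw [div_lt_div_iff₀ (by linarith) (by norm_num)]
  nlinarith [Real.pi_pos]

/-- The diameter of the hexagon is attained only by the diagonal from vertex `0` to vertex `3`. -/
lemma eq_vertex_of_le_dist (hm : 7 ≤ m) (hr : 0 < r) {k : ℤ} {v z z' : ℂ}
    (hz : z ∈ region (tile m r k v)) (hz' : z' ∈ region (tile m r k v))
    (h : r * (1 + 2 * Real.cos (2 * Real.pi / m)) ≤ dist z z') :
    z = tile m r k v 0 ∨ z = tile m r k v 3 := by
  obtain ⟨α, β, γ, a1, a2, b1, b2, c1, c2, rfl⟩ := exists_coeffs hz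
  obtain ⟨α', β', γ', a1', a2', b1', b2', c1', c2', rfl⟩ := exists_coeffs hz'
  have hC := half_lt_cos hm
  have h1 : (r * (1 + 2 * Real.cos (2 * Real.pi / m))) ^ 2 ≤
      ‖(α - α') • edgeVec m r k + (β - β') • edgeVec m r (k + 1) +
        (γ - γ') • edgeVec m r (k + 2)‖ ^ 2 := by
    have : 0 ≤ r * (1 + 2 * Real.cos (2 * Real.pi / m)) := mul_nonneg hr.le (by linarith)
    refine pow_le_pow_left₀ this (h.trans_eq ?_) 2
    rw [dist_eq_norm]
    congr 1
    simp only [sub_smul]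
    ring
  rw [norm_combination_sq, mul_pow] at h1
  have h2 := le_of_mul_le_mul_left h1 (by positivity)
  rcases coeffs_eq_of_le (abs_le.2 ⟨by linarith, by linarith⟩) (abs_le.2 ⟨by linarith, by linarith⟩)
    (abs_le.2 ⟨by linarith, by linarith⟩) hC (Real.sin_sq_add_cos_sq _) h2 with
    ⟨e1, e2, e3⟩ | ⟨e1, e2, e3⟩
  · right
    rw [show α = 1 by linarith, show β = 1 by linarith, show γ = 1 by linarith]
    simp [tile, zonogon]
  · left
    rw [show α = 0 by linarith, show β = 0 by linarith, show γ = 0 by linarith]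
    simp [tile, zonogon]

/-- Every tile that contains `0` has a point at the distance of the diameter from it. -/
lemma exists_dist_of_zero_mem (hm : 5 ≤ m) (hr : 0 < r) {P : Polygon ℂ 6}
    (hP : P ∈ copies (fanPlacements m r (starCorner m r)) (stdHexagon m r)) (h : 0 ∈ region P) :
    ∃ z ∈ region P, r * (1 + 2 * Real.cos (2 * Real.pi / m)) ≤ dist 0 z := by
  obtain ⟨k, j, l, rfl⟩ := mem_copies_fanPlacements.1 hP
  have h1 := add_mul_le_of_mem_fanTile hm h
  have hj : (0 : ℝ) ≤ j := Nat.cast_nonneg j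
  have hl : (0 : ℝ) ≤ l := Nat.cast_nonneg l
  have hr2 : 0 < r ^ 2 := by positivity
  rcases Int.even_or_odd k with hk | hk
  · rw [starCorner_of_even hk, sub_self, cross_zero_right] at h1
    have h2 : (j : ℝ) + l ≤ 0 := by
      by_contra! h3
      nlinarith [mul_pos h3 hr2]
    have hj0 : j = 0 := by exact_mod_cast (by linarith : (j : ℝ) = 0)
    have hl0 : l = 0 := by exact_mod_cast (by linarith : (l : ℝ) = 0)
    subst hj0 hl0
    refine ⟨_, vertex_mem_region _ 3, ?_⟩
    have hc := cos_pos_of_five_le hm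
    refine abs_le_of_sq_le_sq' ?_ dist_nonneg |>.2
    have e : fanTile m r (starCorner m r) k 0 0 3 = (1 : ℝ) • edgeVec m r k +
        (1 : ℝ) • edgeVec m r (k + 1) + (1 : ℝ) • edgeVec m r (k + 2) := by
      simp [fanTile, tile, zonogon, corner, starCorner_of_even hk]
    rw [dist_zero_left, e, norm_combination_sq]
    apply le_of_eq; ring
  · rw [starCorner_of_odd hk, zero_sub, cross_neg_right, cross_neg_I_edgeVec_self] at h1
    nlinarith [mul_nonneg (add_nonneg hj hl) hr2.le]

/-- A vertex other than `0` that ends the long diagonal of one tile is a vertex of another tile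
whose long diagonal does not end there. -/
lemma exists_eq_other_vertex {k : ℤ} {j l : ℕ} {q : ℂ}
    (hq : q = fanTile m r (starCorner m r) k j l 0 ∨ q = fanTile m r (starCorner m r) k j l 3)
    (h0 : q ≠ 0) :
    ∃ k' j' l' s, s ≠ 0 ∧ s ≠ 3 ∧ q = fanTile m r (starCorner m r) k' j' l' s := by
  rcases hq with rfl | rfl
  · rcases j with _ | j
    · rcases l with _ | l
      · rcases Int.even_or_odd k with hk | hk
        · exact (h0 (by simp [fanTile, tile, zonogon, corner, starCorner_of_even hk])).elim
        · refine ⟨k - 1, 0, 0, 5, by decide, by decide, ?_⟩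
          have hk1 : Even (k - 1) := hk.sub_odd odd_one
          have e : k - 1 + 2 = k + 1 := by ring
          simp [fanTile, tile, zonogon, corner, starCorner_of_odd hk, starCorner_of_even hk1, e]
      · refine ⟨k, 0, l, 4, by decide, by decide, ?_⟩
        simp [fanTile, tile, zonogon, corner]; ring
    · refine ⟨k, j, l, 2, by decide, by decide, ?_⟩
      simp [fanTile, tile, zonogon, corner]; ring
  · refine ⟨k, j + 1, l, 5, by decide, by decide, ?_⟩
    simp [fanTile, tile, zonogon, corner]; ring

/-- For `m ≥ 7` every symmetry fixes `0`, the only vertex at which the long diagonals of all the tiles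
around it end. -/
lemma apply_zero_of_mem_symmetries (hm : 7 ≤ m) (hme : Even m) (hr : 0 < r) {g : ℂ ≃ᵢ ℂ}
    (hg : g ∈ symmetries (copies (fanPlacements m r (starCorner m r)) (stdHexagon m r))) :
    g 0 = 0 := by
  by_contra h0
  have hm5 : 5 ≤ m := by omega
  have htiles := (isFan_starCorner hm5 hme hr).tiles hm5 hr
  obtain ⟨-, hg2⟩ := mem_symmetries_iff.1 hg
  have key : ∀ k j l, g 0 ∈ region (fanTile m r (starCorner m r) k j l) →
      g 0 = fanTile m r (starCorner m r) k j l 0 ∨ g 0 = fanTile m r (starCorner m r) k j l 3 := by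
    intro k j l h
    obtain ⟨P, hP, e⟩ := hg2 _ (mem_copies_fanPlacements.2 ⟨k, j, l, rfl⟩)
    have hP0 : 0 ∈ region P := by
      rw [← e] at h
      obtain ⟨z, hz, hz'⟩ := h
      rwa [← g.injective hz']
    obtain ⟨z, hz, hd⟩ := exists_dist_of_zero_mem hm5 hr hP hP0
    rw [← g.isometry.dist_eq] at hd
    exact eq_vertex_of_le_dist hm hr h (by rw [fanTile] at e; rw [← e]; exact ⟨z, hz, rfl⟩) hd
  have hcov : g 0 ∈ fanUnion m r (starCorner m r) := by
    rw [fanUnion_starCorner hm5 hme hr]; trivial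
  obtain ⟨k, hk⟩ := mem_iUnion.1 hcov
  obtain ⟨⟨j, l⟩, hkjl⟩ := mem_iUnion.1 hk
  obtain ⟨k', j', l', s, hs0, hs3, e⟩ := exists_eq_other_vertex (key k j l hkjl) h0
  have hinj := (tile_isCCW hm5 hr k' (corner m r (starCorner m r) k' j' l')).injective (by norm_num)
  rcases key k' j' l' (by rw [e]; exact vertex_mem_region _ _) with h | h
  · exact hs0 (hinj (e.symm.trans h))
  · exact hs3 (hinj (e.symm.trans h))

theorem symmetries_star {n : ℕ} (hn : 4 ≤ n) (hmn : m = 2 * n) (hr : 0 < r) :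
    symmetries (copies (fanPlacements m r (starCorner m r)) (stdHexagon m r)) =
      dihedralSymmetries n 0 (rot m 2) := by
  rw [← pointGroup_star (by omega) hmn hr]
  ext g
  exact ⟨fun hg => ⟨hg, apply_zero_of_mem_symmetries (by omega) ⟨n, by omega⟩ hr hg⟩,
    fun hg => hg.1⟩

end PointGroup

/-! ### The hexagons with the prescribed angles -/

section Classification

variable {m : ℕ} {r : ℝ}

lemma polygon_ext {n : ℕ} {P Q : Polygon ℂ n} (h : ∀ i, P i = Q i) : P = Q := by
  cases P; cases Q
  congr 1
  exact funext h

lemma interiorAngle_eq {n : ℕ} (P : Polygon ℂ n) (i : Fin n) : interiorAngle P i =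
    InnerProductGeometry.angle (P ((finRotate n).symm i) - P i) (P (finRotate n i) - P i) := rfl

/-- Consecutive edge vectors of equal length are related by a rotation through the exterior angle `β`,
in the sense of rotation given by the sign `s`. -/
lemma eq_mul_exp_of_angle {z w : ℂ} {r β s : ℝ} (hr : 0 < r) (hz : ‖z‖ = r) (hw : ‖w‖ = r)
    (hs : s = 1 ∨ s = -1) (hpos : 0 < s * cross z w)
    (hangle : InnerProductGeometry.angle (-z) w = Real.pi - β) :
    w = z * Complex.exp ((s * β : ℝ) * Complex.I) := by
  rw [InnerProductGeometry.angle_neg_left] at hangle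
  have hβ : InnerProductGeometry.angle z w = β := by linarith
  have hs2 : s * s = 1 := by rcases hs with rfl | rfl <;> norm_num
  have hre : (conj z * w).re = r ^ 2 * Real.cos β := by
    have h := InnerProductGeometry.cos_angle_mul_norm_mul_norm z w
    rw [hβ, hz, hw, Complex.inner, mul_comm w] at h
    rw [← h]; ring
  have hsin : 0 ≤ Real.sin β := hβ ▸ InnerProductGeometry.sin_angle_nonneg z w
  have hsq : (conj z * w).re ^ 2 + (conj z * w).im ^ 2 = r ^ 2 * r ^ 2 := by
    have h : Complex.normSq (conj z * w) = r ^ 2 * r ^ 2 := by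
      rw [map_mul, Complex.normSq_conj, Complex.normSq_eq_norm_sq, Complex.normSq_eq_norm_sq,
        hz, hw]
    rw [← h, Complex.normSq_apply]; ring
  have him : (conj z * w).im = s * (r ^ 2 * Real.sin β) := by
    have h1 : (s * cross z w) ^ 2 = (r ^ 2 * Real.sin β) ^ 2 := by
      have h2 := Real.sin_sq_add_cos_sq β
      rw [hre] at hsq
      rw [cross]
      linear_combination (conj z * w).im ^ 2 * hs2 + hsq - r ^ 4 * h2
    have h3 := (sq_eq_sq₀ hpos.le (by positivity)).1 h1
    rw [← h3, ← mul_assoc, hs2, one_mul, cross]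
  have hmul : conj z * w = r ^ 2 * Complex.exp ((s * β : ℝ) * Complex.I) := by
    rw [← Complex.ofReal_pow]
    apply Complex.ext
    · rw [hre, Complex.re_ofReal_mul, Complex.exp_ofReal_mul_I_re]
      rcases hs with rfl | rfl <;> simp
    · rw [him, Complex.im_ofReal_mul, Complex.exp_ofReal_mul_I_im]
      rcases hs with rfl | rfl <;> simp
  have hzz : z * conj z = r ^ 2 := by rw [Complex.mul_conj', hz]
  have hr2 : (r : ℂ) ^ 2 ≠ 0 := pow_ne_zero _ (by exact_mod_cast hr.ne')
  apply mul_left_cancel₀ hr2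
  linear_combination (-w) * hzz + z * hmul

/-- Convexity, equal edges and the given angles determine a hexagon up to an isometry and its edge
length. -/
theorem TileCondition3.exists_eq_movePolygon {H : Polygon ℂ 6}
    (h : TileCondition3 m H) :
    ∃ (r : ℝ) (ψ : ℂ ≃ᵢ ℂ), 0 < r ∧ H = movePolygon ψ (stdHexagon m r) := by
  obtain ⟨⟨s, hs, hconv⟩, heq, hA, hB⟩ := h
  set r := dist (H 0) (H 1) with hrdef
  have hlen : ∀ i, ‖H (finRotate 6 i) - H i‖ = r := by
    intro i
    rw [← dist_eq_norm, dist_comm, heq i 0]; rfl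
  have hr : 0 < r := by
    rw [← hlen 0, norm_pos_iff]
    intro h0
    have := hconv 0 2 (by decide) (by decide)
    rw [h0] at this
    simp at this
  set θ : ℝ := 2 * Real.pi / m with hθ
  -- each edge is obtained from the preceding one by a turn through the exterior angle
  have hturn : ∀ (i : Fin 6) (β : ℝ), interiorAngle H (finRotate 6 i) = Real.pi - β →
      H (finRotate 6 (finRotate 6 i)) - H (finRotate 6 i) =
        (H (finRotate 6 i) - H i) * Complex.exp ((s * β : ℝ) * Complex.I) := by
    intro i β hβ
    refine eq_mul_exp_of_angle hr (hlen i) (hlen _) hs ?_ ?_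
    · have h1 := hconv (finRotate 6 i) i (finRotate_ne_self (by norm_num) i).symm
        (finRotate_finRotate_ne_self (by norm_num) i).symm
      have h2 : cross (H (finRotate 6 i) - H i)
          (H (finRotate 6 (finRotate 6 i)) - H (finRotate 6 i)) =
          cross (H (finRotate 6 (finRotate 6 i)) - H (finRotate 6 i)) (H i - H (finRotate 6 i)) := by
        rw [cross_swap, ← cross_neg_right, neg_sub]
      rw [h2]; exact h1
    · rw [interiorAngle, Equiv.symm_apply_apply] at hβ
      rw [neg_sub]; exact hβ
  obtain ⟨q, hq, hsq⟩ : ∃ q : ℤ, (q = 1 ∨ q = -1) ∧ s = q := by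
    rcases hs with h | h
    · exact ⟨1, Or.inl rfl, by rw [h]; norm_num⟩
    · exact ⟨-1, Or.inr rfl, by rw [h]; norm_num⟩
  have hexp1 : Complex.exp ((s * θ : ℝ) * Complex.I) = rot m q := by
    rw [coe_rot, hsq, hθ]; congr 1; push_cast; ring
  have hexp2 : Complex.exp ((s * (Real.pi - 2 * θ) : ℝ) * Complex.I) = -rot m (-2 * q) := by
    have hπ : Complex.exp (s * Real.pi * Complex.I) = -1 := by
      rcases hs with rfl | rfl
      · simp
      · rw [Complex.ofReal_neg, Complex.ofReal_one, neg_one_mul, neg_mul, Complex.exp_neg,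
          Complex.exp_pi_mul_I]; norm_num
    rw [coe_rot, neg_eq_neg_one_mul, ← hπ, ← Complex.exp_add, hsq, hθ]
    congr 1; push_cast; ring
  have e0 := hturn 0 θ (hB _ (by simp))
  have e1 := hturn 1 θ (hB _ (by simp))
  have e2 := hturn 2 (Real.pi - 2 * θ) (by rw [hA _ (by simp)]; rw [hθ]; ring)
  have e3 := hturn 3 θ (hB _ (by simp))
  have e4 := hturn 4 θ (hB _ (by simp))
  rw [hexp1] at e0 e1 e3 e4
  rw [hexp2] at e2
  change H 2 - H 1 = (H 1 - H 0) * rot m q at e0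
  change H 3 - H 2 = (H 2 - H 1) * rot m q at e1
  change H 4 - H 3 = (H 3 - H 2) * -rot m (-2 * q) at e2
  change H 5 - H 4 = (H 4 - H 3) * rot m q at e3
  change H 0 - H 5 = (H 5 - H 4) * rot m q at e4
  have hqq : (rot m q : ℂ) * rot m q * rot m (-2 * q) = 1 := by
    rw [← Circle.coe_mul, ← Circle.coe_mul, ← rot_add, ← rot_add,
      show q + q + -2 * q = 0 by ring, rot_zero, Circle.coe_one]
  have hr0 : (r : ℂ) ≠ 0 := by exact_mod_cast hr.ne'
  obtain ⟨u, hu⟩ : ∃ u : Circle, H 1 - H 0 = u * r := by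
    refine ⟨⟨(H 1 - H 0) / r, ?_⟩, ?_⟩
    · refine mem_sphere_zero_iff_norm.2 ?_
      rw [norm_div, Complex.norm_real, Real.norm_of_nonneg hr.le,
        show ‖H 1 - H 0‖ = r from hlen 0, div_self hr.ne']
    · exact (div_mul_cancel₀ _ hr0).symm
  have hv1 : H 1 = H 0 + u * r := by linear_combination hu
  have hv2 : H 2 = H 0 + u * r + u * (r * rot m q) := by
    linear_combination e0 + hv1 + (rot m q : ℂ) * hu
  have d1 : H 2 - H 1 = u * (r * rot m q) := by linear_combination e0 + (rot m q : ℂ) * hu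
  have d2 : H 3 - H 2 = u * (r * (rot m q * rot m q)) := by
    linear_combination e1 + (rot m q : ℂ) * d1
  have d3 : H 4 - H 3 = -(u * r) := by
    linear_combination e2 - (rot m (-2 * q) : ℂ) * d2 - u * r * hqq
  have d4 : H 5 - H 4 = -(u * (r * rot m q)) := by
    linear_combination e3 + (rot m q : ℂ) * d3
  have hq2 : (rot m q : ℂ) * rot m q = rot m (2 * q) := by
    rw [← Circle.coe_mul, ← rot_add, two_mul]
  rw [hq2] at d2
  have key : ∀ ψ : ℂ ≃ᵢ ℂ, ψ 0 = H 0 → (∀ z w, ψ (z + w) = ψ z + (ψ w - ψ 0)) →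
      ψ (edgeVec m r 0) = H 0 + u * r → ψ (edgeVec m r 1) = H 0 + u * (r * rot m q) →
      ψ (edgeVec m r 2) = H 0 + u * (r * rot m (2 * q)) →
      H = movePolygon ψ (stdHexagon m r) := by
    intro ψ h0 hadd h1 h2 h3
    refine polygon_ext fun i => ?_
    have n1 : (0 : ℤ) + 1 = 1 := rfl
    have n2 : (0 : ℤ) + 2 = 2 := rfl
    fin_cases i <;> simp [movePolygon, stdHexagon, tile, zonogon, hadd, h0, h1, h2, h3]
    · exact hv1
    · exact hv2
    · linear_combination d2 + hv2
    · linear_combination d3 + d2 + hv2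
    · linear_combination d4 + d3 + d2 + hv2
  rcases hq with rfl | rfl
  · refine ⟨r, directIso u (H 0), hr, key _ (by simp) ?_ ?_ ?_ ?_⟩
    · intro z w; simp; ring
    · simp [edgeVec_zero]
    · simp [edgeVec]
    · simp [edgeVec]
  · refine ⟨r, oppositeIso u (H 0), hr, key _ (by simp) ?_ ?_ ?_ ?_⟩
    · intro z w; simp; ring
    · simp [edgeVec_zero]
    · rw [oppositeIso_apply, conj_edgeVec, edgeVec]
    · rw [oppositeIso_apply, conj_edgeVec, edgeVec]; norm_num

lemma angle_edgeVec (hr : 0 < r) {i j : ℤ} (h : i ≤ j) (hm : 2 * (j - i) ≤ m) (hm0 : m ≠ 0) :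
    InnerProductGeometry.angle (edgeVec m r i) (edgeVec m r j) =
      (j - i : ℤ) * (2 * Real.pi / m) := by
  have h0 : (0 : ℝ) ≤ (j - i : ℤ) * (2 * Real.pi / m) := by
    have : (0 : ℝ) ≤ (j - i : ℤ) := by exact_mod_cast (by omega : 0 ≤ j - i)
    positivity
  have h1 : ((j - i : ℤ) : ℝ) * (2 * Real.pi / m) ≤ Real.pi := by
    have : (2 : ℝ) * (j - i : ℤ) ≤ m := by exact_mod_cast hm
    rw [← mul_div_assoc, div_le_iff₀ (by positivity)]
    nlinarith [Real.pi_pos]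
  rw [← Real.arccos_cos h0 h1, InnerProductGeometry.angle, norm_edgeVec hr, norm_edgeVec hr]
  congr 1
  rw [Complex.inner, mul_comm, conj_edgeVec, edgeVec, edgeVec,
    show (r * rot m (-i) : ℂ) * (r * rot m j) = ((r * r : ℝ) : ℂ) * rot m (j - i) by
      rw [sub_eq_add_neg, rot_add, Circle.coe_mul]; push_cast; ring,
    Complex.re_ofReal_mul, rot_re]
  field_simp

lemma dist_stdHexagon (hr : 0 < r) (i : Fin 6) :
    dist (stdHexagon m r i) (stdHexagon m r (finRotate 6 i)) = r := by
  have h := fun k => norm_edgeVec (m := m) hr k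
  rw [dist_eq_norm]
  fin_cases i
  · refine Eq.trans ?_ (h 0); rw [← norm_neg]; congr 1; simp [stdHexagon, tile, zonogon]
  · refine Eq.trans ?_ (h 1); rw [← norm_neg]; congr 1; simp [stdHexagon, tile, zonogon]
  · refine Eq.trans ?_ (h 2); rw [← norm_neg]; congr 1; simp [stdHexagon, tile, zonogon]
  · refine Eq.trans ?_ (h 0); congr 1; simp [stdHexagon, tile, zonogon]
  · refine Eq.trans ?_ (h 1); congr 1; simp [stdHexagon, tile, zonogon]
  · refine Eq.trans ?_ (h 2); congr 1; simp [stdHexagon, tile, zonogon]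

theorem tileCondition3_stdHexagon (hm : 5 ≤ m) (hr : 0 < r) : TileCondition3 m (stdHexagon m r) := by
  have hm0 : m ≠ 0 := by omega
  have hangle : ∀ (i : Fin 6) (j k : ℤ), j ≤ k → 2 * (k - j) ≤ m →
      ((stdHexagon m r ((finRotate 6).symm i) - stdHexagon m r i = -edgeVec m r j ∧
        stdHexagon m r (finRotate 6 i) - stdHexagon m r i = edgeVec m r k) ∨
      (stdHexagon m r ((finRotate 6).symm i) - stdHexagon m r i = edgeVec m r j ∧
        stdHexagon m r (finRotate 6 i) - stdHexagon m r i = -edgeVec m r k)) →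
      interiorAngle (stdHexagon m r) i = Real.pi - (k - j : ℤ) * (2 * Real.pi / m) := by
    rintro i j k hjk hkm (⟨h1, h2⟩ | ⟨h1, h2⟩)
    · rw [interiorAngle_eq, h1, h2, InnerProductGeometry.angle_neg_left, angle_edgeVec hr hjk hkm hm0]
    · rw [interiorAngle_eq, h1, h2, InnerProductGeometry.angle_neg_right, angle_edgeVec hr hjk hkm hm0]
  have hangle' : ∀ (i : Fin 6) (j k : ℤ), j ≤ k → 2 * (k - j) ≤ m →
      ((stdHexagon m r ((finRotate 6).symm i) - stdHexagon m r i = edgeVec m r k ∧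
        stdHexagon m r (finRotate 6 i) - stdHexagon m r i = edgeVec m r j) ∨
      (stdHexagon m r ((finRotate 6).symm i) - stdHexagon m r i = -edgeVec m r k ∧
        stdHexagon m r (finRotate 6 i) - stdHexagon m r i = -edgeVec m r j)) →
      interiorAngle (stdHexagon m r) i = (k - j : ℤ) * (2 * Real.pi / m) := by
    rintro i j k hjk hkm (⟨h1, h2⟩ | ⟨h1, h2⟩)
    · rw [interiorAngle_eq, h1, h2, InnerProductGeometry.angle_comm, angle_edgeVec hr hjk hkm hm0]
    · rw [interiorAngle_eq, h1, h2, InnerProductGeometry.angle_neg_neg, InnerProductGeometry.angle_comm,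
        angle_edgeVec hr hjk hkm hm0]
  have p0 : (finRotate 6).symm 0 = 5 := rfl
  have p1 : (finRotate 6).symm 1 = 0 := rfl
  have p2 : (finRotate 6).symm 2 = 1 := rfl
  have p3 : (finRotate 6).symm 3 = 2 := rfl
  have p4 : (finRotate 6).symm 4 = 3 := rfl
  have p5 : (finRotate 6).symm 5 = 4 := rfl
  have q0 : finRotate 6 0 = 1 := rfl
  have q1 : finRotate 6 1 = 2 := rfl
  have q2 : finRotate 6 2 = 3 := rfl
  have q3 : finRotate 6 3 = 4 := rfl
  have q4 : finRotate 6 4 = 5 := rfl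
  have q5 : finRotate 6 5 = 0 := rfl
  refine ⟨(stdHexagon_isCCW hm hr).isConvexPolygon,
    fun i j => (dist_stdHexagon hr i).trans (dist_stdHexagon hr j).symm, ?_, ?_⟩
  · rintro i (rfl | rfl)
    · rw [hangle' 0 0 2 (by norm_num) (by omega) (Or.inl ?_)]
      · push_cast; ring
      · rw [p0, q0]; simp [stdHexagon, tile, zonogon]
    · rw [hangle' 3 0 2 (by norm_num) (by omega) (Or.inr ?_)]
      · push_cast; ring
      · rw [p3, q3]; simp [stdHexagon, tile, zonogon]
  · rintro i (rfl | rfl | rfl | rfl)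
    · rw [hangle 1 0 1 (by norm_num) (by omega) (Or.inl ?_)]
      · push_cast; ring
      · rw [p1, q1]; simp [stdHexagon, tile, zonogon]
    · rw [hangle 2 1 2 (by norm_num) (by omega) (Or.inl ?_)]
      · push_cast; ring
      · rw [p2, q2]; simp [stdHexagon, tile, zonogon]
    · rw [hangle 4 0 1 (by norm_num) (by omega) (Or.inr ?_)]
      · push_cast; ring
      · rw [p4, q4]; simp [stdHexagon, tile, zonogon]
    · rw [hangle 5 1 2 (by norm_num) (by omega) (Or.inr ?_)]
      · push_cast; ring
      · rw [p5, q5]; simp [stdHexagon, tile, zonogon]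

lemma TileCondition3.tileCondition2 {n : ℕ} (hmn : m = 2 * n) {H : Polygon ℂ 6}
    (h : TileCondition3 m H) : TileCondition2 n H := by
  obtain ⟨h1, h2, h3, h4⟩ := h
  have e : ((m : ℕ) : ℝ) = 2 * n := by rw [hmn]; push_cast; ring
  refine ⟨h1, h2, fun i hi => ?_, fun i hi => ?_⟩
  · rw [h3 i hi, e, show 4 * Real.pi = 2 * (2 * Real.pi) by ring,
      mul_div_mul_left _ _ two_ne_zero]
  · rw [h4 i hi, e, mul_div_mul_left _ _ two_ne_zero]

end Classification

/-! ### Transport along an isometry -/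

section Transport

variable {n : ℕ} {H : Polygon ℂ 6} {i : Fin 6} {x y : ℂ} {ψ : ℂ ≃ᵢ ℂ}

lemma mem_segment_image {g : ℂ ≃ᵢ ℂ} {x z w : ℂ} :
    g x ∈ segment ℝ (g z) (g w) ↔ x ∈ segment ℝ z w := by
  have := _root_.image_segment ℝ (g.toRealAffineIsometryEquiv.toAffineEquiv : ℂ →ᵃ[ℝ] ℂ) z w
  rw [show segment ℝ (g z) (g w) = g '' segment ℝ z w by simpa using this.symm,
    g.injective.mem_set_image]

lemma isBisection_of_movePolygon (hb : IsBisection (movePolygon ψ H) i x y) :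
    IsBisection H i (ψ.symm x) (ψ.symm y) := by
  obtain ⟨h1, h2, h3⟩ := hb
  refine ⟨?_, ?_, ?_⟩
  · rw [← mem_openSegment_image (g := ψ), ψ.apply_symm_apply]; exact h1
  · rw [← mem_openSegment_image (g := ψ), ψ.apply_symm_apply]; exact h2
  · rw [← mem_segment_image (g := ψ), ψ.apply_symm_apply, ψ.apply_symm_apply, hexagonCenter,
      ψ.map_midpoint]
    exact h3

lemma firstHalf_movePolygon :
    firstHalf (movePolygon ψ H) i x y = movePolygon ψ (firstHalf H i (ψ.symm x) (ψ.symm y)) := by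
  refine polygon_ext fun q => ?_
  fin_cases q <;> simp [firstHalf, movePolygon]

lemma secondHalf_movePolygon :
    secondHalf (movePolygon ψ H) i x y = movePolygon ψ (secondHalf H i (ψ.symm x) (ψ.symm y)) := by
  refine polygon_ext fun q => ?_
  fin_cases q <;> simp [secondHalf, movePolygon]

lemma IsConvexPolygon.movePolygon {P : Polygon ℂ n} (h : IsConvexPolygon P) (ψ : ℂ ≃ᵢ ℂ) :
    IsConvexPolygon (movePolygon ψ P) := by
  obtain ⟨s, hs, h⟩ := h
  change ∀ i j : Fin n, j ≠ i → j ≠ finRotate n i →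
    0 < s * cross (P (finRotate n i) - P i) (P j - P i) at h
  obtain ⟨u, hu | hu⟩ := eq_directIso_or_oppositeIso ψ
  · refine ⟨s, hs, fun i j h1 h2 => ?_⟩
    have hd : ∀ a b, ψ a - ψ b = u * (a - b) := by
      intro a b; rw [hu]; simp; ring
    change 0 < s * cross (ψ (P (finRotate n i)) - ψ (P i)) (ψ (P j) - ψ (P i))
    rw [hd, hd, cross_mul_mul, Circle.norm_coe, one_pow, one_mul]
    exact h i j h1 h2
  · refine ⟨-s, by rcases hs with rfl | rfl <;> simp, fun i j h1 h2 => ?_⟩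
    have hd : ∀ a b, ψ a - ψ b = u * conj (a - b) := by
      intro a b; rw [hu]; simp; ring
    change 0 < -s * cross (ψ (P (finRotate n i)) - ψ (P i)) (ψ (P j) - ψ (P i))
    rw [hd, hd, cross_mul_mul, Circle.norm_coe, one_pow, one_mul, cross_conj_conj, neg_mul_neg]
    exact h i j h1 h2

/-- The placements of `movePolygon ψ P` that give the copies of `P` placed by `G`. The set does not
depend on `P`, so that it serves the hexagon and its halves at once. -/
def pullPlacements (ψ : ℂ ≃ᵢ ℂ) (G : Set (ℂ ≃ᵢ ℂ)) : Set (ℂ ≃ᵢ ℂ) := (ψ.symm.trans ·) '' G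

lemma copies_pullPlacements (G : Set (ℂ ≃ᵢ ℂ)) (P : Polygon ℂ n) :
    copies (pullPlacements ψ G) (movePolygon ψ P) = copies G P := by
  have e : ∀ g : ℂ ≃ᵢ ℂ, movePolygon (ψ.symm.trans g) (movePolygon ψ P) = movePolygon g P := by
    intro g
    simp [movePolygon]
  ext Q
  constructor
  · rintro ⟨_, ⟨g, hg, rfl⟩, rfl⟩
    exact ⟨g, hg, e g⟩
  · rintro ⟨g, hg, rfl⟩
    exact ⟨_, ⟨g, hg, rfl⟩, (e g).symm⟩

lemma bisectedPattern_pullPlacements (G : Set (ℂ ≃ᵢ ℂ)) :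
    bisectedPattern (pullPlacements ψ G) (movePolygon ψ H) i x y =
      bisectedPattern G H i (ψ.symm x) (ψ.symm y) := by
  rw [bisectedPattern, firstHalf_movePolygon, secondHalf_movePolygon, copies_pullPlacements,
    copies_pullPlacements, bisectedPattern]

lemma eq_midpoint_movePolygon_iff (a b : Fin 6) :
    x = midpoint ℝ (movePolygon ψ H a) (movePolygon ψ H b) ↔
      ψ.symm x = midpoint ℝ (H a) (H b) := by
  rw [ψ.symm_apply_eq, ψ.map_midpoint]; rfl

lemma isParallelohexagon_movePolygon (m : ℕ) (r : ℝ) :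
    IsParallelohexagon (movePolygon ψ (stdHexagon m r)) := by
  obtain ⟨u, hu | hu⟩ := eq_directIso_or_oppositeIso ψ <;> rw [hu] <;> intro i <;> fin_cases i <;>
    simp [movePolygon, stdHexagon, tile, zonogon] <;> ring

lemma exists_isometry_firstHalf_secondHalf {m : ℕ} {r : ℝ} (hm : 5 ≤ m) (hr : 0 < r)
    (hb : IsBisection (stdHexagon m r) i x y) :
    ∃ g : ℂ ≃ᵢ ℂ, g '' region (firstHalf (stdHexagon m r) i x y) =
      region (secondHalf (stdHexagon m r) i x y) := by
  obtain ⟨-, -, -, -, h⟩ := IsBisection.halves (turning_edgeVec (m := m) hm hr 0) hb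
  refine ⟨IsometryEquiv.subLeft (0 + 0 + edgeVec m r 0 + edgeVec m r (0 + 1) +
    edgeVec m r (0 + 2)), ?_⟩
  rw [← region_movePolygon]
  congr 1
  refine polygon_ext fun q => ?_
  exact (h q).symm

end Transport

end

end PolygonPattern

theorem mainTheorem1 (m : ℕ) (hm : 5 ≤ m) :
    (∃ H : Polygon ℂ 6, PolygonPattern.TileCondition3 m H) ∧
    ∀ H : Polygon ℂ 6, PolygonPattern.TileCondition3 m H →
      PolygonPattern.IsParallelohexagon H ∧
      -- bisecting the hexagon gives two congruent convex pentagons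
      (∀ (i : Fin 6) (x y : ℂ), PolygonPattern.IsBisection H i x y →
        PolygonPattern.IsConvexPolygon (PolygonPattern.firstHalf H i x y) ∧
        PolygonPattern.IsConvexPolygon (PolygonPattern.secondHalf H i x y) ∧
        (∃ g : ℂ ≃ᵢ ℂ, g '' PolygonPattern.region (PolygonPattern.firstHalf H i x y) =
          PolygonPattern.region (PolygonPattern.secondHalf H i x y)) ∧
        PolygonPattern.region (PolygonPattern.firstHalf H i x y) ∪
          PolygonPattern.region (PolygonPattern.secondHalf H i x y) =
            PolygonPattern.region H) ∧
      -- the patterns with a regular `m`-gonal hole with centre `c`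
      (∃ (G : Set (ℂ ≃ᵢ ℂ)) (c w : ℂ), w ≠ 0 ∧
        (∀ k : Fin m, dist (PolygonPattern.regularPolygon m c w k)
          (PolygonPattern.regularPolygon m c w (finRotate m k)) = dist (H 0) (H 1)) ∧
        PolygonPattern.Tiles (PolygonPattern.copies G H)
          (interior (PolygonPattern.region (PolygonPattern.regularPolygon m c w)))ᶜ ∧
        PolygonPattern.EdgeToEdge (PolygonPattern.copies G H) ∧
        (m ≠ 6 → PolygonPattern.symmetries (PolygonPattern.copies G H) =
          PolygonPattern.cyclicSymmetries m c) ∧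
        (m = 6 → ∃ u : ℂ, ‖u‖ = 1 ∧ PolygonPattern.symmetries (PolygonPattern.copies G H) =
          PolygonPattern.dihedralSymmetries 6 c u) ∧
        ∀ (i : Fin 6) (x y : ℂ), PolygonPattern.IsBisection H i x y →
          PolygonPattern.Tiles (PolygonPattern.bisectedPattern G H i x y)
            (interior (PolygonPattern.region (PolygonPattern.regularPolygon m c w)))ᶜ ∧
          ¬ PolygonPattern.EdgeToEdge (PolygonPattern.bisectedPattern G H i x y) ∧
          PolygonPattern.symmetries (PolygonPattern.bisectedPattern G H i x y) =
            PolygonPattern.cyclicSymmetries m c) ∧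
      -- the tilings of the whole plane for even `m`
      (∀ n : ℕ, m = 2 * n →
        PolygonPattern.TileCondition2 n H ∧
        ∃ (G : Set (ℂ ≃ᵢ ℂ)) (c u : ℂ), ‖u‖ = 1 ∧
          PolygonPattern.Tiles (PolygonPattern.copies G H) Set.univ ∧
          PolygonPattern.EdgeToEdge (PolygonPattern.copies G H) ∧
          PolygonPattern.pointGroup (PolygonPattern.copies G H) c =
            PolygonPattern.dihedralSymmetries n c u ∧
          (4 ≤ n → PolygonPattern.symmetries (PolygonPattern.copies G H) =
            PolygonPattern.dihedralSymmetries n c u) ∧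
          ∀ (i : Fin 6) (x y : ℂ), PolygonPattern.IsBisection H i x y →
            PolygonPattern.Tiles (PolygonPattern.bisectedPattern G H i x y) Set.univ ∧
            ¬ PolygonPattern.EdgeToEdge (PolygonPattern.bisectedPattern G H i x y) ∧
            -- the line `xy` joins the midpoints of `BC` and `EF`, or it does not
            ((x = midpoint ℝ (H 1) (H 2) ∨ x = midpoint ℝ (H 4) (H 5)) →
              PolygonPattern.pointGroup (PolygonPattern.bisectedPattern G H i x y) c =
                PolygonPattern.dihedralSymmetries n c u) ∧
            (¬ (x = midpoint ℝ (H 1) (H 2) ∨ x = midpoint ℝ (H 4) (H 5)) →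
              PolygonPattern.pointGroup (PolygonPattern.bisectedPattern G H i x y) c =
                PolygonPattern.cyclicSymmetries n c)) := by
  refine ⟨⟨_, PolygonPattern.tileCondition3_stdHexagon hm one_pos⟩, fun H hH => ?_⟩
  have hH' := hH
  obtain ⟨r, ψ, hr, rfl⟩ := hH.exists_eq_movePolygon
  have hdist : dist (PolygonPattern.movePolygon ψ (PolygonPattern.stdHexagon m r) 0)
      (PolygonPattern.movePolygon ψ (PolygonPattern.stdHexagon m r) 1) = r :=
    (ψ.isometry.dist_eq _ _).trans (PolygonPattern.dist_stdHexagon hr 0)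
  refine ⟨PolygonPattern.isParallelohexagon_movePolygon m r, fun i x y hb => ?_, ?_,
    fun n hmn => ⟨hH'.tileCondition2 hmn, ?_⟩⟩
  · have hb' := PolygonPattern.isBisection_of_movePolygon hb
    obtain ⟨h1, h2, -, -⟩ := PolygonPattern.stdHexagon_halves hm hr hb'
    obtain ⟨g, hg⟩ := PolygonPattern.exists_isometry_firstHalf_secondHalf hm hr hb'
    rw [PolygonPattern.firstHalf_movePolygon, PolygonPattern.secondHalf_movePolygon]
    refine ⟨h1.isConvexPolygon.movePolygon ψ, h2.isConvexPolygon.movePolygon ψ,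
      ⟨(ψ.symm.trans g).trans ψ, ?_⟩, ?_⟩
    · simp only [PolygonPattern.region_movePolygon, ← hg, ← Set.image_comp]
      congr 1
      funext z
      simp
    · simp only [PolygonPattern.region_movePolygon, ← Set.image_union,
        PolygonPattern.stdHexagon_halves_union hm hr hb']
  · refine ⟨PolygonPattern.pullPlacements ψ
      (PolygonPattern.fanPlacements m r (PolygonPattern.holeCorner m r)), 0,
      PolygonPattern.holeVertex m r, PolygonPattern.holeVertex_ne_zero hm hr, ?_⟩
    rw [PolygonPattern.copies_pullPlacements, hdist]
    refine ⟨PolygonPattern.dist_holePolygon hm hr, PolygonPattern.tiles_hole hm hr,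
      (PolygonPattern.isFan_holeCorner hm hr).edgeToEdge hm hr,
      PolygonPattern.symmetries_hole hm hr, ?_, fun i x y hb => ?_⟩
    · rintro rfl
      exact ⟨1, norm_one, PolygonPattern.symmetries_hole_six hr⟩
    · have hb' := PolygonPattern.isBisection_of_movePolygon hb
      rw [PolygonPattern.bisectedPattern_pullPlacements]
      exact ⟨PolygonPattern.tiles_hole_bisected hm hr hb',
        (PolygonPattern.isFan_holeCorner hm hr).not_edgeToEdge hm hr hb',
        PolygonPattern.symmetries_hole_bisected hm hr hb'⟩
  · have hme : Even m := ⟨n, by omega⟩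
    have hfan := PolygonPattern.isFan_starCorner hm hme hr
    refine ⟨PolygonPattern.pullPlacements ψ
      (PolygonPattern.fanPlacements m r (PolygonPattern.starCorner m r)), 0,
      PolygonPattern.rot m 2, Circle.norm_coe _, ?_⟩
    rw [PolygonPattern.copies_pullPlacements, ← PolygonPattern.fanUnion_starCorner hm hme hr]
    refine ⟨hfan.tiles hm hr, hfan.edgeToEdge hm hr, PolygonPattern.pointGroup_star hm hmn hr,
      fun hn => PolygonPattern.symmetries_star hn hmn hr, fun i x y hb => ?_⟩
    have hb' := PolygonPattern.isBisection_of_movePolygon hb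
    rw [PolygonPattern.bisectedPattern_pullPlacements,
      PolygonPattern.eq_midpoint_movePolygon_iff, PolygonPattern.eq_midpoint_movePolygon_iff]
    exact ⟨hfan.tiles_bisected hm hr hb', hfan.not_edgeToEdge hm hr hb',
      PolygonPattern.pointGroup_star_bisected_of_midpoint hm hmn hr hb',
      PolygonPattern.pointGroup_star_bisected_of_ne_midpoint hm hmn hr hb'⟩
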